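/- Let $k$ be a field of characteristic zero. All complexes are cochain complexes of $k$-vector spaces, indexed by $\mathbb{Z}$, and the Koszul sign rule is used throughout. For a complex $V$ let $sV$ be its suspension, $(sV)^p = V^{p+1}$, $d(sv) = -s(dv)$. For a graded vector space $U$ let $Sym^n(U) \subset U^{\otimes n}$ be the space of graded symmetric tensors (the invariants of the symmetric group acting with Koszul signs). $Sym_a(V) = \bigoplus_{n\ge 0} Sym^n(V)$ denotes the graded commutative algebra of symmetric tensors, the product being the symmetrization (average over permutations) of the tensor product, and $Sym_c(sV) = \bigoplus_{n \ge 0} Sym^n(sV)$ the cocommutative coalgebra of symmetric tensors, the coproduct being deconcatenation; both carry the differential induced by that of $V$. Let $E(V) = Sym_a(V)$, and let $A(V) = \Omega\, Sym_c(sV)$ be the reduced cobar construction, i.e. the tensor algebra on $s^{-1} Sym^{\ge 1}(sV)$ whose differential $d$ is the derivation given on generators by $$ d(s^{-1}x) = - s^{-1}(dx) + \sum (-1)^{\deg x'} s^{-1}x' \otimes s^{-1}x'', \qquad \overline{\Delta} x = \sum x' \otimes x'' . $$ Let $f_V : A(V) \to E(V)$ be the algebra map extending the projection $s^{-1}Sym^{\ge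 1}(sV) \to s^{-1}Sym^1(sV) = V$, let $g_V : E(V) \to A(V)$ be the map given on each $Sym^n(V)$ by the composition of the natural embeddings $$ Sym^n(V) \hookrightarrow V^{\otimes n} \hookrightarrow T(V) \hookrightarrow T(s^{-1} Sym^{\ge 1}(sV)) = A(V), $$ and let $\iota_\Omega$ be the (graded) algebra anti-involution of $A(V)$ that acts by $-1$ on the generators $s^{-1}Sym^{\ge 1}(sV)$. **Theorem 1.** $A(V)$ and $E(V)$ are complexes, $f_V$ and $g_V$ are maps of complexes, and $f_V g_V = 1$. Moreover, there is a system of linear maps $h_V : A(V) \to A(V)$ of degree $-1$, one for each complex $V$, such that for every $V$ $$ 1 - g_V f_V = d h_V + h_V d, \qquad f_V h_V = 0, \qquad h_V g_V = 0, \qquad h_V h_V = 0, $$ such that for every morphism of complexes $\phi : V \to W$ the induced algebra map $A(\phi) : A(V) \to A(W)$ satisfies $h_W\, A(\phi) = A(\phi)\, h_V$, and such that $h_V \iota_\Omega = \iota_\Omega h_V$ for every $V$. -/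

import Mathlib

open CategoryTheory
open scoped TensorProduct DirectSum

universe u v w

noncomputable section

namespace SymCobar

section Generic

variable {k : Type u} [Field k] {M : Type v} [AddCommGroup M] [Module k M]
  {N : Type w} [AddCommGroup N] [Module k N]

/-- The scalar `(-1)^b`, where `true` stands for odd and `false` for even. -/
def boolSign (k : Type u) [Field k] (b : Bool) : k := if b then -1 else 1

/-- Let `ε` be the parity involution `v ↦ (-1)^(deg v) v` of a graded vector space.
`parityProj ε false` and `parityProj ε true` are the projections onto the even and the odd part. -/
def parityProj (ε : M →ₗ[k] M) (b : Bool) : M →ₗ[k] M :=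
  (2⁻¹ : k) • (LinearMap.id + boolSign k b • ε)

/-- The Koszul sign of moving the `i`-th factor to position `σ i` for all `i`, where `e i` says
whether the `i`-th factor is odd: each pair of odd factors that changes its order contributes
`-1`. -/
def koszulSign {n : ℕ} (σ : Equiv.Perm (Fin n)) (e : Fin n → Bool) : ℤˣ :=
  ∏ p : Fin n × Fin n with p.1 < p.2 ∧ σ p.2 < σ p.1, if e p.1 && e p.2 then -1 else 1

/-- The graded action of a permutation `σ` on `M^{⊗ n}`: it moves the `i`-th factor to
position `σ i`, with the Koszul sign. A general tensor is split into its parity components. -/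
def koszulAct (ε : M →ₗ[k] M) {n : ℕ} (σ : Equiv.Perm (Fin n)) : (⨂[k]^n M) →ₗ[k] (⨂[k]^n M) :=
  ∑ e : Fin n → Bool, (((koszulSign σ e : ℤˣ) : ℤ) : k) •
    ((PiTensorProduct.reindex k (fun _ : Fin n => M) σ).toLinearMap ∘ₗ
      PiTensorProduct.map (fun i => parityProj ε (e i)))

/-- `Sym^n`: the graded symmetric tensors, that is, the tensors in `M^{⊗ n}` that are invariant
under the graded action of the symmetric group. -/
def SymPow (ε : M →ₗ[k] M) (n : ℕ) : Submodule k (⨂[k]^n M) where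
  carrier := {x | ∀ σ : Equiv.Perm (Fin n), koszulAct ε σ x = x}
  add_mem' hx hy σ := by rw [map_add, hx σ, hy σ]
  zero_mem' σ := map_zero _
  smul_mem' c x hx σ := by rw [map_smul, hx σ]

/-- The average over the graded action of the symmetric group on `M^{⊗ n}`. -/
def symmetrizer (ε : M →ₗ[k] M) (n : ℕ) : (⨂[k]^n M) →ₗ[k] (⨂[k]^n M) :=
  ((n.factorial : k)⁻¹) • ∑ σ : Equiv.Perm (Fin n), koszulAct ε σ

/-- The differential of `M^{⊗ n}` induced by the differential `d` of `M`, with Koszul signs: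
the sum over `i` of `ε ⊗ ⋯ ⊗ ε ⊗ d ⊗ 1 ⊗ ⋯ ⊗ 1` with `d` in position `i`. -/
def tensorD (ε d : M →ₗ[k] M) (n : ℕ) : (⨂[k]^n M) →ₗ[k] (⨂[k]^n M) :=
  ∑ i : Fin n, PiTensorProduct.map
    (fun j => if j < i then ε else if j = i then d else LinearMap.id)

/-! ### Helper facts -/

lemma prod_pairs_comp {n : ℕ} (F : Fin n → Fin n → ℤˣ) (hF : ∀ i j, F i j = F j i)
    (τ : Equiv.Perm (Fin n)) :
    ∏ p : Fin n × Fin n with p.1 < p.2, F (τ p.1) (τ p.2) =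
      ∏ p : Fin n × Fin n with p.1 < p.2, F p.1 p.2 := by
  refine Finset.prod_nbij' (fun p => if τ p.1 < τ p.2 then (τ p.1, τ p.2) else (τ p.2, τ p.1))
    (fun p => if τ⁻¹ p.1 < τ⁻¹ p.2 then (τ⁻¹ p.1, τ⁻¹ p.2) else (τ⁻¹ p.2, τ⁻¹ p.1)) ?_ ?_ ?_ ?_ ?_
  · rintro ⟨i, j⟩ h
    simp only [Finset.mem_filter_univ] at h ⊢
    split_ifs with h1
    · exact h1
    · exact lt_of_le_of_ne (not_lt.1 h1) fun h2 => h.ne (τ.injective h2.symm)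
  · rintro ⟨i, j⟩ h
    simp only [Finset.mem_filter_univ] at h ⊢
    split_ifs with h1
    · exact h1
    · exact lt_of_le_of_ne (not_lt.1 h1) fun h2 => h.ne ((τ⁻¹).injective h2.symm)
  · rintro ⟨i, j⟩ h
    simp only [Finset.mem_filter_univ] at h ⊢
    split_ifs <;> simp_all [lt_asymm]
  · rintro ⟨i, j⟩ h
    simp only [Finset.mem_filter_univ] at h ⊢
    split_ifs <;> simp_all [lt_asymm]
  · rintro ⟨i, j⟩ h
    dsimp only
    split_ifs
    · rfl
    · exact hF _ _

lemma koszulSign_eq {n : ℕ} (σ : Equiv.Perm (Fin n)) (e : Fin n → Bool) :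
    koszulSign σ e = ∏ p : Fin n × Fin n with p.1 < p.2,
      if e p.1 = true ∧ e p.2 = true ∧ σ p.2 < σ p.1 then (-1 : ℤˣ) else 1 := by
  rw [koszulSign, ← Finset.filter_filter, Finset.prod_filter]
  refine Finset.prod_congr rfl fun p _ => ?_
  split_ifs <;> simp_all

lemma koszulSign_mul {n : ℕ} (σ τ : Equiv.Perm (Fin n)) (e : Fin n → Bool) :
    koszulSign (σ * τ) e = koszulSign σ (fun i => e (τ.symm i)) * koszulSign τ e := by
  have h1 : koszulSign σ (fun i => e (τ.symm i)) = ∏ p : Fin n × Fin n with p.1 < p.2,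
      if e (τ.symm p.1) = true ∧ e (τ.symm p.2) = true ∧
        ((p.1 < p.2 ∧ σ p.2 < σ p.1) ∨ (p.2 < p.1 ∧ σ p.1 < σ p.2)) then (-1 : ℤˣ) else 1 := by
    rw [koszulSign_eq]
    refine Finset.prod_congr rfl fun p hp => ?_
    rw [Finset.mem_filter_univ] at hp
    have : ¬ p.2 < p.1 := not_lt_of_gt hp
    simp [hp, this]
  rw [h1, ← prod_pairs_comp (fun i j => if e (τ.symm i) = true ∧ e (τ.symm j) = true ∧
        ((i < j ∧ σ j < σ i) ∨ (j < i ∧ σ i < σ j)) then (-1 : ℤˣ) else 1) _ τ,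
    koszulSign_eq, koszulSign_eq, ← Finset.prod_mul_distrib]
  · refine Finset.prod_congr rfl fun p hp => ?_
    obtain ⟨i, j⟩ := p
    simp only [Finset.mem_filter_univ] at hp
    simp only [Equiv.symm_apply_apply, Equiv.Perm.mul_apply]
    have ht : τ i ≠ τ j := fun h => hp.ne (τ.injective h)
    have hs : σ (τ i) ≠ σ (τ j) := fun h => ht (σ.injective h)
    rcases lt_or_gt_of_ne ht with h2 | h2 <;> rcases lt_or_gt_of_ne hs with h3 | h3 <;>
      cases e i <;> cases e j <;> simp [h2, h3, not_lt_of_gt h2, not_lt_of_gt h3]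
  · intro i j
    congr 1
    exact propext (by tauto)

lemma koszulSign_one {n : ℕ} (e : Fin n → Bool) : koszulSign (1 : Equiv.Perm (Fin n)) e = 1 := by
  rw [koszulSign_eq]
  refine Finset.prod_eq_one fun p hp => ?_
  rw [Finset.mem_filter_univ] at hp
  simp [not_lt_of_gt hp]

lemma koszulSign_eq' {n : ℕ} (σ : Equiv.Perm (Fin n)) (e : Fin n → Bool) :
    koszulSign σ e = ∏ a, ∏ b,
      if e a = true ∧ e b = true ∧ a < b ∧ σ b < σ a then (-1 : ℤˣ) else 1 := by
  rw [koszulSign, Finset.prod_filter, Fintype.prod_prod_type]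
  refine Finset.prod_congr rfl fun a _ => Finset.prod_congr rfl fun b _ => ?_
  split_ifs <;> simp_all

lemma koszulSign_update {n : ℕ} (σ : Equiv.Perm (Fin n)) (e : Fin n → Bool) (i : Fin n) :
    (∏ j, if j < i ∧ e j = true then (-1 : ℤˣ) else 1) *
        koszulSign σ (Function.update e i (!e i)) =
      koszulSign σ e * ∏ j, if σ j < σ i ∧ e j = true then (-1 : ℤˣ) else 1 := by
  have h : ∀ a b : Fin n, (if Function.update e i (!e i) a = true ∧
      Function.update e i (!e i) b = true ∧ a < b ∧ σ b < σ a then (-1 : ℤˣ) else 1) =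
      (if e a = true ∧ e b = true ∧ a < b ∧ σ b < σ a then (-1 : ℤˣ) else 1) *
      ((if a = i then (if i < b ∧ σ b < σ i ∧ e b = true then (-1 : ℤˣ) else 1) else 1) *
      (if b = i then (if a < i ∧ σ i < σ a ∧ e a = true then (-1 : ℤˣ) else 1) else 1)) := by
    intro a b
    by_cases ha : a = i <;> by_cases hb : b = i
    · subst ha; subst hb; simp
    · subst ha
      cases hea : e a <;> cases heb : e b <;> simp [hb, heb]
      split_ifs <;> simp
    · subst hb
      cases hea : e a <;> cases heb : e b <;> simp [ha, hea]
      split_ifs <;> simp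
    · simp [ha, hb]
  rw [koszulSign_eq', koszulSign_eq']
  simp only [h, Finset.prod_mul_distrib]
  rw [mul_left_comm]
  congr 1
  have h2 : (∏ x : Fin n, ∏ x_1 : Fin n,
      if x = i then (if i < x_1 ∧ σ x_1 < σ i ∧ e x_1 = true then (-1 : ℤˣ) else 1) else 1) =
      ∏ b, if i < b ∧ σ b < σ i ∧ e b = true then (-1 : ℤˣ) else 1 := by
    rw [Finset.prod_comm]
    simp
  rw [h2]
  simp only [Finset.prod_ite_eq', Finset.mem_univ, if_true]
  rw [← Finset.prod_mul_distrib, ← Finset.prod_mul_distrib]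
  refine Finset.prod_congr rfl fun j _ => ?_
  rcases lt_trichotomy i j with h3 | h3 | h3
  · rcases lt_or_gt_of_ne (fun h => h3.ne (σ.injective h) : σ i ≠ σ j) with h4 | h4 <;>
      cases e j <;> simp [h3, h4, not_lt_of_gt h3, not_lt_of_gt h4]
  · subst h3; simp
  · rcases lt_or_gt_of_ne (fun h => h3.ne (σ.injective h) : σ j ≠ σ i) with h4 | h4 <;>
      cases e j <;> simp [h3, h4, not_lt_of_gt h3, not_lt_of_gt h4]

lemma koszulSign_append {p q : ℕ} (σ : Equiv.Perm (Fin p)) (τ : Equiv.Perm (Fin q))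
    (e : Fin p → Bool) (f : Fin q → Bool) :
    koszulSign (finSumFinEquiv.permCongr (Equiv.sumCongr σ τ)) (Fin.append e f) =
      koszulSign σ e * koszulSign τ f := by
  simp only [koszulSign_eq', Fin.prod_univ_add, Finset.prod_mul_distrib, Fin.append_left,
    Fin.append_right, Equiv.permCongr_apply, finSumFinEquiv_symm_apply_castAdd,
    finSumFinEquiv_symm_apply_natAdd, Equiv.sumCongr_apply, Sum.map_inl, Sum.map_inr,
    finSumFinEquiv_apply_left, finSumFinEquiv_apply_right]
  have h1 : ∀ (a : Fin p) (b : Fin q), Fin.castAdd q a < Fin.natAdd p b := fun a b => by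
    rw [Fin.lt_def, Fin.val_castAdd, Fin.val_natAdd]; omega
  have h2 : ∀ a b : Fin p, Fin.castAdd q a < Fin.castAdd q b ↔ a < b := fun a b => Iff.rfl
  simp [h1, h2, fun a b => not_lt_of_gt (h1 a b)]

lemma pure_map {ε : M →ₗ[k] M} {ε' : N →ₗ[k] N} {φ : M →ₗ[k] N} (hφ : φ ∘ₗ ε = ε' ∘ₗ φ)
    {v : M} {b : Bool} (hv : ε v = boolSign k b • v) : ε' (φ v) = boolSign k b • φ v := by
  rw [← map_smul, ← hv]
  exact (LinearMap.congr_fun hφ v).symm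

lemma tensorD_pure {ε d : M →ₗ[k] M} {n : ℕ} {e : Fin n → Bool} {v : Fin n → M}
    (hv : ∀ i, ε (v i) = boolSign k (e i) • v i) :
    tensorD ε d n (PiTensorProduct.tprod k v) =
      ∑ i, (((∏ j, if j < i ∧ e j = true then (-1 : ℤˣ) else 1 : ℤˣ) : ℤ) : k) •
        PiTensorProduct.tprod k (Function.update v i (d (v i))) := by
  rw [tensorD, LinearMap.sum_apply]
  refine Finset.sum_congr rfl fun i _ => ?_
  rw [PiTensorProduct.map_tprod]
  have h : ∀ j, (if j < i then ε else if j = i then d else LinearMap.id) (v j) =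
      (if j < i ∧ e j = true then (-1 : k) else 1) • Function.update v i (d (v i)) j := by
    intro j
    rcases lt_trichotomy j i with hj | rfl | hj
    · rw [if_pos hj, Function.update_of_ne hj.ne, hv]
      cases e j <;> simp [boolSign, hj]
    · simp
    · simp [not_lt_of_gt hj, hj.ne']
  simp only [h]
  rw [MultilinearMap.map_smul_univ]
  congr 1
  push_cast
  refine Finset.prod_congr rfl fun j _ => ?_
  split_ifs <;> simp

lemma mulEquiv_tprod {p q : ℕ} (a : Fin p → M) (b : Fin q → M) :
    TensorPower.mulEquiv (PiTensorProduct.tprod k a ⊗ₜ[k] PiTensorProduct.tprod k b) =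
      PiTensorProduct.tprod k (Fin.append a b) :=
  TensorPower.tprod_mul_tprod k a b

section CharZero

variable [CharZero k]

lemma parityProj_pure {ε : M →ₗ[k] M} {v : M} {b : Bool} (hv : ε v = boolSign k b • v)
    (c : Bool) : parityProj ε c v = if c = b then v else 0 := by
  cases b <;> cases c <;> simp [parityProj, boolSign] at hv ⊢ <;> rw [hv] <;>
    module

lemma parityProj_mem {ε : M →ₗ[k] M} (hε : ε ∘ₗ ε = LinearMap.id) (b : Bool) (v : M) :
    ε (parityProj ε b v) = boolSign k b • parityProj ε b v := by
  have h : ε (ε v) = v := LinearMap.congr_fun hε v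
  cases b <;> simp [parityProj, boolSign, h] <;> module

lemma parityProj_add (ε : M →ₗ[k] M) (v : M) :
    ∑ b : Bool, parityProj ε b v = v := by
  simp [parityProj, boolSign]
  module

/-- Linear maps out of `M^{⊗ n}` agree if they agree on tensors of homogeneous vectors. -/
lemma ext_pure {P : Type*} [AddCommGroup P] [Module k P] {ε : M →ₗ[k] M}
    (hε : ε ∘ₗ ε = LinearMap.id) {n : ℕ} {f g : (⨂[k]^n M) →ₗ[k] P}
    (h : ∀ (e : Fin n → Bool) (v : Fin n → M), (∀ i, ε (v i) = boolSign k (e i) • v i) →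
      f (PiTensorProduct.tprod k v) = g (PiTensorProduct.tprod k v)) : f = g := by
  refine PiTensorProduct.ext (MultilinearMap.ext fun v => ?_)
  have hv : v = fun i => ∑ b : Bool, parityProj ε b (v i) :=
    funext fun i => (parityProj_add ε (v i)).symm
  rw [hv, MultilinearMap.map_sum, MultilinearMap.map_sum]
  exact Finset.sum_congr rfl fun e _ => h e _ fun i => parityProj_mem hε _ _

lemma koszulAct_pure {ε : M →ₗ[k] M} {n : ℕ} (σ : Equiv.Perm (Fin n)) {e : Fin n → Bool}
    {v : Fin n → M} (hv : ∀ i, ε (v i) = boolSign k (e i) • v i) :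
    koszulAct ε σ (PiTensorProduct.tprod k v) =
      (((koszulSign σ e : ℤˣ) : ℤ) : k) • PiTensorProduct.tprod k (fun i => v (σ.symm i)) := by
  simp only [koszulAct, LinearMap.sum_apply, LinearMap.smul_apply, LinearMap.comp_apply,
    PiTensorProduct.map_tprod, LinearEquiv.coe_coe, PiTensorProduct.reindex_tprod]
  rw [Finset.sum_eq_single e]
  · congr 2
    ext i
    rw [parityProj_pure (hv _), if_pos rfl]
  · intro e' _ hne
    obtain ⟨i, hi⟩ := Function.ne_iff.1 hne
    rw [MultilinearMap.map_coord_zero _ (σ i), smul_zero]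
    rw [parityProj_pure (hv _), if_neg]
    simpa using hi
  · intro h
    exact absurd (Finset.mem_univ _) h

lemma koszulAct_one {ε : M →ₗ[k] M} (hε : ε ∘ₗ ε = LinearMap.id) (n : ℕ) :
    koszulAct ε (1 : Equiv.Perm (Fin n)) = LinearMap.id := by
  refine ext_pure hε fun e v hv => ?_
  rw [koszulAct_pure _ hv, koszulSign_one]
  rw [Units.val_one, Int.cast_one, one_smul]
  rfl

lemma koszulAct_mul {ε : M →ₗ[k] M} (hε : ε ∘ₗ ε = LinearMap.id) {n : ℕ}
    (σ τ : Equiv.Perm (Fin n)) :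
    koszulAct ε (σ * τ) = koszulAct ε σ ∘ₗ koszulAct ε τ := by
  refine ext_pure hε fun e v hv => ?_
  rw [LinearMap.comp_apply, koszulAct_pure _ hv, koszulAct_pure _ hv, map_smul,
    koszulAct_pure (e := fun i => e (τ.symm i)) _ (fun i => hv _), koszulSign_mul, smul_smul]
  congr 1
  push_cast
  ring

lemma koszulAct_comp_symmetrizer {ε : M →ₗ[k] M} (hε : ε ∘ₗ ε = LinearMap.id) {n : ℕ}
    (σ : Equiv.Perm (Fin n)) :
    koszulAct ε σ ∘ₗ symmetrizer ε n = symmetrizer ε n := by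
  ext1
  ext v
  simp only [symmetrizer, LinearMap.compMultilinearMap_apply, LinearMap.comp_apply,
    LinearMap.smul_apply, LinearMap.sum_apply, map_smul, map_sum]
  congr 1
  refine Fintype.sum_equiv (Equiv.mulLeft σ) _ _ fun τ => ?_
  rw [Equiv.coe_mulLeft, koszulAct_mul hε, LinearMap.comp_apply]

lemma symmetrizer_comp_koszulAct {ε : M →ₗ[k] M} (hε : ε ∘ₗ ε = LinearMap.id) {n : ℕ}
    (σ : Equiv.Perm (Fin n)) :
    symmetrizer ε n ∘ₗ koszulAct ε σ = symmetrizer ε n := by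
  ext1
  ext v
  simp only [symmetrizer, LinearMap.compMultilinearMap_apply, LinearMap.comp_apply,
    LinearMap.smul_apply, LinearMap.sum_apply]
  congr 1
  refine Fintype.sum_equiv (Equiv.mulRight σ) _ _ fun τ => ?_
  rw [Equiv.coe_mulRight, koszulAct_mul hε, LinearMap.comp_apply]

lemma symmetrizer_of_mem {ε : M →ₗ[k] M} {n : ℕ} {x : ⨂[k]^n M} (hx : x ∈ SymPow ε n) :
    symmetrizer ε n x = x := by
  have h : ∀ σ : Equiv.Perm (Fin n), koszulAct ε σ x = x := hx
  rw [symmetrizer, LinearMap.smul_apply, LinearMap.sum_apply]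
  simp only [h, Finset.sum_const, Finset.card_univ, Fintype.card_perm, Fintype.card_fin]
  rw [← Nat.cast_smul_eq_nsmul k, smul_smul, inv_mul_cancel₀, one_smul]
  exact_mod_cast Nat.factorial_ne_zero n

/-- The projection `M^{⊗ n} → Sym^n` given by averaging over the symmetric group. -/
def symProj {ε : M →ₗ[k] M} (hε : ε ∘ₗ ε = LinearMap.id) (n : ℕ) :
    (⨂[k]^n M) →ₗ[k] SymPow ε n :=
  (symmetrizer ε n).codRestrict (SymPow ε n) fun x σ =>
    LinearMap.congr_fun (koszulAct_comp_symmetrizer hε σ) x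

lemma symProj_of_mem {ε : M →ₗ[k] M} (hε : ε ∘ₗ ε = LinearMap.id) {n : ℕ} (x : SymPow ε n) :
    symProj hε n x = x :=
  Subtype.ext (symmetrizer_of_mem x.2)

lemma koszulAct_map {ε : M →ₗ[k] M} {ε' : N →ₗ[k] N} (hε : ε ∘ₗ ε = LinearMap.id)
    {φ : M →ₗ[k] N} (hφ : φ ∘ₗ ε = ε' ∘ₗ φ) {n : ℕ} (σ : Equiv.Perm (Fin n)) :
    koszulAct ε' σ ∘ₗ PiTensorProduct.map (fun _ => φ) =
      PiTensorProduct.map (fun _ => φ) ∘ₗ koszulAct ε σ := by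
  refine ext_pure hε fun e v hv => ?_
  rw [LinearMap.comp_apply, LinearMap.comp_apply, koszulAct_pure _ hv, map_smul,
    PiTensorProduct.map_tprod, PiTensorProduct.map_tprod,
    koszulAct_pure _ fun i => pure_map hφ (hv i)]

/-- The map `Sym^n M → Sym^n N` induced by a parity preserving map `M → N`. -/
def symMap {ε : M →ₗ[k] M} {ε' : N →ₗ[k] N} (hε : ε ∘ₗ ε = LinearMap.id)
    (φ : M →ₗ[k] N) (hφ : φ ∘ₗ ε = ε' ∘ₗ φ) (n : ℕ) : SymPow ε n →ₗ[k] SymPow ε' n :=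
  (PiTensorProduct.map (fun _ => φ)).restrict fun x hx σ => by
    have h := LinearMap.congr_fun (koszulAct_map hε hφ σ) x
    rw [LinearMap.comp_apply, LinearMap.comp_apply, hx σ] at h
    exact h

lemma koszulAct_tensorD {ε d : M →ₗ[k] M} (hε : ε ∘ₗ ε = LinearMap.id)
    (hd : d ∘ₗ ε = -(ε ∘ₗ d)) {n : ℕ} (σ : Equiv.Perm (Fin n)) :
    koszulAct ε σ ∘ₗ tensorD ε d n = tensorD ε d n ∘ₗ koszulAct ε σ := by
  refine ext_pure hε fun e v hv => ?_
  rw [LinearMap.comp_apply, LinearMap.comp_apply, koszulAct_pure _ hv, map_smul,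
    tensorD_pure hv, tensorD_pure (e := fun i => e (σ.symm i)) (fun i => hv _), map_sum,
    Finset.smul_sum]
  refine Fintype.sum_equiv σ _ _ fun i => ?_
  have hv' : ∀ j, ε (Function.update v i (d (v i)) j) =
      boolSign k (Function.update e i (!e i) j) • Function.update v i (d (v i)) j := by
    intro j
    rcases eq_or_ne j i with rfl | hj
    · have h := LinearMap.congr_fun hd (v j)
      rw [LinearMap.comp_apply, hv, map_smul, LinearMap.neg_apply, LinearMap.comp_apply] at h
      rw [Function.update_self, Function.update_self, ← neg_inj, ← h]
      cases e j <;> simp [boolSign]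
    · rw [Function.update_of_ne hj, Function.update_of_ne hj, hv]
  rw [map_smul, koszulAct_pure _ hv', smul_smul, smul_smul]
  congr 1
  · have h := koszulSign_update σ e i
    rw [Fintype.prod_equiv σ (fun j => if σ j < σ i ∧ e j = true then (-1 : ℤˣ) else 1)
      (fun j => if j < σ i ∧ e (σ.symm j) = true then (-1 : ℤˣ) else 1) (by simp)] at h
    exact_mod_cast congrArg (fun z : ℤˣ => ((z : ℤ) : k)) h
  · congr 1
    ext j
    rw [Equiv.symm_apply_apply]
    rcases eq_or_ne j (σ i) with rfl | hj
    · simp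
    · rw [Function.update_of_ne hj, Function.update_of_ne]
      rwa [Ne, Equiv.symm_apply_eq]

/-- The differential of `Sym^n`: the restriction of the differential of `M^{⊗ n}`. -/
def symD {ε d : M →ₗ[k] M} (hε : ε ∘ₗ ε = LinearMap.id) (hd : d ∘ₗ ε = -(ε ∘ₗ d)) (n : ℕ) :
    SymPow ε n →ₗ[k] SymPow ε n :=
  (tensorD ε d n).restrict fun x hx σ => by
    have h := LinearMap.congr_fun (koszulAct_tensorD hε hd σ) x
    rw [LinearMap.comp_apply, LinearMap.comp_apply, hx σ] at h
    exact h

lemma koszulAct_append {ε : M →ₗ[k] M} (hε : ε ∘ₗ ε = LinearMap.id) {p q : ℕ}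
    (σ : Equiv.Perm (Fin p)) (τ : Equiv.Perm (Fin q)) (x : ⨂[k]^p M) (y : ⨂[k]^q M) :
    koszulAct ε (finSumFinEquiv.permCongr (Equiv.sumCongr σ τ))
        (TensorPower.mulEquiv (x ⊗ₜ[k] y)) =
      TensorPower.mulEquiv (koszulAct ε σ x ⊗ₜ[k] koszulAct ε τ y) := by
  let B : (⨂[k]^p M) →ₗ[k] (⨂[k]^q M) →ₗ[k] (⨂[k]^(p + q) M) :=
    (TensorProduct.mk k _ _).compr₂ (TensorPower.mulEquiv (R := k) (M := M)).toLinearMap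
  have h : B.compr₂ (koszulAct ε (finSumFinEquiv.permCongr (Equiv.sumCongr σ τ))) =
      B.compl₁₂ (koszulAct ε σ) (koszulAct ε τ) := by
    refine ext_pure hε fun e v hv => ext_pure hε fun f w hw => ?_
    simp only [B, LinearMap.compr₂_apply, LinearMap.compl₁₂_apply, TensorProduct.mk_apply,
      LinearEquiv.coe_coe]
    rw [koszulAct_pure _ hv, koszulAct_pure _ hw, ← TensorProduct.smul_tmul', TensorProduct.tmul_smul,
      map_smul, map_smul, mulEquiv_tprod, mulEquiv_tprod,
      koszulAct_pure (e := Fin.append e f), koszulSign_append, smul_smul]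
    · congr 1
      · push_cast; rfl
      · congr 1
        ext i
        refine Fin.addCases (fun i => ?_) (fun i => ?_) i
        · simp [Equiv.permCongr_def]
        · simp [Equiv.permCongr_def]
    · intro i
      refine Fin.addCases (fun i => ?_) (fun i => ?_) i
      · simpa using hv i
      · simpa using hw i
  exact LinearMap.congr_fun₂ h x y

lemma symmetrizer_mul {ε : M →ₗ[k] M} (hε : ε ∘ₗ ε = LinearMap.id) {p q : ℕ}
    (x : ⨂[k]^p M) (y : ⨂[k]^q M) :
    symmetrizer ε (p + q) (TensorPower.mulEquiv (symmetrizer ε p x ⊗ₜ[k] symmetrizer ε q y)) =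
      symmetrizer ε (p + q) (TensorPower.mulEquiv (x ⊗ₜ[k] y)) := by
  have h : ∀ (σ : Equiv.Perm (Fin p)) (τ : Equiv.Perm (Fin q)),
      symmetrizer ε (p + q)
        (TensorPower.mulEquiv (koszulAct ε σ x ⊗ₜ[k] koszulAct ε τ y)) =
      symmetrizer ε (p + q) (TensorPower.mulEquiv (x ⊗ₜ[k] y)) := fun σ τ => by
    rw [← koszulAct_append hε]
    exact LinearMap.congr_fun (symmetrizer_comp_koszulAct hε _) _
  have h2 : symmetrizer ε p x ⊗ₜ[k] symmetrizer ε q y =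
      (p.factorial : k)⁻¹ • (q.factorial : k)⁻¹ • ∑ σ : Equiv.Perm (Fin p),
        ∑ τ : Equiv.Perm (Fin q), koszulAct ε σ x ⊗ₜ[k] koszulAct ε τ y := by
    simp only [symmetrizer, LinearMap.smul_apply, LinearMap.sum_apply,
      ← TensorProduct.smul_tmul', TensorProduct.tmul_smul, TensorProduct.sum_tmul,
      TensorProduct.tmul_sum]
    rw [← Finset.smul_sum, smul_comm, Finset.sum_comm]
  rw [h2]
  simp only [map_smul, map_sum, h, Finset.sum_const, Finset.card_univ, Fintype.card_perm,
    Fintype.card_fin]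
  rw [← Nat.cast_smul_eq_nsmul k, ← Nat.cast_smul_eq_nsmul k, smul_comm (q.factorial : k)⁻¹,
    inv_smul_smul₀, inv_smul_smul₀]
  all_goals exact_mod_cast Nat.factorial_ne_zero _

/-- Deconcatenation `v₁ ⊗ ⋯ ⊗ vₙ ↦ (v₁ ⊗ ⋯ ⊗ v_p) ⊗ (v_{p+1} ⊗ ⋯ ⊗ vₙ)` for `n = p + q`. -/
def deconc {n p q : ℕ} (h : n = p + q) : (⨂[k]^n M) →ₗ[k] (⨂[k]^p M) ⊗[k] (⨂[k]^q M) :=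
  TensorPower.mulEquiv.symm.toLinearMap ∘ₗ (TensorPower.cast k M h).toLinearMap

/-- The component `Sym^n → Sym^p ⊗ Sym^q` of the coproduct, for `n = p + q`: the restriction of
deconcatenation to symmetric tensors. Since the deconcatenation of a symmetric tensor lies in
`Sym^p ⊗ Sym^q` (see `comulComp_spec`), the projections onto symmetric tensors that are applied
afterwards only adjust the codomain. -/
def comulComp {ε : M →ₗ[k] M} (hε : ε ∘ₗ ε = LinearMap.id) {n p q : ℕ} (h : n = p + q) :
    SymPow ε n →ₗ[k] SymPow ε p ⊗[k] SymPow ε q :=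
  TensorProduct.map (symProj hε p) (symProj hε q) ∘ₗ deconc h ∘ₗ (SymPow ε n).subtype

lemma comulComp_spec {ε : M →ₗ[k] M} (hε : ε ∘ₗ ε = LinearMap.id) {n p q : ℕ} (h : n = p + q)
    (x : SymPow ε n) :
    TensorProduct.map (SymPow ε p).subtype (SymPow ε q).subtype (comulComp hε h x) =
      deconc h (x : ⨂[k]^n M) := by
  subst h
  have key : ∀ (σ : Equiv.Perm (Fin p)) (τ : Equiv.Perm (Fin q)),
      TensorProduct.map (koszulAct ε σ) (koszulAct ε τ) (deconc rfl (x : ⨂[k]^(p + q) M)) =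
        deconc rfl (x : ⨂[k]^(p + q) M) := by
    intro σ τ
    have h1 : ∀ y : (⨂[k]^p M) ⊗[k] (⨂[k]^q M),
        TensorPower.mulEquiv (TensorProduct.map (koszulAct ε σ) (koszulAct ε τ) y) =
        koszulAct ε (finSumFinEquiv.permCongr (Equiv.sumCongr σ τ)) (TensorPower.mulEquiv y) := by
      intro y
      induction y using TensorProduct.induction_on with
      | zero => simp only [map_zero]
      | add a b ha hb => simp only [map_add, ha, hb]
      | tmul a b => rw [TensorProduct.map_tmul, koszulAct_append hε]
    apply TensorPower.mulEquiv.injective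
    rw [h1]
    simp only [deconc, TensorPower.cast_refl, LinearMap.comp_apply, LinearEquiv.coe_coe,
      LinearEquiv.refl_apply, LinearEquiv.apply_symm_apply]
    exact x.2 _
  have h2 : ∀ y, TensorProduct.map (SymPow ε p).subtype (SymPow ε q).subtype
      (TensorProduct.map (symProj hε p) (symProj hε q) y) =
      TensorProduct.mapBilinear (.id k) _ _ _ _ (symmetrizer ε p) (symmetrizer ε q) y := by
    intro y
    rw [← LinearMap.comp_apply, ← TensorProduct.map_comp]
    rfl
  rw [comulComp, LinearMap.comp_apply, h2]
  simp only [symmetrizer, map_smul, LinearMap.smul_apply, map_sum, LinearMap.sum_apply,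
    TensorProduct.mapBilinear_apply, LinearMap.comp_apply, Submodule.subtype_apply, key,
    Finset.sum_const, Finset.card_univ, Fintype.card_perm, Fintype.card_fin]
  rw [← Nat.cast_smul_eq_nsmul k, ← Nat.cast_smul_eq_nsmul k]
  simp only [smul_smul]
  convert one_smul k _
  have hp : (p.factorial : k) ≠ 0 := by exact_mod_cast Nat.factorial_ne_zero _
  have hq : (q.factorial : k) ≠ 0 := by exact_mod_cast Nat.factorial_ne_zero _
  field_simp

end CharZero

end Generic

section Cobar

/-! ### The reduced cobar construction

`C` is the space `C̄` of a coaugmented DG coalgebra `k ⊕ C̄` with parity involution `ε`,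
differential `d` and reduced coproduct `Δ`. The desuspension `s⁻¹ C̄` has the same underlying
space, but its degrees are raised by one, so that its parity involution is `-ε`. The algebra
`Ω = T(s⁻¹ C̄)` is `TensorAlgebra k C`, with `ι x` in the role of `s⁻¹ x`. -/

variable {k : Type u} [Field k] {C : Type v} [AddCommGroup C] [Module k C]

/-- The parity involution `a ↦ (-1)^(deg a) a` of the cobar construction. -/
def cobarPar (ε : C →ₗ[k] C) : TensorAlgebra k C →ₐ[k] TensorAlgebra k C :=
  TensorAlgebra.lift k (TensorAlgebra.ι k ∘ₗ (-ε))

/-- The cobar differential on generators: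
`s⁻¹ x ↦ - s⁻¹ (d x) + ∑ (-1)^(deg x') s⁻¹ x' ⊗ s⁻¹ x''` where `Δ x = ∑ x' ⊗ x''`, that is,
`- s⁻¹ d s + (s⁻¹ ⊗ s⁻¹) Δ s` with the Koszul sign rule. -/
def cobarGen (ε d : C →ₗ[k] C) (Δ : C →ₗ[k] C ⊗[k] C) : C →ₗ[k] TensorAlgebra k C :=
  -(TensorAlgebra.ι k ∘ₗ d) +
    LinearMap.mul' k (TensorAlgebra k C) ∘ₗ
      TensorProduct.map (TensorAlgebra.ι k ∘ₗ ε) (TensorAlgebra.ι k) ∘ₗ Δ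

/-- The algebra map `a ↦ [[(-1)^(deg a) a, D a], [0, a]]` that encodes the derivation `D`
extending `cobarGen`. -/
def cobarMat (ε d : C →ₗ[k] C) (Δ : C →ₗ[k] C ⊗[k] C) :
    TensorAlgebra k C →ₐ[k] Matrix (Fin 2) (Fin 2) (TensorAlgebra k C) :=
  TensorAlgebra.lift k
    { toFun := fun x => !![-TensorAlgebra.ι k (ε x), cobarGen ε d Δ x; 0, TensorAlgebra.ι k x]
      map_add' := fun x y => by
        ext i j
        fin_cases i <;> fin_cases j <;> simp [add_comm]
      map_smul' := fun c x => by
        ext i j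
        fin_cases i <;> fin_cases j <;> simp }

/-- The cobar differential: the graded derivation of `T(s⁻¹ C̄)` that extends `cobarGen`
(see `cobarD_ι`, `cobarD_one` and `cobarD_mul`). -/
def cobarD (ε d : C →ₗ[k] C) (Δ : C →ₗ[k] C ⊗[k] C) :
    TensorAlgebra k C →ₗ[k] TensorAlgebra k C where
  toFun a := cobarMat ε d Δ a 0 1
  map_add' a b := by rw [map_add, Matrix.add_apply]
  map_smul' c a := by rw [map_smul, Matrix.smul_apply, RingHom.id_apply]

lemma cobarMat_eq (ε d : C →ₗ[k] C) (Δ : C →ₗ[k] C ⊗[k] C) (a : TensorAlgebra k C) :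
    cobarMat ε d Δ a = !![cobarPar ε a, cobarD ε d Δ a; 0, a] := by
  induction a using TensorAlgebra.induction with
  | algebraMap r =>
    ext i j
    rw [cobarD]
    fin_cases i <;> fin_cases j <;> simp [Matrix.algebraMap_matrix_apply]
  | ι x =>
    ext i j
    fin_cases i <;> fin_cases j <;>
      simp [cobarD, cobarMat, cobarPar, TensorAlgebra.lift_ι_apply]
  | mul a b ha hb =>
    have h : cobarMat ε d Δ (a * b) 0 1 = cobarD ε d Δ (a * b) := rfl
    rw [← h, map_mul, ha, hb]
    ext i j
    fin_cases i <;> fin_cases j <;> simp [Matrix.mul_apply, Fin.sum_univ_two]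
  | add a b ha hb =>
    rw [map_add, ha, hb, map_add, map_add]
    ext i j
    fin_cases i <;> fin_cases j <;> simp

lemma cobarD_ι (ε d : C →ₗ[k] C) (Δ : C →ₗ[k] C ⊗[k] C) (x : C) :
    cobarD ε d Δ (TensorAlgebra.ι k x) = cobarGen ε d Δ x := by
  simp [cobarD, cobarMat, TensorAlgebra.lift_ι_apply]

lemma cobarD_one (ε d : C →ₗ[k] C) (Δ : C →ₗ[k] C ⊗[k] C) : cobarD ε d Δ 1 = 0 := by
  simp [cobarD]

lemma cobarD_mul (ε d : C →ₗ[k] C) (Δ : C →ₗ[k] C ⊗[k] C) (a b : TensorAlgebra k C) :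
    cobarD ε d Δ (a * b) = cobarD ε d Δ a * b + cobarPar ε a * cobarD ε d Δ b := by
  have h : cobarMat ε d Δ (a * b) 0 1 = cobarD ε d Δ (a * b) := rfl
  rw [← h, map_mul, cobarMat_eq, cobarMat_eq]
  simp [Matrix.mul_apply, Fin.sum_univ_two, add_comm]

/-- The algebra anti-involution of `T(s⁻¹ C̄)` that acts by `-1` on generators: with `wᵢ = s⁻¹ xᵢ`
it sends `w₁ ⊗ ⋯ ⊗ wₙ` to `(-1)^n` times the graded reversal `± wₙ ⊗ ⋯ ⊗ w₁`. -/
def cobarAntiInv (ε : C →ₗ[k] C) : TensorAlgebra k C →ₗ[k] TensorAlgebra k C :=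
  TensorAlgebra.ofDirectSum.toLinearMap ∘ₗ
    DirectSum.lmap (fun n => ((-1 : k) ^ n) • koszulAct (-ε) (Fin.revPerm (n := n))) ∘ₗ
    TensorAlgebra.toDirectSum.toLinearMap

end Cobar

section Complexes

variable {k : Type u} [Field k]

/-! ### The total space of a complex -/

/-- The total space `⨁ₚ Vᵖ` of a complex `V`. -/
abbrev Tot (V : CochainComplex (ModuleCat.{v} k) ℤ) : Type v := ⨁ p : ℤ, V.X p

/-- The parity involution `v ↦ (-1)^(deg v) v` of `V`. The suspension `sV`, with
`(sV)ᵖ = Vᵖ⁺¹`, has the same total space as `V`, and its parity involution is `-par V`. -/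
def par (V : CochainComplex (ModuleCat.{v} k) ℤ) : Tot V →ₗ[k] Tot V :=
  DirectSum.lmap fun p : ℤ => ((p.negOnePow : ℤ) : k) • LinearMap.id

/-- The differential on the total space of `V`. The differential of the suspension `sV`,
`d (s v) = - s (d v)`, is `-totD V`. -/
def totD (V : CochainComplex (ModuleCat.{v} k) ℤ) : Tot V →ₗ[k] Tot V :=
  DirectSum.toModule k ℤ (Tot V) fun p =>
    DirectSum.lof k ℤ (fun p => V.X p) (p + 1) ∘ₗ (V.d p (p + 1)).hom

/-- The map of total spaces induced by a morphism of complexes. -/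
def totMap {V W : CochainComplex (ModuleCat.{v} k) ℤ} (φ : V ⟶ W) : Tot V →ₗ[k] Tot W :=
  DirectSum.lmap fun p => (φ.f p).hom

lemma par_par (V : CochainComplex (ModuleCat.{v} k) ℤ) : par V ∘ₗ par V = LinearMap.id := by
  refine DirectSum.linearMap_ext k fun p => LinearMap.ext fun x => ?_
  have h : ((p.negOnePow : ℤ) : k) * ((p.negOnePow : ℤ) : k) = 1 := by
    rw [← Int.cast_mul, ← Units.val_mul, Int.units_mul_self, Units.val_one, Int.cast_one]
  simp only [par, LinearMap.comp_apply, DirectSum.lmap_lof, LinearMap.smul_apply,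
    LinearMap.id_apply, map_smul, smul_smul, h, one_smul]

lemma totD_par (V : CochainComplex (ModuleCat.{v} k) ℤ) :
    totD V ∘ₗ par V = -(par V ∘ₗ totD V) := by
  refine DirectSum.linearMap_ext k fun p => LinearMap.ext fun x => ?_
  have h : (((p + 1).negOnePow : ℤ) : k) = -((p.negOnePow : ℤ) : k) := by
    rw [Int.negOnePow_succ, Units.val_neg, Int.cast_neg]
  simp only [par, totD, LinearMap.comp_apply, LinearMap.neg_apply, DirectSum.lmap_lof,
    DirectSum.toModule_lof, LinearMap.smul_apply, LinearMap.id_apply, map_smul, h, neg_smul,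
    map_neg, neg_neg]

lemma totMap_par {V W : CochainComplex (ModuleCat.{v} k) ℤ} (φ : V ⟶ W) :
    totMap φ ∘ₗ par V = par W ∘ₗ totMap φ := by
  refine DirectSum.linearMap_ext k fun p => LinearMap.ext fun x => ?_
  simp [par, totMap]

lemma spar_spar (V : CochainComplex (ModuleCat.{v} k) ℤ) :
    (-par V) ∘ₗ (-par V) = LinearMap.id := by
  rw [LinearMap.neg_comp, LinearMap.comp_neg, neg_neg, par_par]

lemma stotD_spar (V : CochainComplex (ModuleCat.{v} k) ℤ) :
    (-totD V) ∘ₗ (-par V) = -((-par V) ∘ₗ (-totD V)) := by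
  simp only [LinearMap.neg_comp, LinearMap.comp_neg, neg_neg, totD_par]

lemma totMap_spar {V W : CochainComplex (ModuleCat.{v} k) ℤ} (φ : V ⟶ W) :
    totMap φ ∘ₗ (-par V) = (-par W) ∘ₗ totMap φ := by
  rw [LinearMap.neg_comp, LinearMap.comp_neg, totMap_par]

/-! ### The algebra `E(V)` of symmetric tensors -/

/-- `E(V) = Sym_a(V)`: the symmetric tensors `⨁ₙ Symⁿ(V)`, with the product defined below. -/
def SymAlg (V : CochainComplex (ModuleCat.{v} k) ℤ) : Type (max u v) :=
  ⨁ n : ℕ, SymPow (par V) n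

instance (V : CochainComplex (ModuleCat.{v} k) ℤ) : AddCommGroup (SymAlg V) :=
  inferInstanceAs (AddCommGroup (⨁ n : ℕ, SymPow (par V) n))

instance (V : CochainComplex (ModuleCat.{v} k) ℤ) : Module k (SymAlg V) :=
  inferInstanceAs (Module k (⨁ n : ℕ, SymPow (par V) n))

/-- The inclusion of `Symⁿ(V)` into `E(V)`. -/
def symOf (V : CochainComplex (ModuleCat.{v} k) ℤ) (n : ℕ) : SymPow (par V) n →ₗ[k] SymAlg V :=
  DirectSum.lof k ℕ (fun n => SymPow (par V) n) n

/-- The inclusion of the symmetric tensors into all tensors. -/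
def symIncl (V : CochainComplex (ModuleCat.{v} k) ℤ) : SymAlg V →ₗ[k] ⨁ n : ℕ, ⨂[k]^n (Tot V) :=
  DirectSum.lmap fun n => (SymPow (par V) n).subtype

lemma symIncl_symOf {V : CochainComplex (ModuleCat.{v} k) ℤ} (n : ℕ) (x : SymPow (par V) n) :
    symIncl V (symOf V n x) = DirectSum.of (fun n => ⨂[k]^n (Tot V)) n (x : ⨂[k]^n (Tot V)) :=
  DirectSum.lmap_lof (R := k) (fun n => (SymPow (par V) n).subtype) n x

variable [CharZero k]

/-- The projection of all tensors onto the symmetric tensors, by averaging. -/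
def symAvg (V : CochainComplex (ModuleCat.{v} k) ℤ) : (⨁ n : ℕ, ⨂[k]^n (Tot V)) →ₗ[k] SymAlg V :=
  DirectSum.lmap fun n => symProj (par_par V) n

/-- The product of `E(V)`: the symmetrization of the tensor product of two symmetric tensors. -/
instance (V : CochainComplex (ModuleCat.{v} k) ℤ) : Mul (SymAlg V) :=
  ⟨fun a b => symAvg V (symIncl V a * symIncl V b)⟩

instance (V : CochainComplex (ModuleCat.{v} k) ℤ) : One (SymAlg V) := ⟨symAvg V 1⟩

lemma SymAlg.mul_def {V : CochainComplex (ModuleCat.{v} k) ℤ} (a b : SymAlg V) :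
    a * b = symAvg V (symIncl V a * symIncl V b) := rfl

lemma SymAlg.one_def {V : CochainComplex (ModuleCat.{v} k) ℤ} :
    (1 : SymAlg V) = symAvg V 1 := rfl

lemma symAvg_of {V : CochainComplex (ModuleCat.{v} k) ℤ} (n : ℕ) (x : ⨂[k]^n (Tot V)) :
    symAvg V (DirectSum.of (fun n => ⨂[k]^n (Tot V)) n x) =
      symOf V n (symProj (par_par V) n x) :=
  DirectSum.lmap_lof (R := k) (fun n => symProj (par_par V) n) n x

lemma symAvg_symIncl {V : CochainComplex (ModuleCat.{v} k) ℤ} (a : SymAlg V) :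
    symAvg V (symIncl V a) = a := by
  have h : symAvg V ∘ₗ symIncl V = LinearMap.id := by
    refine DirectSum.linearMap_ext k fun n => LinearMap.ext fun x => ?_
    change symAvg V (symIncl V (symOf V n x)) = symOf V n x
    rw [symIncl_symOf, symAvg_of, symProj_of_mem]
  exact LinearMap.congr_fun h a

lemma symAvg_mul {V : CochainComplex (ModuleCat.{v} k) ℤ} (x y : ⨁ n : ℕ, ⨂[k]^n (Tot V)) :
    symAvg V x * symAvg V y = symAvg V (x * y) := by
  induction x using DirectSum.induction_on with
  | zero => simp only [SymAlg.mul_def, map_zero, zero_mul]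
  | add a b ha hb =>
    rw [SymAlg.mul_def] at ha hb ⊢
    simp only [map_add, add_mul, ha, hb]
  | of n a =>
    induction y using DirectSum.induction_on with
    | zero => simp only [SymAlg.mul_def, map_zero, mul_zero]
    | add b c hb hc =>
      rw [SymAlg.mul_def] at hb hc ⊢
      simp only [map_add, mul_add, hb, hc]
    | of m b =>
      rw [SymAlg.mul_def, symAvg_of, symAvg_of, symIncl_symOf, symIncl_symOf, DirectSum.of_mul_of,
        DirectSum.of_mul_of, symAvg_of, symAvg_of]
      congr 1
      exact Subtype.ext (symmetrizer_mul (par_par V) a b)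

instance (V : CochainComplex (ModuleCat.{v} k) ℤ) : Ring (SymAlg V) :=
  { (inferInstance : AddCommGroup (SymAlg V)) with
    mul_assoc := fun a b c => by
      rw [← symAvg_symIncl a, ← symAvg_symIncl b, ← symAvg_symIncl c]
      simp only [symAvg_mul, mul_assoc]
    one_mul := fun a => by
      rw [← symAvg_symIncl a, SymAlg.one_def, symAvg_mul, one_mul]
    mul_one := fun a => by
      rw [← symAvg_symIncl a, SymAlg.one_def, symAvg_mul, mul_one]
    left_distrib := fun a b c => by
      simp only [SymAlg.mul_def, map_add, mul_add]
    right_distrib := fun a b c => by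
      simp only [SymAlg.mul_def, map_add, add_mul]
    zero_mul := fun a => by
      simp only [SymAlg.mul_def, map_zero, zero_mul]
    mul_zero := fun a => by
      simp only [SymAlg.mul_def, map_zero, mul_zero] }

instance (V : CochainComplex (ModuleCat.{v} k) ℤ) : Algebra k (SymAlg V) :=
  Algebra.ofModule
    (fun c a b => by simp only [SymAlg.mul_def, map_smul, smul_mul_assoc])
    (fun c a b => by simp only [SymAlg.mul_def, map_smul, mul_smul_comm])

/-- The differential of `E(V)`, induced by the differential of `V`. -/
def symAlgD (V : CochainComplex (ModuleCat.{v} k) ℤ) : SymAlg V →ₗ[k] SymAlg V :=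
  DirectSum.lmap fun n => symD (par_par V) (totD_par V) n

/-- The embedding of `V` into `E(V)` as `Sym¹(V)`. Averaging over the trivial group does nothing
but record that every tensor in `V^{⊗ 1}` is symmetric. -/
def symι (V : CochainComplex (ModuleCat.{v} k) ℤ) : Tot V →ₗ[k] SymAlg V :=
  symOf V 1 ∘ₗ symProj (par_par V) 1 ∘ₗ
    (PiTensorProduct.subsingletonEquiv (R := k) (s := fun _ => Tot V) (0 : Fin 1)).symm.toLinearMap

/-! ### The DG algebra `A(V) = Ω Sym_c(sV)` -/

/-- The reduced symmetric coalgebra `Sym_c^{≥ 1}(sV) = ⨁ₙ Symⁿ⁺¹(sV)` of the suspension of `V`. -/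
abbrev SymCoalg (V : CochainComplex (ModuleCat.{v} k) ℤ) : Type (max u v) :=
  ⨁ n : ℕ, SymPow (-par V) (n + 1)

/-- The parity involution of `Sym_c^{≥ 1}(sV)`. -/
def symCoalgPar (V : CochainComplex (ModuleCat.{v} k) ℤ) : SymCoalg V →ₗ[k] SymCoalg V :=
  DirectSum.lmap fun n => symMap (spar_spar V) (-par V) rfl (n + 1)

/-- The differential of `Sym_c^{≥ 1}(sV)`, induced by the differential of `sV`. -/
def symCoalgD (V : CochainComplex (ModuleCat.{v} k) ℤ) : SymCoalg V →ₗ[k] SymCoalg V :=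
  DirectSum.lmap fun n => symD (spar_spar V) (stotD_spar V) (n + 1)

/-- The reduced coproduct of `Sym_c^{≥ 1}(sV)`: on `Symⁿ⁺¹(sV)` it is the sum of the
components `Symⁿ⁺¹ → Symᵖ ⊗ Sym^q` of deconcatenation over all `p, q ≥ 1` with `p + q = n + 1`;
here `p = i + 1` and `q = (n - 1 - i) + 1` with `0 ≤ i < n`. -/
def symCoalgComul (V : CochainComplex (ModuleCat.{v} k) ℤ) :
    SymCoalg V →ₗ[k] SymCoalg V ⊗[k] SymCoalg V :=
  DirectSum.toModule k ℕ _ fun n => ∑ i : Fin n,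
    TensorProduct.map
        (DirectSum.lof k ℕ (fun n => SymPow (-par V) (n + 1)) (i : ℕ))
        (DirectSum.lof k ℕ (fun n => SymPow (-par V) (n + 1)) (n - 1 - (i : ℕ))) ∘ₗ
      comulComp (spar_spar V)
        (show n + 1 = ((i : ℕ) + 1) + ((n - 1 - (i : ℕ)) + 1) by have := i.isLt; omega)

/-- The map of reduced symmetric coalgebras induced by a morphism of complexes. -/
def symCoalgMap {V W : CochainComplex (ModuleCat.{v} k) ℤ} (φ : V ⟶ W) :
    SymCoalg V →ₗ[k] SymCoalg W :=
  DirectSum.lmap fun n => symMap (spar_spar V) (totMap φ) (totMap_spar φ) (n + 1)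

/-- `A(V) = Ω Sym_c(sV)`, the reduced cobar construction: the tensor algebra on
`s⁻¹ Sym_c^{≥ 1}(sV)`. -/
abbrev CobarSym (V : CochainComplex (ModuleCat.{v} k) ℤ) : Type (max u v) :=
  TensorAlgebra k (SymCoalg V)

/-- The differential of `A(V)`. -/
def cobarSymD (V : CochainComplex (ModuleCat.{v} k) ℤ) : CobarSym V →ₗ[k] CobarSym V :=
  cobarD (C := SymCoalg V) (symCoalgPar V) (symCoalgD V) (symCoalgComul V)

/-- The anti-involution `ι_Ω` of `A(V)`, which acts by `-1` on the generators. -/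
def iotaOmega (V : CochainComplex (ModuleCat.{v} k) ℤ) : CobarSym V →ₗ[k] CobarSym V :=
  cobarAntiInv (C := SymCoalg V) (symCoalgPar V)

/-- The algebra map `A(V) → A(W)` induced by a morphism of complexes `V ⟶ W`. -/
def cobarSymMap {V W : CochainComplex (ModuleCat.{v} k) ℤ} (φ : V ⟶ W) :
    CobarSym V →ₐ[k] CobarSym W :=
  TensorAlgebra.lift k (TensorAlgebra.ι k ∘ₗ symCoalgMap φ)

/-! ### The maps `f_V` and `g_V` -/

/-- The projection `s⁻¹ Sym^{≥ 1}(sV) → s⁻¹ Sym¹(sV) = V`. -/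
def projGen (V : CochainComplex (ModuleCat.{v} k) ℤ) : SymCoalg V →ₗ[k] Tot V :=
  (PiTensorProduct.subsingletonEquiv (R := k) (s := fun _ => Tot V) (0 : Fin 1)).toLinearMap ∘ₗ
    (SymPow (-par V) 1).subtype ∘ₗ DirectSum.component k ℕ (fun n => SymPow (-par V) (n + 1)) 0

/-- The embedding `V = s⁻¹ Sym¹(sV) → s⁻¹ Sym^{≥ 1}(sV)`. -/
def inclGen (V : CochainComplex (ModuleCat.{v} k) ℤ) : Tot V →ₗ[k] SymCoalg V :=
  DirectSum.lof k ℕ (fun n => SymPow (-par V) (n + 1)) 0 ∘ₗ symProj (spar_spar V) 1 ∘ₗ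
    (PiTensorProduct.subsingletonEquiv (R := k) (s := fun _ => Tot V) (0 : Fin 1)).symm.toLinearMap

/-- `f_V : A(V) → E(V)`, the multiplicative extension of the projection
`s⁻¹ Sym^{≥ 1}(sV) → V`. -/
def fMap (V : CochainComplex (ModuleCat.{v} k) ℤ) : CobarSym V →ₐ[k] SymAlg V :=
  TensorAlgebra.lift k (symι V ∘ₗ projGen V)

/-- `g_V : E(V) → A(V)`, the composition of the natural embeddings
`Symⁿ(V) → V^{⊗ n} → T(V) → T(s⁻¹ Sym_c^{≥ 1}(sV))`. -/
def gMap (V : CochainComplex (ModuleCat.{v} k) ℤ) : SymAlg V →ₗ[k] CobarSym V :=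
  (TensorAlgebra.lift k (TensorAlgebra.ι k ∘ₗ inclGen V)).toLinearMap ∘ₗ
    TensorAlgebra.ofDirectSum.toLinearMap ∘ₗ symIncl V

/-! ### The grading of `A(V)` -/

/-- The part of degree `q` of `Symⁿ(sV)`: the symmetric tensors in the span of all
`sv₁ ⊗ ⋯ ⊗ svₙ` with `vᵢ` homogeneous and `∑ deg (svᵢ) = ∑ (deg vᵢ - 1) = q`. -/
def symDeg (V : CochainComplex (ModuleCat.{v} k) ℤ) (n : ℕ) (q : ℤ) :
    Submodule k (SymPow (-par V) n) :=
  (Submodule.span k {t : ⨂[k]^n (Tot V) | ∃ (a : Fin n → ℤ) (x : ∀ i, V.X (a i)),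
    ∑ i, (a i - 1) = q ∧
    t = PiTensorProduct.tprod k fun i => DirectSum.lof k ℤ (fun p => V.X p) (a i) (x i)}).comap
    (SymPow (-par V) n).subtype

/-- The part of degree `q` of `s⁻¹ Sym^{≥ 1}(sV)`, where `deg (s⁻¹ x) = deg x + 1`. -/
def genDeg (V : CochainComplex (ModuleCat.{v} k) ℤ) (q : ℤ) : Submodule k (SymCoalg V) :=
  ⨅ n : ℕ, (symDeg V (n + 1) (q - 1)).comap
    (DirectSum.component k ℕ (fun n => SymPow (-par V) (n + 1)) n)

/-- The part of degree `q` of `A(V)`: the span of the products of homogeneous generators whose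
degrees add up to `q`. -/
def cobarDeg (V : CochainComplex (ModuleCat.{v} k) ℤ) (q : ℤ) : Submodule k (CobarSym V) :=
  Submodule.span k {t | ∃ (n : ℕ) (a : Fin n → ℤ) (x : Fin n → SymCoalg V),
    (∀ i, x i ∈ genDeg V (a i)) ∧ ∑ i, a i = q ∧ t = TensorAlgebra.tprod k (SymCoalg V) n x}

end Complexes

end SymCobar

end

/-! Write `C = Sym^{≥ 1}(sV)` and `A = T(s⁻¹ C)`. The coalgebra `C` is generated from the vectors
`v` in `sV` by the shuffle products `L v`, and, up to signs, `Δ(L v c) = v ⊗ c + c ⊗ v + (L v ⊗ 1 +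
1 ⊗ L v) Δ c`. Translated to the cobar construction, this says that the derivation `Lhat v` of `A`
extending `L v` is a homotopy that annihilates the graded commutator with `v` (`D_Lhat`): up to
homotopy, letters from `V` commute with every word.

Let `preHomotopy` remove a letter `v` that is a vector and apply `Lhat v` to the part of the word to
its right. Its anticommutator with the differential is the multiplication by the weight (the total
number of vectors shuffled into the letters) minus the operator that moves one vector letter to the
right end of the word (`D_preHomotopy`). Two facts enter: the cross terms of the quadratic
differential cancel by cocommutativity (`koszulFlip_Δ`), and splitting a vector off a symmetric
tensor of weight `n` and shuffling it back is multiplication by `n` (`num_eq`).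

Removing a vector letter is a chain map `A → A ⊗ V` that lowers the weight by one (`extract_D`,
`rTensor_extract_eq_zero`), so the construction can be repeated on the remaining word. In weight `n`
the result is a homotopy from `n!` to the operator that keeps only the words of vectors and sums
over all their orders (`D_stage`, `permProj_eq`). Division by `n!`, which needs characteristic zero,
turns this operator into `g f` (`gMap_fMap`) and gives a homotopy from `1` to `g f`.

The remaining conditions are formal (`improve_spec`): average over conjugation by the
anti-involution, compress by `1 - g f`, and replace `h` by `h d h`. Naturality and the degree `-1`
hold because every operator is built from the structure maps of `C`.

The argument is carried out for an abstract `InsertionCoalgebra`. That the symmetric coalgebra is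
one (`symInsertion`) is checked inside the tensor algebra of `V`, where `L v` becomes the insertion
of `v` in all positions and `Δ` becomes deconcatenation. -/

noncomputable section

namespace SymCobar

open TensorAlgebra (ι)

/-! ### Recursion and induction on words of a tensor algebra -/

section TensorRecursion

variable {k : Type u} [Field k] {C : Type*} [AddCommGroup C] [Module k C]
  {B : Type*} [AddCommGroup B] [Module k B]

/-- Left multiplication by a generator, extended to an operator on pairs `(a, G a)`. -/
def tensorRecStep (s₁ : C →ₗ[k] TensorAlgebra k C →ₗ[k] B) (s₂ : C →ₗ[k] B →ₗ[k] B) :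
    C →ₗ[k] Module.End k (TensorAlgebra k C × B) where
  toFun x := LinearMap.prod (LinearMap.mulLeft k (ι k x) ∘ₗ LinearMap.fst k _ _)
    (s₁ x ∘ₗ LinearMap.fst k _ _ + s₂ x ∘ₗ LinearMap.snd k _ _)
  map_add' x y := by
    refine LinearMap.ext fun p => Prod.ext ?_ ?_
    · simp [add_mul]
    · simp; abel
  map_smul' c x := by
    refine LinearMap.ext fun p => Prod.ext ?_ ?_ <;> simp

lemma tensorRecStep_apply (s₁ : C →ₗ[k] TensorAlgebra k C →ₗ[k] B) (s₂ : C →ₗ[k] B →ₗ[k] B) (x : C)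
    (p : TensorAlgebra k C × B) :
    tensorRecStep s₁ s₂ x p = (ι k x * p.1, s₁ x p.1 + s₂ x p.2) := rfl

/-- The linear map `G` out of the tensor algebra with `G 1 = z` and
`G (x a) = s₁ x a + s₂ x (G a)` for generators `x`. -/
def tensorRec (z : B) (s₁ : C →ₗ[k] TensorAlgebra k C →ₗ[k] B) (s₂ : C →ₗ[k] B →ₗ[k] B) :
    TensorAlgebra k C →ₗ[k] B where
  toFun a := (TensorAlgebra.lift k (tensorRecStep s₁ s₂) a (1, z)).2
  map_add' a b := by simp
  map_smul' c a := by simp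

variable (z : B) (s₁ : C →ₗ[k] TensorAlgebra k C →ₗ[k] B) (s₂ : C →ₗ[k] B →ₗ[k] B)

@[simp] lemma tensorRec_one : tensorRec z s₁ s₂ 1 = z := by simp [tensorRec]

/-- A subspace of the tensor algebra that contains `1` and is closed under left multiplication by
a spanning set of generators is everything. -/
lemma tensor_mem {s : Set C} (hs : Submodule.span k s = ⊤) (S : Submodule k (TensorAlgebra k C))
    (h1 : 1 ∈ S) (hmul : ∀ x ∈ s, ∀ b ∈ S, ι k x * b ∈ S) (a : TensorAlgebra k C) : a ∈ S := by
  have hx : ∀ x : C, ∀ b ∈ S, ι k x * b ∈ S := fun x b hb => by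
    have : (⊤ : Submodule k C) ≤ S.comap (LinearMap.mulRight k b ∘ₗ ι k) := by
      rw [← hs, Submodule.span_le]
      exact fun y hy => hmul y hy b hb
    exact this (Submodule.mem_top (x := x))
  have key : ∀ b ∈ S, a * b ∈ S := by
    induction a using TensorAlgebra.induction with
    | algebraMap r => intro b hb; rw [← Algebra.smul_def]; exact S.smul_mem r hb
    | ι x => exact hx x
    | mul a a' ha ha' => intro b hb; rw [mul_assoc]; exact ha _ (ha' b hb)
    | add a a' ha ha' => intro b hb; rw [add_mul]; exact S.add_mem (ha b hb) (ha' b hb)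
  simpa using key 1 h1

/-- Maps given by `tensorRec` are known only through their behaviour under a letter on the left, so
their identities are proved by this induction on words. Taking letters from a spanning set makes it
possible to assume them homogeneous, where all signs are explicit. -/
lemma tensor_ext {s : Set C} (hs : Submodule.span k s = ⊤) {f g : TensorAlgebra k C →ₗ[k] B}
    (h1 : f 1 = g 1) (hmul : ∀ x ∈ s, ∀ b, f b = g b → f (ι k x * b) = g (ι k x * b)) : f = g :=
  LinearMap.ext fun a => tensor_mem hs (LinearMap.eqLocus f g) h1 hmul a

lemma tensor_ext' {f g : TensorAlgebra k C →ₗ[k] B}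
    (h1 : f 1 = g 1) (hmul : ∀ x b, f b = g b → f (ι k x * b) = g (ι k x * b)) : f = g :=
  tensor_ext (s := Set.univ) Submodule.span_univ h1 fun x _ => hmul x

/-- The first component of the pair only carries the word along, so that `s₁` can see the
unprocessed rest of it. -/
lemma tensorRec_lift_fst (a : TensorAlgebra k C) :
    (TensorAlgebra.lift k (tensorRecStep s₁ s₂) a (1, z)).1 = a := by
  have h := tensor_ext' (f := LinearMap.fst k _ _ ∘ₗ LinearMap.applyₗ (R := k) ((1 : TensorAlgebra k C), z) ∘ₗ
    (TensorAlgebra.lift k (tensorRecStep s₁ s₂)).toLinearMap) (g := LinearMap.id) (by simp)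
    (fun x b hb => by
      simp only [LinearMap.comp_apply, AlgHom.toLinearMap_apply, LinearMap.applyₗ_apply_apply,
        LinearMap.fst_apply, LinearMap.id_apply] at hb
      simp [tensorRecStep_apply, hb])
  exact LinearMap.congr_fun h a

@[simp] lemma tensorRec_ι_mul (x : C) (a : TensorAlgebra k C) :
    tensorRec z s₁ s₂ (ι k x * a) = s₁ x a + s₂ x (tensorRec z s₁ s₂ a) := by
  simp only [tensorRec, LinearMap.coe_mk, AddHom.coe_mk, map_mul, TensorAlgebra.lift_ι_apply,
    Module.End.mul_apply, tensorRecStep_apply, tensorRec_lift_fst]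

end TensorRecursion

/-! ### Parity involutions and reduction to homogeneous vectors -/

section Parity

variable {k : Type u} [Field k] {M : Type*} [AddCommGroup M] [Module k M]
  {N : Type*} [AddCommGroup N] [Module k N]

/-- The `b`-th power of the involution `τ`. -/
def twist (τ : M →ₗ[k] M) (b : Bool) : M →ₗ[k] M := if b then τ else LinearMap.id

@[simp] lemma twist_true (τ : M →ₗ[k] M) : twist τ true = τ := rfl
@[simp] lemma twist_false (τ : M →ₗ[k] M) : twist τ false = LinearMap.id := rfl
@[simp] lemma boolSign_true : boolSign k true = -1 := rfl
@[simp] lemma boolSign_false : boolSign k false = 1 := rfl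

lemma boolSign_mul_self (b : Bool) : boolSign k b * boolSign k b = 1 := by cases b <;> simp

lemma boolSign_not (b : Bool) : boolSign k (!b) = -boolSign k b := by cases b <;> simp

lemma boolSign_xor (b c : Bool) : boolSign k (b ^^ c) = boolSign k b * boolSign k c := by
  cases b <;> cases c <;> simp

lemma twist_pure {τ : M →ₗ[k] M} {v : M} {c : Bool} (hv : τ v = boolSign k c • v) (b : Bool) :
    twist τ b v = boolSign k (b && c) • v := by
  cases b <;> simp [hv]

lemma twist_map {τ : M →ₗ[k] M} {τ' : N →ₗ[k] N} {φ : M →ₗ[k] N} (h : ∀ x, φ (τ x) = τ' (φ x))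
    (b : Bool) (x : M) : φ (twist τ b x) = twist τ' b (φ x) := by
  cases b <;> simp [h]

/-- The vectors that are even or odd. -/
def homogeneous (τ : M →ₗ[k] M) : Set M := {v | ∃ b, τ v = boolSign k b • v}

variable [CharZero k]

lemma span_homogeneous {τ : M →ₗ[k] M} (hτ : τ ∘ₗ τ = LinearMap.id) :
    Submodule.span k (homogeneous τ) = ⊤ := by
  refine Submodule.eq_top_iff'.2 fun v => ?_
  rw [← parityProj_add τ v]
  exact Submodule.sum_mem _ fun b _ => Submodule.subset_span ⟨b, parityProj_mem hτ b v⟩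

lemma ext_homogeneous {N : Type*} [AddCommMonoid N] [Module k N] {τ : M →ₗ[k] M}
    (hτ : τ ∘ₗ τ = LinearMap.id) {f g : M →ₗ[k] N}
    (h : ∀ b v, τ v = boolSign k b • v → f v = g v) : f = g :=
  LinearMap.ext_on (span_homogeneous hτ) fun v ⟨b, hb⟩ => h b v hb

/-- Operators with Koszul signs are defined as sums over the parity of an argument; on a homogeneous
argument a single summand survives, and this evaluates it. -/
lemma sum_parityProj_pure {τ : M →ₗ[k] M} {v : M} {b : Bool} (hv : τ v = boolSign k b • v)
    (f : Bool → M →ₗ[k] N) : ∑ c, f c (parityProj τ c v) = f b v := by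
  rw [Finset.sum_eq_single b]
  · rw [parityProj_pure hv, if_pos rfl]
  · intro c _ hc
    rw [parityProj_pure hv, if_neg hc, map_zero]
  · simp

end Parity

section TensorParity

variable {k : Type u} [Field k] {M : Type*} [AddCommGroup M] [Module k M]
  {N : Type*} [AddCommGroup N] [Module k N]

/-- The algebra endomorphism of the tensor algebra that extends the `b`-th power of `τ`. -/
def tensorTwist (τ : M →ₗ[k] M) (b : Bool) : TensorAlgebra k M →ₐ[k] TensorAlgebra k M :=
  TensorAlgebra.lift k (ι k ∘ₗ twist τ b)

@[simp] lemma tensorTwist_ι (τ : M →ₗ[k] M) (b : Bool) (x : M) :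
    tensorTwist τ b (ι k x) = ι k (twist τ b x) := by
  simp [tensorTwist]

@[simp] lemma tensorTwist_false (τ : M →ₗ[k] M) : tensorTwist τ false = AlgHom.id k _ := by
  ext x; simp

lemma tensorTwist_tensorTwist {τ : M →ₗ[k] M} (hτ : τ ∘ₗ τ = LinearMap.id) (b c : Bool)
    (a : TensorAlgebra k M) : tensorTwist τ b (tensorTwist τ c a) = tensorTwist τ (b ^^ c) a := by
  have h : ∀ x, τ (τ x) = x := LinearMap.congr_fun hτ
  have : (tensorTwist τ b).comp (tensorTwist τ c) = tensorTwist τ (b ^^ c) := by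
    ext x; cases b <;> cases c <;> simp [h]
  exact DFunLike.congr_fun this a

lemma tensorTwist_map {τ : M →ₗ[k] M} {τ' : N →ₗ[k] N} {φ : M →ₗ[k] N}
    (h : ∀ x, φ (τ x) = τ' (φ x)) (b : Bool) (a : TensorAlgebra k M) :
    TensorAlgebra.lift k (ι k ∘ₗ φ) (tensorTwist τ b a) =
      tensorTwist τ' b (TensorAlgebra.lift k (ι k ∘ₗ φ) a) := by
  have : (TensorAlgebra.lift k (ι k ∘ₗ φ)).comp (tensorTwist τ b) =
      (tensorTwist τ' b).comp (TensorAlgebra.lift k (ι k ∘ₗ φ)) := by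
    ext x
    simp [twist_map h]
  exact DFunLike.congr_fun this a

/-- Left multiplication by generators on `Hom(M, A)`, with the Koszul sign of moving a generator
past an argument in `M`. -/
def twistedMul (τ : N →ₗ[k] N) (τM : M →ₗ[k] M) :
    N →ₗ[k] (M →ₗ[k] TensorAlgebra k N) →ₗ[k] (M →ₗ[k] TensorAlgebra k N) :=
  LinearMap.mk₂ k (fun x l => ∑ b : Bool,
      LinearMap.mulLeft k (ι k (twist τ b x)) ∘ₗ l ∘ₗ parityProj τM b)
    (fun x y l => by ext v; simp [add_mul]; abel)
    (fun c x l => by ext v; simp)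
    (fun x l l' => by ext v; simp [mul_add]; abel)
    (fun c x l => by ext v; simp)

lemma twistedMul_pure [CharZero k] (τ : N →ₗ[k] N) {τM : M →ₗ[k] M} {v : M} {b : Bool}
    (hv : τM v = boolSign k b • v) (x : N) (l : M →ₗ[k] TensorAlgebra k N) :
    twistedMul τ τM x l v = ι k (twist τ b x) * l v := by
  simp only [twistedMul, LinearMap.mk₂_apply, LinearMap.sum_apply, LinearMap.comp_apply]
  exact sum_parityProj_pure hv fun c => LinearMap.mulLeft k (ι k (twist τ c x)) ∘ₗ l

end TensorParity

/-! ### Insertion of a vector into a tensor: the shuffle product with a vector -/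

section Insertion

variable {k : Type u} [Field k] {M : Type*} [AddCommGroup M] [Module k M]

/-- The signed sum of the tensors obtained by inserting a vector into a tensor in all possible
positions, that is, the shuffle product with a vector. -/
def insertion (τ : M →ₗ[k] M) : TensorAlgebra k M →ₗ[k] M →ₗ[k] TensorAlgebra k M :=
  tensorRec (ι k)
    (LinearMap.mk₂ k (fun x t => LinearMap.mulRight k (ι k x * t) ∘ₗ ι k)
      (fun x y l => by ext v; simp only [map_add, add_mul, mul_add, LinearMap.comp_apply,
        LinearMap.mulRight_apply, LinearMap.add_apply])
      (fun c x l => by ext v; simp only [map_smul, smul_mul_assoc, mul_smul_comm,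
        LinearMap.comp_apply, LinearMap.mulRight_apply, LinearMap.smul_apply])
      (fun x l l' => by ext v; simp only [mul_add, LinearMap.comp_apply,
        LinearMap.mulRight_apply, LinearMap.add_apply])
      (fun c x l => by ext v; simp only [mul_smul_comm,
        LinearMap.comp_apply, LinearMap.mulRight_apply, LinearMap.smul_apply]))
    (twistedMul τ τ)

@[simp] lemma insertion_one (τ : M →ₗ[k] M) (v : M) : insertion τ 1 v = ι k v := by
  simp [insertion]

variable [CharZero k]

lemma insertion_ι_mul {τ : M →ₗ[k] M} {v : M} {b : Bool} (hv : τ v = boolSign k b • v) (x : M)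
    (t : TensorAlgebra k M) : insertion τ (ι k x * t) v =
      ι k v * (ι k x * t) + ι k (twist τ b x) * insertion τ t v := by
  rw [insertion, tensorRec_ι_mul, LinearMap.add_apply, twistedMul_pure τ hv]
  rfl

lemma tensorTwist_insertion {τ : M →ₗ[k] M} (hτ : τ ∘ₗ τ = LinearMap.id) (c : Bool) {v : M}
    {b : Bool} (hv : τ v = boolSign k b • v) (t : TensorAlgebra k M) :
    tensorTwist τ c (insertion τ t v) = boolSign k (b && c) • insertion τ (tensorTwist τ c t) v := by
  have h := tensor_ext (f := (tensorTwist τ c).toLinearMap ∘ₗ (insertion τ).flip v)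
    (g := boolSign k (b && c) • (insertion τ).flip v ∘ₗ (tensorTwist τ c).toLinearMap)
    (span_homogeneous hτ) (by cases c <;> simp [hv]) (fun x ⟨e, he⟩ t ht => by
      simp only [LinearMap.comp_apply, LinearMap.flip_apply, AlgHom.toLinearMap_apply,
        LinearMap.smul_apply] at ht ⊢
      rw [insertion_ι_mul hv, map_mul, tensorTwist_ι, insertion_ι_mul hv]
      simp only [map_add, map_mul, ht, tensorTwist_ι, twist_pure hv, twist_pure he, map_smul,
        smul_mul_assoc, mul_smul_comm, smul_add, smul_smul]
      cases b <;> cases c <;> cases e <;> simp)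
  exact LinearMap.congr_fun h t

/-- Both sides place the two vectors in all possible positions, and exchanging the order of
insertion costs only the Koszul sign of the pair. This is the source of `L_comm`, and it makes
`permSum` insensitive to the order of adjacent letters. -/
lemma insertion_comm {τ : M →ₗ[k] M} (hτ : τ ∘ₗ τ = LinearMap.id) {v : M}
    {b : Bool} (hv : τ v = boolSign k b • v) (w : M) (t : TensorAlgebra k M) :
    insertion τ (insertion τ t w) v = insertion τ (insertion τ t v) (twist τ b w) := by
  suffices H : (insertion τ).flip.compr₂ ((insertion τ).flip v) =
      ((insertion τ).flip ∘ₗ twist τ b).compl₂ ((insertion τ).flip v) from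
    LinearMap.congr_fun₂ H w t
  refine ext_homogeneous hτ fun c w hw => ?_
  refine tensor_ext (span_homogeneous hτ) ?_ fun x ⟨e, he⟩ t ht => ?_
  · have h1 := insertion_ι_mul hv w 1
    have h2 := insertion_ι_mul hw v 1
    simp only [mul_one, insertion_one] at h1 h2
    simp [h1, h2, twist_pure hw, twist_pure hv]
    cases b <;> cases c <;> simp [add_comm]
  · simp only [LinearMap.comp_apply, LinearMap.compr₂_apply, LinearMap.compl₂_apply,
      LinearMap.flip_apply, twist_pure hw, map_smul, LinearMap.smul_apply] at ht ⊢
    rw [insertion_ι_mul hw, insertion_ι_mul hv]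
    simp only [map_add, LinearMap.add_apply, insertion_ι_mul hw, insertion_ι_mul hv, ht,
      twist_pure hw, twist_pure hv, twist_pure he, map_smul, smul_mul_assoc, mul_smul_comm,
      smul_add, smul_smul, LinearMap.smul_apply, mul_add]
    cases b <;> cases c <;> cases e <;> simp <;> abel

/-- The differential of the tensor algebra of `M` that is induced by the differential of `M`. -/
def tensorDiff (τ δ : M →ₗ[k] M) : TensorAlgebra k M →ₗ[k] TensorAlgebra k M :=
  tensorRec 0 ((LinearMap.mul k (TensorAlgebra k M)) ∘ₗ ι k ∘ₗ δ)
    ((LinearMap.mul k (TensorAlgebra k M)) ∘ₗ ι k ∘ₗ τ)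

omit [CharZero k] in
@[simp] lemma tensorDiff_one (τ δ : M →ₗ[k] M) : tensorDiff τ δ 1 = 0 := by simp [tensorDiff]

omit [CharZero k] in
@[simp] lemma tensorDiff_ι_mul (τ δ : M →ₗ[k] M) (x : M) (t : TensorAlgebra k M) :
    tensorDiff τ δ (ι k x * t) = ι k (δ x) * t + ι k (τ x) * tensorDiff τ δ t := by
  simp [tensorDiff]

omit [CharZero k] in
@[simp] lemma tensorDiff_ι (τ δ : M →ₗ[k] M) (x : M) :
    tensorDiff τ δ (ι k x) = ι k (δ x) := by
  simpa using tensorDiff_ι_mul τ δ x 1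

omit [CharZero k] in
lemma pure_diff {τ δ : M →ₗ[k] M} (hδ : δ ∘ₗ τ = -(τ ∘ₗ δ)) {v : M} {b : Bool}
    (hv : τ v = boolSign k b • v) : τ (δ v) = boolSign k (!b) • δ v := by
  have h : δ (τ v) = -τ (δ v) := LinearMap.congr_fun hδ v
  rw [← neg_inj, ← h, hv, map_smul, boolSign_not, neg_smul, neg_neg]

/-- The induced differential is a derivation of the shuffle product: it hits either the inserted
vector or the tensor. -/
lemma tensorDiff_insertion {τ δ : M →ₗ[k] M} (hτ : τ ∘ₗ τ = LinearMap.id)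
    (hδ : δ ∘ₗ τ = -(τ ∘ₗ δ)) {v : M} {b : Bool} (hv : τ v = boolSign k b • v)
    (t : TensorAlgebra k M) :
    tensorDiff τ δ (insertion τ t v) =
      insertion τ t (δ v) + boolSign k b • insertion τ (tensorDiff τ δ t) v := by
  have h := tensor_ext (f := tensorDiff τ δ ∘ₗ (insertion τ).flip v)
    (g := (insertion τ).flip (δ v) + boolSign k b • (insertion τ).flip v ∘ₗ tensorDiff τ δ)
    (span_homogeneous hτ) (by simp) (fun x ⟨e, he⟩ t ht => by
      simp only [LinearMap.comp_apply, LinearMap.flip_apply,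
        LinearMap.smul_apply, LinearMap.add_apply] at ht ⊢
      rw [insertion_ι_mul hv, insertion_ι_mul (pure_diff hδ hv), tensorDiff_ι_mul]
      simp only [map_add, LinearMap.add_apply, insertion_ι_mul hv, tensorDiff_ι_mul, ht,
        twist_pure he, twist_pure (pure_diff hδ he), map_smul, smul_mul_assoc,
        mul_smul_comm, he, hv, smul_add, smul_smul, mul_add, LinearMap.smul_apply]
      cases b <;> cases e <;> simp <;> abel)
  exact LinearMap.congr_fun h t

end Insertion

end SymCobar
end

noncomputable section

namespace SymCobar

open TensorAlgebra (ι)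

section TensorMaps

variable {R : Type*} [CommSemiring R] {A B B' D E : Type*} [AddCommMonoid A] [AddCommMonoid B]
  [AddCommMonoid B'] [AddCommMonoid D] [AddCommMonoid E] [Module R A] [Module R B] [Module R B']
  [Module R D] [Module R E]

lemma map_rTensor_apply (f : B →ₗ[R] B') (g : D →ₗ[R] E) (u : A →ₗ[R] B) (y : A ⊗[R] D) :
    TensorProduct.map f g (u.rTensor D y) = TensorProduct.map (f ∘ₗ u) g y := by
  rw [← LinearMap.map_comp_rTensor, LinearMap.comp_apply]

lemma rTensor_map_apply (f : A →ₗ[R] B) (g : D →ₗ[R] E) (u : B →ₗ[R] B') (y : A ⊗[R] D) :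
    u.rTensor E (TensorProduct.map f g y) = TensorProduct.map (u ∘ₗ f) g y := by
  rw [← LinearMap.rTensor_comp_map, LinearMap.comp_apply]

end TensorMaps

/-! ### Deconcatenation and its component for the last letter -/

section Deconcatenation

variable {k : Type u} [Field k] {M : Type*} [AddCommGroup M] [Module k M]

/-- Deconcatenation of tensors. -/
def deconcat : TensorAlgebra k M →ₗ[k] TensorAlgebra k M ⊗[k] TensorAlgebra k M :=
  tensorRec (1 ⊗ₜ 1)
    ((LinearMap.mul k (TensorAlgebra k M)).compr₂ (TensorProduct.mk k _ _ 1) ∘ₗ ι k)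
    (LinearMap.rTensorHom (TensorAlgebra k M) ∘ₗ LinearMap.mul k (TensorAlgebra k M) ∘ₗ ι k)

@[simp] lemma deconcat_one : deconcat (1 : TensorAlgebra k M) = 1 ⊗ₜ 1 := by simp [deconcat]

@[simp] lemma deconcat_ι_mul (x : M) (t : TensorAlgebra k M) :
    deconcat (ι k x * t) = 1 ⊗ₜ (ι k x * t) +
      (LinearMap.mul k (TensorAlgebra k M) (ι k x)).rTensor _ (deconcat t) := by
  simp [deconcat]

/-- After a cut, the inserted vector lies in the left or in the right piece; in the second case it
has passed the whole left piece, whence the twist there. This is the compatibility of the shuffle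
product with deconcatenation. -/
lemma deconcat_insertion [CharZero k] {τ : M →ₗ[k] M} {v : M} {b : Bool}
    (hv : τ v = boolSign k b • v) (t : TensorAlgebra k M) :
    deconcat (insertion τ t v) =
      ((insertion τ).flip v).rTensor _ (deconcat t) +
        TensorProduct.map (tensorTwist τ b).toLinearMap ((insertion τ).flip v) (deconcat t) := by
  have h := tensor_ext' (f := deconcat ∘ₗ (insertion τ).flip v)
    (g := (((insertion τ).flip v).rTensor _ +
        TensorProduct.map (tensorTwist τ b).toLinearMap ((insertion τ).flip v)) ∘ₗ deconcat)
    (by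
      have := deconcat_ι_mul v (1 : TensorAlgebra k M)
      rw [mul_one] at this
      simp [this, add_comm])
    (fun x t ht => by
      simp only [LinearMap.comp_apply, LinearMap.flip_apply, LinearMap.add_apply] at ht ⊢
      -- Inserting `v` into a left piece that begins with `x` puts it either before `x` or behind
      -- it.
      have h1 : ∀ y : TensorAlgebra k M ⊗[k] TensorAlgebra k M,
          ((insertion τ).flip v).rTensor _
            ((LinearMap.mul k (TensorAlgebra k M) (ι k x)).rTensor _ y) =
          (LinearMap.mul k (TensorAlgebra k M) (ι k v)).rTensor _
            ((LinearMap.mul k (TensorAlgebra k M) (ι k x)).rTensor _ y) +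
          (LinearMap.mul k (TensorAlgebra k M) (ι k (twist τ b x))).rTensor _
            (((insertion τ).flip v).rTensor _ y) := by
        intro y
        rw [← LinearMap.rTensor_comp_apply, ← LinearMap.rTensor_comp_apply,
          ← LinearMap.rTensor_comp_apply, ← LinearMap.add_apply, ← LinearMap.rTensor_add]
        congr 2
        exact LinearMap.ext fun t => insertion_ι_mul hv x t
      have h2 : ∀ y : TensorAlgebra k M ⊗[k] TensorAlgebra k M,
          TensorProduct.map (tensorTwist τ b).toLinearMap ((insertion τ).flip v)
            ((LinearMap.mul k (TensorAlgebra k M) (ι k x)).rTensor _ y) =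
          (LinearMap.mul k (TensorAlgebra k M) (ι k (twist τ b x))).rTensor _
            (TensorProduct.map (tensorTwist τ b).toLinearMap ((insertion τ).flip v) y) := by
        intro y
        rw [map_rTensor_apply, rTensor_map_apply]
        congr 2
        exact LinearMap.ext fun t => by simp
      rw [insertion_ι_mul hv]
      simp only [map_add, deconcat_ι_mul, ht, h1, h2, LinearMap.rTensor_tmul,
        TensorProduct.map_tmul, LinearMap.flip_apply, insertion_one, LinearMap.mul_apply',
        insertion_ι_mul hv, TensorProduct.tmul_add, AlgHom.toLinearMap_apply, map_one, mul_one]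
      abel)
  exact LinearMap.congr_fun h t

@[simp] lemma algebraMapInv_ι_mul (x : M) (t : TensorAlgebra k M) :
    TensorAlgebra.algebraMapInv (ι k x * t) = 0 := by
  simp [TensorAlgebra.algebraMapInv]

/-- The component of deconcatenation that splits off the last letter of a tensor. -/
def lastLetter : TensorAlgebra k M →ₗ[k] TensorAlgebra k M ⊗[k] M :=
  tensorRec 0
    (((LinearMap.lsmul k (TensorAlgebra k M ⊗[k] M)).flip ∘ₗ
      (TensorProduct.mk k (TensorAlgebra k M) M 1)).compl₂
        (TensorAlgebra.algebraMapInv (R := k) (M := M)).toLinearMap)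
    (LinearMap.rTensorHom M ∘ₗ LinearMap.mul k (TensorAlgebra k M) ∘ₗ ι k)

@[simp] lemma lastLetter_one : lastLetter (1 : TensorAlgebra k M) = 0 := by simp [lastLetter]

@[simp] lemma lastLetter_ι_mul (x : M) (t : TensorAlgebra k M) :
    lastLetter (ι k x * t) = TensorAlgebra.algebraMapInv t • ((1 : TensorAlgebra k M) ⊗ₜ[k] x) +
      (LinearMap.mul k (TensorAlgebra k M) (ι k x)).rTensor M (lastLetter t) := by
  simp [lastLetter]

/-- Multiplication of a tensor by a vector from the right. -/
def mulVec {N : Type*} [AddCommGroup N] [Module k N] (i : M →ₗ[k] N) :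
    TensorAlgebra k N ⊗[k] M →ₗ[k] TensorAlgebra k N :=
  TensorProduct.lift ((LinearMap.mul k (TensorAlgebra k N)).compl₂ (ι k ∘ₗ i))

@[simp] lemma mulVec_tmul {N : Type*} [AddCommGroup N] [Module k N] (i : M →ₗ[k] N)
    (t : TensorAlgebra k N) (v : M) : mulVec i (t ⊗ₜ v) = t * ι k (i v) := rfl

lemma mulVec_rTensor_mul {N : Type*} [AddCommGroup N] [Module k N] (i : M →ₗ[k] N)
    (a : TensorAlgebra k N) (y : TensorAlgebra k N ⊗[k] M) :
    mulVec i ((LinearMap.mul k (TensorAlgebra k N) a).rTensor M y) = a * mulVec i y := by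
  induction y using TensorProduct.induction_on with
  | zero => simp
  | add y z hy hz => simp only [map_add, hy, hz, mul_add]
  | tmul t v => simp [mul_assoc]

lemma mulVec_lastLetter (t : TensorAlgebra k M) :
    mulVec LinearMap.id (lastLetter t) =
      t - algebraMap k _ (TensorAlgebra.algebraMapInv t) := by
  have h := tensor_ext' (f := mulVec LinearMap.id ∘ₗ lastLetter (k := k) (M := M))
    (g := LinearMap.id - Algebra.linearMap k _ ∘ₗ TensorAlgebra.algebraMapInv.toLinearMap)
    (by simp) (fun x t ht => by
      simp only [LinearMap.comp_apply, LinearMap.sub_apply, LinearMap.id_apply,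
        AlgHom.toLinearMap_apply, Algebra.linearMap_apply] at ht ⊢
      rw [lastLetter_ι_mul, map_add, mulVec_rTensor_mul, ht]
      simp [TensorAlgebra.algebraMapInv, mul_sub, Algebra.smul_def, Algebra.commutes])
  exact LinearMap.congr_fun h t

variable [CharZero k]

lemma algebraMapInv_insertion {τ : M →ₗ[k] M} {v : M} {b : Bool}
    (hv : τ v = boolSign k b • v) (t : TensorAlgebra k M) :
    TensorAlgebra.algebraMapInv (insertion τ t v) = 0 := by
  have h := tensor_ext' (f := TensorAlgebra.algebraMapInv.toLinearMap ∘ₗ (insertion τ).flip v)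
    (g := 0) (by simp [TensorAlgebra.algebraMapInv]) (fun x t ht => by
      simp [insertion_ι_mul hv, TensorAlgebra.algebraMapInv])
  exact LinearMap.congr_fun h t

/-- The last letter after the insertion is either the old last letter or `v` itself, which has then
passed all of `t`. -/
lemma lastLetter_insertion {τ : M →ₗ[k] M} {v : M} {b : Bool}
    (hv : τ v = boolSign k b • v) (t : TensorAlgebra k M) :
    lastLetter (insertion τ t v) = ((insertion τ).flip v).rTensor M (lastLetter t) +
      tensorTwist τ b t ⊗ₜ v := by
  have h := tensor_ext' (f := lastLetter ∘ₗ (insertion τ).flip v)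
    (g := ((insertion τ).flip v).rTensor M ∘ₗ lastLetter +
      (TensorProduct.mk k _ M).flip v ∘ₗ (tensorTwist τ b).toLinearMap)
    (by
      have := lastLetter_ι_mul v (1 : TensorAlgebra k M)
      rw [mul_one] at this
      simp [this])
    (fun x t ht => by
      simp only [LinearMap.comp_apply, LinearMap.flip_apply, LinearMap.add_apply,
        TensorProduct.mk_apply, AlgHom.toLinearMap_apply] at ht ⊢
      have h1 : ∀ y : TensorAlgebra k M ⊗[k] M,
          ((insertion τ).flip v).rTensor _
            ((LinearMap.mul k (TensorAlgebra k M) (ι k x)).rTensor _ y) =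
          (LinearMap.mul k (TensorAlgebra k M) (ι k v)).rTensor _
            ((LinearMap.mul k (TensorAlgebra k M) (ι k x)).rTensor _ y) +
          (LinearMap.mul k (TensorAlgebra k M) (ι k (twist τ b x))).rTensor _
            (((insertion τ).flip v).rTensor _ y) := by
        intro y
        rw [← LinearMap.rTensor_comp_apply, ← LinearMap.rTensor_comp_apply,
          ← LinearMap.rTensor_comp_apply, ← LinearMap.add_apply, ← LinearMap.rTensor_add]
        congr 2
        exact LinearMap.ext fun t => insertion_ι_mul hv x t
      rw [insertion_ι_mul hv]
      simp only [map_add, lastLetter_ι_mul, ht, h1, LinearMap.rTensor_tmul, map_smul,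
        LinearMap.flip_apply, insertion_one, LinearMap.mul_apply', map_mul (tensorTwist τ b), tensorTwist_ι,
        algebraMapInv_insertion hv, zero_smul, mul_one, algebraMapInv_ι_mul]
      abel)
  exact LinearMap.congr_fun h t

end Deconcatenation

/-! ### Extraction of a letter, and sums over permutations -/

section Extraction

variable {k : Type u} [Field k] {M : Type*} [AddCommGroup M] [Module k M]
  {C : Type*} [AddCommGroup C] [Module k C]

/-- Moving a vector past a tensor, with the Koszul sign. -/
def koszulSwap (ρ : C →ₗ[k] C) (ρM : M →ₗ[k] M) :
    M →ₗ[k] TensorAlgebra k C →ₗ[k] TensorAlgebra k C ⊗[k] M :=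
  ∑ b : Bool, (TensorProduct.mk k (TensorAlgebra k C) M).flip.compl₁₂ (parityProj ρM b)
    (tensorTwist ρ b).toLinearMap

lemma koszulSwap_pure [CharZero k] (ρ : C →ₗ[k] C) {ρM : M →ₗ[k] M} {v : M} {b : Bool}
    (hv : ρM v = boolSign k b • v) (a : TensorAlgebra k C) :
    koszulSwap ρ ρM v a = tensorTwist ρ b a ⊗ₜ v := by
  simp only [koszulSwap, LinearMap.sum_apply, LinearMap.compl₁₂_apply]
  exact sum_parityProj_pure hv fun c => TensorProduct.mk k _ _ (tensorTwist ρ c a)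

/-- The signed sum of the results of removing from a word a letter `x` and placing `π x` to the
right of the word. -/
def extraction (ρ : C →ₗ[k] C) (ρM : M →ₗ[k] M) (π : C →ₗ[k] M) :
    TensorAlgebra k C →ₗ[k] TensorAlgebra k C ⊗[k] M :=
  tensorRec 0 (koszulSwap ρ ρM ∘ₗ π)
    (LinearMap.rTensorHom M ∘ₗ LinearMap.mul k (TensorAlgebra k C) ∘ₗ ι k)

@[simp] lemma extraction_one (ρ : C →ₗ[k] C) (ρM : M →ₗ[k] M) (π : C →ₗ[k] M) :
    extraction ρ ρM π 1 = 0 := by simp [extraction]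

@[simp] lemma extraction_ι_mul (ρ : C →ₗ[k] C) (ρM : M →ₗ[k] M) (π : C →ₗ[k] M) (x : C)
    (a : TensorAlgebra k C) : extraction ρ ρM π (ι k x * a) = koszulSwap ρ ρM (π x) a +
      (LinearMap.mul k (TensorAlgebra k C) (ι k x)).rTensor M (extraction ρ ρM π a) := by
  simp [extraction]

variable {M' : Type*} [AddCommGroup M'] [Module k M'] {C' : Type*} [AddCommGroup C'] [Module k C']

lemma koszulSwap_map [CharZero k] {ρ : C →ₗ[k] C} {ρM : M →ₗ[k] M} {ρ' : C' →ₗ[k] C'}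
    {ρM' : M' →ₗ[k] M'} (hρM : ρM ∘ₗ ρM = LinearMap.id)
    {ψ : C →ₗ[k] C'} {φ : M →ₗ[k] M'} (hψ : ∀ x, ψ (ρ x) = ρ' (ψ x))
    (hφ : ∀ x, φ (ρM x) = ρM' (φ x)) (v : M) (a : TensorAlgebra k C) :
    TensorProduct.map (TensorAlgebra.lift k (ι k ∘ₗ ψ)).toLinearMap φ (koszulSwap ρ ρM v a) =
      koszulSwap ρ' ρM' (φ v) (TensorAlgebra.lift k (ι k ∘ₗ ψ) a) := by
  have h := ext_homogeneous hρM (f := (koszulSwap ρ ρM).compr₂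
      (TensorProduct.map (TensorAlgebra.lift k (ι k ∘ₗ ψ)).toLinearMap φ))
    (g := (koszulSwap ρ' ρM').compl₁₂ φ (TensorAlgebra.lift k (ι k ∘ₗ ψ)).toLinearMap)
    fun b v hv => LinearMap.ext fun a => by
      have hv' : ρM' (φ v) = boolSign k b • φ v := by rw [← hφ, hv, map_smul]
      simp only [LinearMap.compr₂_apply, LinearMap.compl₁₂_apply, AlgHom.toLinearMap_apply]
      rw [koszulSwap_pure ρ hv, koszulSwap_pure ρ' hv', TensorProduct.map_tmul,
        AlgHom.toLinearMap_apply, tensorTwist_map hψ]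
  exact LinearMap.congr_fun₂ h v a

/-- Besides the maps induced by morphisms, this is applied to the parity involution (`extract_par`)
and to the projection `π` onto words of vectors (`permProj_eq`). -/
lemma extraction_map [CharZero k] {ρ : C →ₗ[k] C} {ρM : M →ₗ[k] M} {ρ' : C' →ₗ[k] C'}
    {ρM' : M' →ₗ[k] M'} (hρM : ρM ∘ₗ ρM = LinearMap.id) {π : C →ₗ[k] M} {π' : C' →ₗ[k] M'}
    {ψ : C →ₗ[k] C'} {φ : M →ₗ[k] M'} (hψ : ∀ x, ψ (ρ x) = ρ' (ψ x))
    (hφ : ∀ x, φ (ρM x) = ρM' (φ x)) (hπ : ∀ x, φ (π x) = π' (ψ x)) (a : TensorAlgebra k C) :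
    TensorProduct.map (TensorAlgebra.lift k (ι k ∘ₗ ψ)).toLinearMap φ (extraction ρ ρM π a) =
      extraction ρ' ρM' π' (TensorAlgebra.lift k (ι k ∘ₗ ψ) a) := by
  have h := tensor_ext' (f := TensorProduct.map (TensorAlgebra.lift k (ι k ∘ₗ ψ)).toLinearMap φ ∘ₗ
      extraction ρ ρM π) (g := extraction ρ' ρM' π' ∘ₗ
      (TensorAlgebra.lift k (ι k ∘ₗ ψ)).toLinearMap) (by simp) (fun x a ha => by
    simp only [LinearMap.comp_apply, AlgHom.toLinearMap_apply] at ha ⊢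
    rw [map_mul (TensorAlgebra.lift k _), TensorAlgebra.lift_ι_apply, LinearMap.comp_apply,
      extraction_ι_mul, extraction_ι_mul, map_add, ← ha, koszulSwap_map hρM hψ hφ, hπ]
    congr 1
    rw [map_rTensor_apply, rTensor_map_apply]
    congr 2
    exact LinearMap.ext fun t => by simp)
  exact LinearMap.congr_fun h a

/-- The sum of all permutations of a tensor, with Koszul signs. -/
def permSum (τ : M →ₗ[k] M) : TensorAlgebra k M →ₗ[k] TensorAlgebra k M :=
  tensorRec 1 0 (insertion τ).flip

@[simp] lemma permSum_one (τ : M →ₗ[k] M) : permSum τ 1 = 1 := by simp [permSum]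

@[simp] lemma permSum_ι_mul (τ : M →ₗ[k] M) (x : M) (t : TensorAlgebra k M) :
    permSum τ (ι k x * t) = insertion τ (permSum τ t) x := by simp [permSum]

lemma tensorTwist_permSum [CharZero k] {τ : M →ₗ[k] M} (hτ : τ ∘ₗ τ = LinearMap.id) (b : Bool)
    (t : TensorAlgebra k M) : tensorTwist τ b (permSum τ t) = permSum τ (tensorTwist τ b t) := by
  have h := tensor_ext (f := (tensorTwist τ b).toLinearMap ∘ₗ permSum τ)
    (g := permSum τ ∘ₗ (tensorTwist τ b).toLinearMap) (span_homogeneous hτ) (by simp)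
    (fun x ⟨e, he⟩ t ht => by
      simp only [LinearMap.comp_apply, AlgHom.toLinearMap_apply] at ht ⊢
      rw [permSum_ι_mul, map_mul, tensorTwist_ι, permSum_ι_mul, tensorTwist_insertion hτ _ he, ht,
        twist_pure he, map_smul, Bool.and_comm])
  exact LinearMap.congr_fun h t

/-- Every letter of `t` can become the last one; the letters in front of it are then an arbitrary
permutation of the others, and the sign is that of moving the chosen letter to the end. -/
lemma lastLetter_permSum [CharZero k] {τ : M →ₗ[k] M} (hτ : τ ∘ₗ τ = LinearMap.id)
    (t : TensorAlgebra k M) :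
    lastLetter (permSum τ t) = (permSum τ).rTensor M (extraction τ τ LinearMap.id t) := by
  have h := tensor_ext (f := lastLetter ∘ₗ permSum τ)
    (g := (permSum τ).rTensor M ∘ₗ extraction τ τ LinearMap.id) (span_homogeneous hτ) (by simp)
    (fun x ⟨e, he⟩ t ht => by
      simp only [LinearMap.comp_apply] at ht ⊢
      rw [permSum_ι_mul, lastLetter_insertion he, ht, extraction_ι_mul, map_add,
        LinearMap.id_apply, koszulSwap_pure τ he, LinearMap.rTensor_tmul,
        ← tensorTwist_permSum hτ, add_comm, ← LinearMap.rTensor_comp_apply,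
        ← LinearMap.rTensor_comp_apply]
      congr 3
      exact LinearMap.ext fun t => by simp)
  exact LinearMap.congr_fun h t

/-- A sum over permutations is the sum over the choices of the last letter. -/
lemma permSum_eq [CharZero k] {τ : M →ₗ[k] M} (hτ : τ ∘ₗ τ = LinearMap.id)
    (t : TensorAlgebra k M) :
    permSum τ t = mulVec LinearMap.id ((permSum τ).rTensor M (extraction τ τ LinearMap.id t)) +
      algebraMap k _ (TensorAlgebra.algebraMapInv t) := by
  have h : TensorAlgebra.algebraMapInv (permSum τ t) = TensorAlgebra.algebraMapInv t := by
    have h := tensor_ext (f := TensorAlgebra.algebraMapInv.toLinearMap ∘ₗ permSum τ)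
      (g := TensorAlgebra.algebraMapInv.toLinearMap) (span_homogeneous hτ) (by simp)
      (fun x ⟨e, he⟩ t ht => by
        simp [algebraMapInv_insertion he])
    exact LinearMap.congr_fun h t
  rw [← lastLetter_permSum hτ, mulVec_lastLetter, h, sub_add_cancel]

end Extraction

end SymCobar
end

noncomputable section

namespace SymCobar

open TensorAlgebra (ι)
open TensorPower (toTensorAlgebra)

/-! ### Comparison with tensor powers, symmetrizers and the graded action of permutations -/

section TensorPowers

variable {k : Type u} [Field k] {M : Type*} [AddCommGroup M] [Module k M]
  {N : Type*} [AddCommGroup N] [Module k N]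

lemma ofDirectSum_of {n : ℕ} (t : ⨂[k]^n M) :
    TensorAlgebra.ofDirectSum (DirectSum.of (fun n => ⨂[k]^n M) n t) = toTensorAlgebra t :=
  DirectSum.toAddMonoid_of
    (fun _ ↦ LinearMap.toAddMonoidHom TensorPower.toTensorAlgebra) _ _

lemma toDirectSum_toTensorAlgebra {n : ℕ} (t : ⨂[k]^n M) :
    TensorAlgebra.toDirectSum (toTensorAlgebra t) = DirectSum.of (fun n => ⨂[k]^n M) n t := by
  rw [← ofDirectSum_of, TensorAlgebra.toDirectSum_ofDirectSum]

/-- The tensor product of a vector and a tensor. -/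
def tensorCons (n : ℕ) : M →ₗ[k] (⨂[k]^n M) →ₗ[k] (⨂[k]^(n + 1) M) :=
  (PiTensorProduct.lift (R := k) (s := fun _ : Fin n => M)).toLinearMap ∘ₗ
    (PiTensorProduct.tprod k (s := fun _ : Fin (n + 1) => M)).curryLeft

lemma tensorCons_tprod {n : ℕ} (v : M) (w : Fin n → M) :
    tensorCons n v (PiTensorProduct.tprod k w) =
      PiTensorProduct.tprod k (Fin.cons v w : Fin (n + 1) → M) :=
  PiTensorProduct.lift.tprod _

lemma tprod_cons {n : ℕ} (v : M) (w : Fin n → M) :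
    TensorAlgebra.tprod k M (n + 1) (Fin.cons v w) = ι k v * TensorAlgebra.tprod k M n w := by
  simp [TensorAlgebra.tprod_apply, List.ofFn_succ]

lemma tprod_zero (w : Fin 0 → M) : TensorAlgebra.tprod k M 0 w = 1 := by
  simp [TensorAlgebra.tprod_apply]

lemma toTensorAlgebra_tensorCons {n : ℕ} (v : M) (t : ⨂[k]^n M) :
    toTensorAlgebra (tensorCons n v t) = ι k v * toTensorAlgebra t := by
  have : toTensorAlgebra ∘ₗ tensorCons n v =
      LinearMap.mulLeft k (ι k v) ∘ₗ toTensorAlgebra (R := k) (n := n) := by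
    refine PiTensorProduct.ext (MultilinearMap.ext fun w => ?_)
    simp only [LinearMap.compMultilinearMap_apply, LinearMap.comp_apply, tensorCons_tprod,
      TensorPower.toTensorAlgebra_tprod, tprod_cons, LinearMap.mulLeft_apply]
  exact LinearMap.congr_fun this t

lemma toTensorAlgebra_map {n : ℕ} (φ : M →ₗ[k] N) (t : ⨂[k]^n M) :
    toTensorAlgebra (PiTensorProduct.map (fun _ => φ) t) =
      TensorAlgebra.lift k (ι k ∘ₗ φ) (toTensorAlgebra t) := by
  have : toTensorAlgebra ∘ₗ PiTensorProduct.map (fun _ : Fin n => φ) =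
      (TensorAlgebra.lift k (ι k ∘ₗ φ)).toLinearMap ∘ₗ toTensorAlgebra := by
    refine PiTensorProduct.ext (MultilinearMap.ext fun w => ?_)
    simp [TensorAlgebra.tprod_apply, map_list_prod, List.map_ofFn, Function.comp_def]
  exact LinearMap.congr_fun this t

lemma toTensorAlgebra_tensorD {n : ℕ} (ε d : M →ₗ[k] M) (t : ⨂[k]^n M) :
    toTensorAlgebra (tensorD ε d n t) = tensorDiff ε d (toTensorAlgebra t) := by
  have : toTensorAlgebra ∘ₗ tensorD ε d n = tensorDiff ε d ∘ₗ toTensorAlgebra := by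
    clear t
    refine PiTensorProduct.ext (MultilinearMap.ext fun w => ?_)
    simp only [LinearMap.compMultilinearMap_apply, LinearMap.comp_apply, tensorD,
      LinearMap.sum_apply, map_sum, PiTensorProduct.map_tprod, TensorPower.toTensorAlgebra_tprod]
    induction n with
    | zero => simp
    | succ n ih =>
      obtain ⟨v, w, rfl⟩ : ∃ v w', w = Fin.cons v w' :=
        ⟨w 0, Fin.tail w, (Fin.cons_self_tail w).symm⟩
      rw [tprod_cons, tensorDiff_ι_mul, ← ih w, Fin.sum_univ_succ, Finset.mul_sum]
      · congr 1
        · rw [← tprod_cons]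
          congr 1
          ext j
          refine Fin.cases ?_ (fun j => ?_) j <;> simp
        · refine Finset.sum_congr rfl fun i _ => ?_
          rw [← tprod_cons]
          congr 1
          ext j
          refine Fin.cases ?_ (fun j => ?_) j <;> simp
  exact LinearMap.congr_fun this t

variable [CharZero k]

/-- A permutation fixing `0` has no inversion that involves `0`. -/
lemma koszulSign_decomposeFin {n : ℕ} (σ : Equiv.Perm (Fin n)) (b : Bool) (e : Fin n → Bool) :
    koszulSign (Equiv.Perm.decomposeFin.symm (0, σ)) (Fin.cons b e) = koszulSign σ e := by
  simp [koszulSign_eq', Fin.prod_univ_succ, Fin.succ_lt_succ_iff]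

omit [CharZero k] in
lemma pure_cons {τ : M →ₗ[k] M} {v : M} {b : Bool} (hv : τ v = boolSign k b • v) {n : ℕ}
    {w : Fin n → M} {e : Fin n → Bool} (hw : ∀ i, τ (w i) = boolSign k (e i) • w i) (i : Fin (n + 1)) :
    τ ((Fin.cons v w : Fin (n + 1) → M) i) =
      boolSign k ((Fin.cons b e : Fin (n + 1) → Bool) i) • (Fin.cons v w : Fin (n + 1) → M) i := by
  refine Fin.cases ?_ (fun j => ?_) i
  · simpa using hv
  · simpa using hw j

lemma koszulAct_tensorCons {τ : M →ₗ[k] M} (hτ : τ ∘ₗ τ = LinearMap.id) {n : ℕ}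
    (σ : Equiv.Perm (Fin n)) (v : M) (t : ⨂[k]^n M) :
    koszulAct τ (Equiv.Perm.decomposeFin.symm (0, σ)) (tensorCons n v t) =
      tensorCons n v (koszulAct τ σ t) := by
  have h := ext_homogeneous hτ
    (f := (tensorCons n).compr₂ (koszulAct τ (Equiv.Perm.decomposeFin.symm (0, σ))))
    (g := (tensorCons n).compl₂ (koszulAct τ σ)) fun b v hv => by
    refine ext_pure hτ fun e w hw => ?_
    rw [LinearMap.compr₂_apply, LinearMap.compl₂_apply, koszulAct_pure σ hw, tensorCons_tprod,
      map_smul, tensorCons_tprod, koszulAct_pure _ (pure_cons hv hw), koszulSign_decomposeFin]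
    congr 2
    ext i
    refine Fin.cases ?_ (fun j => ?_) i
    · have : (Equiv.Perm.decomposeFin.symm (0, σ)).symm 0 = 0 := by
        rw [Equiv.symm_apply_eq]; simp
      rw [this, Fin.cons_zero, Fin.cons_zero]
    · have : (Equiv.Perm.decomposeFin.symm (0, σ)).symm j.succ = (σ.symm j).succ := by
        rw [Equiv.symm_apply_eq]; simp
      rw [this, Fin.cons_succ, Fin.cons_succ]
  exact LinearMap.congr_fun₂ h v t

/-- The group permuting the last `n` factors is the stabilizer of the first position in the full
symmetric group, so its action is absorbed by the full average. -/
lemma symmetrizer_tensorCons {τ : M →ₗ[k] M} (hτ : τ ∘ₗ τ = LinearMap.id) {n : ℕ} (v : M)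
    (t : ⨂[k]^n M) : symmetrizer τ (n + 1) (tensorCons n v (symmetrizer τ n t)) =
      symmetrizer τ (n + 1) (tensorCons n v t) := by
  have h : ∀ σ : Equiv.Perm (Fin n), symmetrizer τ (n + 1) (tensorCons n v (koszulAct τ σ t)) =
      symmetrizer τ (n + 1) (tensorCons n v t) := fun σ => by
    rw [← koszulAct_tensorCons hτ]
    exact LinearMap.congr_fun (symmetrizer_comp_koszulAct hτ _) _
  conv_lhs => rw [symmetrizer.eq_def τ n]
  simp only [LinearMap.smul_apply, LinearMap.sum_apply, map_smul, map_sum, h, Finset.sum_const,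
    Finset.card_univ, Fintype.card_perm, Fintype.card_fin]
  rw [← Nat.cast_smul_eq_nsmul k, inv_smul_smul₀]
  exact_mod_cast Nat.factorial_ne_zero _

/-- The inverse of `cycleRange i` moves the first factor to position `i` and keeps the order of the
others; only the factors that the first one passes contribute. -/
lemma koszulSign_cycleRange {n : ℕ} (i : Fin (n + 1)) (b : Bool) (e : Fin n → Bool) :
    koszulSign (Fin.cycleRange i).symm (Fin.cons b e) =
      ∏ j : Fin n, if j.castSucc < i ∧ (b && e j) = true then (-1 : ℤˣ) else 1 := by
  have h : ∀ x y : Fin n, ¬ (x < y ∧ i.succAbove y < i.succAbove x) := fun x y h =>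
    lt_asymm h.1 ((Fin.strictMono_succAbove i).lt_iff_lt.1 h.2)
  rw [koszulSign_eq', Fin.prod_univ_succ]
  simp only [Fin.prod_univ_succ, Fin.cons_zero, Fin.cons_succ, Fin.cycleRange_symm_zero,
    Fin.cycleRange_symm_succ, lt_irrefl, Fin.succ_pos, Fin.not_lt_zero, false_and, and_false,
    true_and, if_false, one_mul, Fin.succ_lt_succ_iff, h, Finset.prod_const_one, mul_one,
    Fin.succAbove_lt_iff_castSucc_lt]
  refine Finset.prod_congr rfl fun j _ => ?_
  congr 1
  simp only [Bool.and_eq_true]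
  exact propext (by tauto)

lemma insertion_tprod {τ : M →ₗ[k] M} {v : M} {b : Bool} (hv : τ v = boolSign k b • v) {n : ℕ}
    {w : Fin n → M} {e : Fin n → Bool} (hw : ∀ i, τ (w i) = boolSign k (e i) • w i) :
    insertion τ (TensorAlgebra.tprod k M n w) v =
      ∑ i : Fin (n + 1), (((∏ j : Fin n, if j.castSucc < i ∧ (b && e j) = true then
        (-1 : ℤˣ) else 1 : ℤˣ) : ℤ) : k) • TensorAlgebra.tprod k M (n + 1) (i.insertNth v w) := by
  induction n with
  | zero => simp [TensorAlgebra.tprod_apply]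
  | succ n ih =>
    obtain ⟨x, w, rfl⟩ : ∃ x w', w = Fin.cons x w' :=
      ⟨w 0, Fin.tail w, (Fin.cons_self_tail w).symm⟩
    obtain ⟨c, e, rfl⟩ : ∃ c e', e = Fin.cons c e' :=
      ⟨e 0, Fin.tail e, (Fin.cons_self_tail e).symm⟩
    have hx : τ x = boolSign k c • x := by simpa using hw 0
    rw [tprod_cons, insertion_ι_mul hv, ih (fun i => by simpa using hw i.succ),
      ← tprod_cons, ← tprod_cons, Finset.mul_sum]
    conv_rhs => rw [Fin.sum_univ_succ]
    congr 1
    · simp [Fin.insertNth_zero']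
    · refine Finset.sum_congr rfl fun i _ => ?_
      rw [Fin.insertNth_succ_cons, tprod_cons, twist_pure hx, Fin.prod_univ_succ]
      simp only [Fin.cons_zero, Fin.cons_succ, Fin.castSucc_zero, Fin.succ_pos, true_and,
        Fin.castSucc_succ, Fin.succ_lt_succ_iff, map_smul, smul_mul_assoc, mul_smul_comm,
        smul_smul, Units.val_mul, Int.cast_mul]
      congr 1
      rw [mul_comm]
      congr 1
      cases b <;> cases c <;> simp

/-- The signed sum of the insertions of a vector into a symmetric tensor is a multiple of a
symmetrization. -/
lemma toTensorAlgebra_symmetrizer_tensorCons {τ : M →ₗ[k] M} (hτ : τ ∘ₗ τ = LinearMap.id) {n : ℕ}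
    (v : M) {c : ⨂[k]^n M} (hc : c ∈ SymPow τ n) :
    ((n + 1 : ℕ) : k) • toTensorAlgebra (symmetrizer τ (n + 1) (tensorCons n v c)) =
      insertion τ (toTensorAlgebra c) v := by
  -- These cycles represent the left cosets of the stabilizer of the first position. As `c` is
  -- already symmetric, summing over the representatives produces a symmetric tensor.
  let z : ⨂[k]^(n + 1) M := ∑ i : Fin (n + 1), koszulAct τ (Fin.cycleRange i).symm (tensorCons n v c)
  have hz : z ∈ SymPow τ (n + 1) := fun ρ => by
    rw [map_sum]
    refine Fintype.sum_equiv ρ _ _ fun i => ?_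
    rw [← LinearMap.comp_apply, ← koszulAct_mul hτ]
    -- The product of `ρ` with the two cycles fixes `0`, hence comes from a permutation `σ` of the
    -- remaining factors, under which `c` is invariant.
    obtain ⟨⟨p, σ⟩, hp⟩ := Equiv.Perm.decomposeFin.symm.surjective
      ((Fin.cycleRange (ρ i)) * (ρ * (Fin.cycleRange i).symm))
    have hp0 : p = 0 := by
      have := congrArg (fun f : Equiv.Perm _ => f 0) hp
      simpa using this
    subst hp0
    have : ρ * (Fin.cycleRange i).symm =
        (Fin.cycleRange (ρ i)).symm * Equiv.Perm.decomposeFin.symm (0, σ) := by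
      rw [hp]
      ext j
      simp
    rw [this, koszulAct_mul hτ, LinearMap.comp_apply, koszulAct_tensorCons hτ, hc σ]
  have h1 : symmetrizer τ (n + 1) z = ((n + 1 : ℕ) : k) • symmetrizer τ (n + 1) (tensorCons n v c) := by
    have h : ∀ i : Fin (n + 1), symmetrizer τ (n + 1)
        (koszulAct τ (Fin.cycleRange i).symm (tensorCons n v c)) =
        symmetrizer τ (n + 1) (tensorCons n v c) := fun i =>
      LinearMap.congr_fun (symmetrizer_comp_koszulAct hτ _) _
    rw [map_sum, Finset.sum_congr rfl fun i _ => h i, Finset.sum_const, Finset.card_univ, Fintype.card_fin, ← Nat.cast_smul_eq_nsmul k]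
  rw [← map_smul, ← h1, symmetrizer_of_mem hz]
  -- The cycle with index `i` yields exactly the insertion in position `i`, with the same sign.
  have h2 := ext_homogeneous hτ
    (f := ∑ i : Fin (n + 1), (tensorCons n).compr₂ (toTensorAlgebra ∘ₗ koszulAct τ (Fin.cycleRange i).symm))
    (g := (insertion τ).flip.compl₂ toTensorAlgebra) fun b v hv => by
    refine ext_pure hτ fun e w hw => ?_
    rw [LinearMap.sum_apply, LinearMap.sum_apply, LinearMap.compl₂_apply, LinearMap.flip_apply,
      TensorPower.toTensorAlgebra_tprod, insertion_tprod hv hw]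
    refine Finset.sum_congr rfl fun i _ => ?_
    rw [LinearMap.compr₂_apply, tensorCons_tprod, LinearMap.comp_apply,
      koszulAct_pure _ (pure_cons hv hw), map_smul, TensorPower.toTensorAlgebra_tprod,
      koszulSign_cycleRange]
    congr 2
    exact Fin.cons_comp_cycleRange v w i
  have h3 := LinearMap.congr_fun₂ h2 v c
  simp only [LinearMap.sum_apply, LinearMap.compr₂_apply, LinearMap.compl₂_apply,
    LinearMap.flip_apply, LinearMap.comp_apply] at h3
  rw [← h3, map_sum]

/-- Induction on `n`: inserting a vector into `n!` times an average gives `(n + 1) · n!` times the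
average over the larger group. -/
lemma permSum_toTensorAlgebra {τ : M →ₗ[k] M} (hτ : τ ∘ₗ τ = LinearMap.id) {n : ℕ}
    (t : ⨂[k]^n M) :
    permSum τ (toTensorAlgebra t) = (n.factorial : k) • toTensorAlgebra (symmetrizer τ n t) := by
  have : permSum τ ∘ₗ toTensorAlgebra =
      (n.factorial : k) • toTensorAlgebra ∘ₗ symmetrizer τ n := by
    clear t
    refine PiTensorProduct.ext (MultilinearMap.ext fun w => ?_)
    simp only [LinearMap.compMultilinearMap_apply, LinearMap.comp_apply, LinearMap.smul_apply]
    induction n with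
    | zero =>
      rw [symmetrizer_of_mem]
      · simp
      · intro σ
        rw [Subsingleton.elim σ 1, koszulAct_one hτ, LinearMap.id_apply]
    | succ n ih =>
      obtain ⟨v, w, rfl⟩ : ∃ v w', w = Fin.cons v w' :=
        ⟨w 0, Fin.tail w, (Fin.cons_self_tail w).symm⟩
      rw [TensorPower.toTensorAlgebra_tprod, tprod_cons, permSum_ι_mul,
        ← TensorPower.toTensorAlgebra_tprod, ih, map_smul, LinearMap.smul_apply,
        ← toTensorAlgebra_symmetrizer_tensorCons hτ, symmetrizer_tensorCons hτ, tensorCons_tprod,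
        smul_smul, mul_comm, Nat.factorial_succ, Nat.cast_mul]
      exact fun σ => LinearMap.congr_fun (koszulAct_comp_symmetrizer hτ σ) _
  exact LinearMap.congr_fun this t

end TensorPowers

/-! ### Deconcatenation in terms of tensor powers -/

section Deconcatenation

variable {k : Type u} [Field k] {M : Type*} [AddCommGroup M] [Module k M]

lemma tprod_eq_list {n : ℕ} (w : Fin n → M) :
    TensorAlgebra.tprod k M n w = ((List.ofFn w).map (ι k)).prod := by
  rw [TensorAlgebra.tprod_apply, List.map_ofFn]; rfl

lemma deconcat_list (l : List M) : deconcat (l.map (ι k)).prod =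
    ∑ i ∈ Finset.range (l.length + 1),
      ((l.take i).map (ι k)).prod ⊗ₜ[k] ((l.drop i).map (ι k)).prod := by
  induction l with
  | nil => simp
  | cons x l ih =>
    rw [List.map_cons, List.prod_cons, deconcat_ι_mul, ih, List.length_cons,
      Finset.sum_range_succ' _ (l.length + 1), add_comm, map_sum]
    simp

lemma map_deconc {n p q : ℕ} (h : n = p + q) (w : Fin n → M) :
    TensorProduct.map toTensorAlgebra toTensorAlgebra (deconc h (PiTensorProduct.tprod k w)) =
      (((List.ofFn w).take p).map (ι k)).prod ⊗ₜ[k] (((List.ofFn w).drop p).map (ι k)).prod := by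
  subst h
  obtain ⟨a, b, rfl⟩ : ∃ a b, w = Fin.append a b :=
    ⟨_, _, (Fin.append_castAdd_natAdd (f := w)).symm⟩
  have : deconc rfl (PiTensorProduct.tprod k (Fin.append a b)) =
      PiTensorProduct.tprod k a ⊗ₜ[k] PiTensorProduct.tprod k b := by
    rw [← mulEquiv_tprod]
    simp [deconc]
  rw [this, TensorProduct.map_tmul, List.ofFn_fin_append, List.take_left', List.drop_left',
    TensorPower.toTensorAlgebra_tprod, TensorPower.toTensorAlgebra_tprod, tprod_eq_list,
    tprod_eq_list] <;> simp

lemma deconcat_toTensorAlgebra {n : ℕ} (t : ⨂[k]^(n + 1) M) :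
    deconcat (toTensorAlgebra t) = 1 ⊗ₜ toTensorAlgebra t + toTensorAlgebra t ⊗ₜ 1 +
      ∑ i : Fin n, TensorProduct.map toTensorAlgebra toTensorAlgebra
        (deconc (show n + 1 = ((i : ℕ) + 1) + ((n - 1 - (i : ℕ)) + 1) by have := i.isLt; omega) t) := by
  have : deconcat ∘ₗ toTensorAlgebra =
      TensorProduct.mk k _ _ 1 ∘ₗ toTensorAlgebra +
      (TensorProduct.mk k _ _).flip 1 ∘ₗ toTensorAlgebra +
      ∑ i : Fin n, TensorProduct.map toTensorAlgebra toTensorAlgebra ∘ₗ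
        (deconc (k := k) (M := M) (show n + 1 = ((i : ℕ) + 1) + ((n - 1 - (i : ℕ)) + 1) by
          have := i.isLt; omega)) := by
    refine PiTensorProduct.ext (MultilinearMap.ext fun w => ?_)
    simp only [LinearMap.compMultilinearMap_apply, LinearMap.comp_apply, LinearMap.add_apply,
      LinearMap.sum_apply, map_deconc, TensorPower.toTensorAlgebra_tprod, tprod_eq_list,
      deconcat_list, List.length_ofFn]
    -- The cuts before the first and after the last letter are split off; they are the two terms
    -- missing from the reduced coproduct.
    rw [Finset.sum_range_succ', Finset.sum_range_succ,
      Fin.sum_univ_eq_sum_range (fun i => ((List.take (i + 1) (List.ofFn w)).map (ι k)).prod ⊗ₜ[k]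
        ((List.drop (i + 1) (List.ofFn w)).map (ι k)).prod)]
    rw [List.take_of_length_le (i := n + 1) (by simp), List.drop_of_length_le (i := n + 1) (by simp)]
    simp
    abel
  simpa using LinearMap.congr_fun this t

end Deconcatenation

end SymCobar
end

noncomputable section

namespace SymCobar

open TensorAlgebra (ι)

/-! ### The Koszul flip, and coalgebras generated by shuffles with vectors -/

section KoszulFlip

variable {k : Type u} [Field k] {C : Type*} [AddCommGroup C] [Module k C]
  {B : Type*} [AddCommMonoid B] [Module k B]

/-- The symmetry `x ⊗ y ↦ ± y ⊗ x` with the Koszul sign. -/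
def koszulFlip (ε : C →ₗ[k] C) : C ⊗[k] C →ₗ[k] C ⊗[k] C :=
  TensorProduct.lift (∑ b : Bool, (TensorProduct.mk k C C).flip.compl₁₂ (parityProj ε b) (twist ε b))

variable [CharZero k]

lemma koszulFlip_pure {ε : C →ₗ[k] C} {x : C} {b : Bool} (hx : ε x = boolSign k b • x) (y : C) :
    koszulFlip ε (x ⊗ₜ y) = twist ε b y ⊗ₜ x := by
  simp only [koszulFlip, TensorProduct.lift.tmul, LinearMap.sum_apply, LinearMap.compl₁₂_apply]
  exact sum_parityProj_pure hx fun c => TensorProduct.mk k C C (twist ε c y)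

/-- Linear maps out of a tensor square agree if they agree on tensors with homogeneous factors. -/
lemma tensor_square_ext {ε : C →ₗ[k] C} (hε : ε ∘ₗ ε = LinearMap.id) {f g : C ⊗[k] C →ₗ[k] B}
    (h : ∀ b c x y, ε x = boolSign k b • x → ε y = boolSign k c • y → f (x ⊗ₜ y) = g (x ⊗ₜ y)) :
    f = g := by
  refine TensorProduct.ext (ext_homogeneous hε fun b x hx => ext_homogeneous hε fun c y hy => ?_)
  exact h b c x y hx hy

end KoszulFlip

/-- The structure on the reduced symmetric coalgebra `C` of the suspension of a complex that
enters into the contraction: `M` is the suspension with its parity involution `σ` and its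
differential `δ`, and `L v c` is the shuffle product of `v` and `c`, by which `C` is generated
from `M`. The polynomial `wt c` records the components of `c` of the various weights. -/
structure InsertionCoalgebra (k : Type u) [Field k] [CharZero k] (M : Type v) [AddCommGroup M]
    [Module k M] (C : Type w) [AddCommGroup C] [Module k C] where
  σ : M →ₗ[k] M
  δ : M →ₗ[k] M
  ε : C →ₗ[k] C
  d : C →ₗ[k] C
  Δ : C →ₗ[k] C ⊗[k] C
  incl : M →ₗ[k] C
  π : C →ₗ[k] M
  L : M →ₗ[k] C →ₗ[k] C
  wt : C →ₗ[k] Polynomial (TensorAlgebra k C)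
  σ_comp_σ : σ ∘ₗ σ = LinearMap.id
  δ_comp_σ : δ ∘ₗ σ = -(σ ∘ₗ δ)
  δ_δ : ∀ v, δ (δ v) = 0
  ε_incl : ∀ v, ε (incl v) = incl (σ v)
  ε_L : ∀ v c, ε (L v c) = L (σ v) (ε c)
  d_incl : ∀ v, d (incl v) = incl (δ v)
  d_L : ∀ {b v}, σ v = boolSign k b • v → ∀ c, d (L v c) = L (δ v) c + boolSign k b • L v (d c)
  Δ_incl : ∀ v, Δ (incl v) = 0
  Δ_L : ∀ {b v}, σ v = boolSign k b • v → ∀ c, Δ (L v c) =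
    incl v ⊗ₜ c + twist ε b c ⊗ₜ incl v +
      ((L v).rTensor C (Δ c) + TensorProduct.map (twist ε b) (L v) (Δ c))
  π_incl : ∀ v, π (incl v) = v
  π_L : ∀ v c, π (L v c) = 0
  L_comm : ∀ {b v}, σ v = boolSign k b • v → ∀ w c, L v (L w c) = L (twist σ b w) (L v c)
  L_incl_comm : ∀ {b v}, σ v = boolSign k b • v → ∀ w, L v (incl w) = L (twist σ b w) (incl v)
  wt_incl : ∀ v, wt (incl v) = Polynomial.monomial 1 (ι k (incl v))
  wt_L : ∀ v c n, wt c = Polynomial.monomial n (ι k c) →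
    wt (L v c) = Polynomial.monomial (n + 1) (ι k (L v c))
  generated : ∀ S : Submodule k C, (∀ v, incl v ∈ S) → (∀ v, ∀ c ∈ S, L v c ∈ S) → ∀ c, c ∈ S

namespace InsertionCoalgebra

variable {k : Type u} [Field k] [CharZero k] {M : Type v} [AddCommGroup M] [Module k M]
  {C : Type w} [AddCommGroup C] [Module k C] (X : InsertionCoalgebra k M C)
  {B : Type*} [AddCommGroup B] [Module k B]

/-- The elements of `C` of parity `b` and weight `n` that are obtained by shuffling `n`
homogeneous vectors. -/
inductive IsShuffle : Bool → ℕ → C → Prop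
  | incl {b : Bool} {v : M} (hv : X.σ v = boolSign k b • v) : IsShuffle b 1 (X.incl v)
  | L {b c : Bool} {n : ℕ} {v : M} {x : C} (hv : X.σ v = boolSign k b • v)
      (hx : IsShuffle c n x) : IsShuffle (b ^^ c) (n + 1) (X.L v x)

lemma σ_σ (v : M) : X.σ (X.σ v) = v := LinearMap.congr_fun X.σ_comp_σ v

variable {X} in
lemma IsShuffle.pure {b : Bool} {n : ℕ} {x : C} (h : X.IsShuffle b n x) :
    X.ε x = boolSign k b • x := by
  induction h with
  | incl hv => rw [X.ε_incl, hv, map_smul]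
  | L hv _ ih => rw [X.ε_L, hv, ih, map_smul, map_smul, LinearMap.smul_apply, smul_smul, mul_comm,
      ← boolSign_xor]

variable {X} in
lemma IsShuffle.wt {b : Bool} {n : ℕ} {x : C} (h : X.IsShuffle b n x) :
    X.wt x = Polynomial.monomial n (ι k x) := by
  induction h with
  | incl hv => exact X.wt_incl _
  | L hv _ ih => exact X.wt_L _ _ _ ih

lemma span_isShuffle : Submodule.span k {x | ∃ b n, X.IsShuffle b n x} = ⊤ := by
  refine Submodule.eq_top_iff'.2 fun x => X.generated _ (fun v => ?_) (fun v c hc => ?_) x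
  · rw [← parityProj_add X.σ v, map_sum]
    exact Submodule.sum_mem _ fun b _ =>
      Submodule.subset_span ⟨b, 1, .incl (parityProj_mem X.σ_comp_σ b v)⟩
  · induction hc using Submodule.span_induction with
    | mem c hc =>
      obtain ⟨e, n, hc⟩ := hc
      rw [← parityProj_add X.σ v, map_sum, LinearMap.sum_apply]
      exact Submodule.sum_mem _ fun b _ =>
        Submodule.subset_span ⟨_, _, .L (parityProj_mem X.σ_comp_σ b v) hc⟩
    | zero => rw [map_zero]; exact Submodule.zero_mem _
    | add x y _ _ hx hy => rw [map_add]; exact Submodule.add_mem _ hx hy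
    | smul a x _ hx => rw [map_smul]; exact Submodule.smul_mem _ _ hx

/-- This is the induction principle behind all properties of `C` that are not axioms: counitality of
signs, cocommutativity, naturality and square zero are all checked on vectors and propagated along
`L v`. -/
lemma ext_generated {B : Type*} [AddCommMonoid B] [Module k B] {f g : C →ₗ[k] B}
    (hincl : ∀ b v, X.σ v = boolSign k b • v → f (X.incl v) = g (X.incl v))
    (hL : ∀ b v, X.σ v = boolSign k b • v → ∀ c, f c = g c → f (X.L v c) = g (X.L v c)) :
    f = g := by
  refine LinearMap.ext_on X.span_isShuffle ?_
  rintro x ⟨b, n, hx⟩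
  induction hx with
  | incl hv => exact hincl _ _ hv
  | L hv _ ih => exact hL _ _ hv _ ih

lemma ε_comp_ε : X.ε ∘ₗ X.ε = LinearMap.id :=
  X.ext_generated (fun b v _ => by simp [X.ε_incl, X.σ_σ])
    (fun b v _ c hc => by
      rw [LinearMap.comp_apply, LinearMap.id_apply] at hc ⊢
      rw [X.ε_L, X.ε_L, X.σ_σ, hc])

lemma ε_ε (x : C) : X.ε (X.ε x) = x := LinearMap.congr_fun X.ε_comp_ε x

lemma π_ε (x : C) : X.π (X.ε x) = X.σ (X.π x) := by
  have h := X.ext_generated (f := X.π ∘ₗ X.ε) (g := X.σ ∘ₗ X.π)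
    (fun b v _ => by simp [X.ε_incl, X.π_incl]) (fun b v _ c _ => by simp [X.ε_L, X.π_L])
  exact LinearMap.congr_fun h x

lemma π_d (x : C) : X.π (X.d x) = X.δ (X.π x) := by
  have h := X.ext_generated (f := X.π ∘ₗ X.d) (g := X.δ ∘ₗ X.π)
    (fun b v _ => by simp [X.d_incl, X.π_incl]) (fun b v hv c _ => by simp [X.d_L hv, X.π_L])
  exact LinearMap.congr_fun h x

lemma d_ε (x : C) : X.d (X.ε x) = -X.ε (X.d x) := by
  have hδ : ∀ v, X.δ (X.σ v) = -X.σ (X.δ v) := LinearMap.congr_fun X.δ_comp_σ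
  have h := X.ext_generated (f := X.d ∘ₗ X.ε) (g := -(X.ε ∘ₗ X.d))
    (fun b v _ => by simp [X.ε_incl, X.d_incl, hδ])
    (fun b v hv c hc => by
      simp only [LinearMap.comp_apply, LinearMap.neg_apply] at hc ⊢
      rw [X.d_L hv, map_add, map_smul, X.ε_L, X.ε_L, X.ε_L, hv, map_smul, LinearMap.smul_apply,
        map_smul, X.d_L hv, hc, pure_diff X.δ_comp_σ hv]
      simp only [map_smul, LinearMap.smul_apply, boolSign_not, map_neg]
      module)
  exact LinearMap.congr_fun h x

lemma Δ_ε (x : C) : X.Δ (X.ε x) = TensorProduct.map X.ε X.ε (X.Δ x) := by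
  have h := X.ext_generated (f := X.Δ ∘ₗ X.ε) (g := TensorProduct.map X.ε X.ε ∘ₗ X.Δ)
    (fun b v _ => by simp [X.ε_incl, X.Δ_incl])
    (fun b v hv c hc => by
      simp only [LinearMap.comp_apply] at hc ⊢
      have h1 : X.ε ∘ₗ X.L v = boolSign k b • X.L v ∘ₗ X.ε := LinearMap.ext fun x => by
        simp [X.ε_L, hv]
      have h2 : X.ε ∘ₗ twist X.ε b = twist X.ε b ∘ₗ X.ε := by cases b <;> rfl
      have h3 : ∀ y, TensorProduct.map X.ε X.ε ((X.L v).rTensor C y) =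
          boolSign k b • (X.L v).rTensor C (TensorProduct.map X.ε X.ε y) := fun y => by
        rw [map_rTensor_apply, rTensor_map_apply, h1, TensorProduct.map_smul_left,
          LinearMap.smul_apply]
      have h4 : ∀ y, TensorProduct.map X.ε X.ε (TensorProduct.map (twist X.ε b) (X.L v) y) =
          boolSign k b • TensorProduct.map (twist X.ε b) (X.L v) (TensorProduct.map X.ε X.ε y) :=
        fun y => by
        rw [← LinearMap.comp_apply, ← TensorProduct.map_comp, h1, h2,
          TensorProduct.map_smul_right, TensorProduct.map_comp]
        rfl
      rw [X.Δ_L hv, X.ε_L, hv, map_smul, LinearMap.smul_apply, map_smul, X.Δ_L hv, hc]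
      simp only [map_add, h3, h4, TensorProduct.map_tmul, X.ε_incl, hv, map_smul,
        TensorProduct.tmul_smul, smul_add, ← TensorProduct.smul_tmul']
      rw [← LinearMap.comp_apply X.ε, h2, LinearMap.comp_apply])
  exact LinearMap.congr_fun h x

/-- Cocommutativity. -/
lemma koszulFlip_Δ (x : C) : koszulFlip X.ε (X.Δ x) = X.Δ x := by
  have h := X.ext_generated (f := koszulFlip X.ε ∘ₗ X.Δ) (g := X.Δ)
    (fun b v _ => by simp [X.Δ_incl])
    (fun b v hv c hc => by
      simp only [LinearMap.comp_apply] at hc ⊢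
      have hL : ∀ x, X.ε (X.L v x) = boolSign k b • X.L v (X.ε x) := fun x => by
        rw [X.ε_L, hv, map_smul, LinearMap.smul_apply]
      have hv' : X.ε (X.incl v) = boolSign k b • X.incl v := by rw [X.ε_incl, hv, map_smul]
      -- The flip exchanges the two terms of `Δ_L` in which `v` is shuffled into a factor of `Δ c`,
      -- and likewise the two terms in which `v` is a factor of its own.
      have h1 : koszulFlip X.ε ∘ₗ (X.L v).rTensor C =
          TensorProduct.map (twist X.ε b) (X.L v) ∘ₗ koszulFlip X.ε := by
        refine tensor_square_ext X.ε_comp_ε fun e e' x y hx hy => ?_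
        have hx' : X.ε (X.L v x) = boolSign k (b ^^ e) • X.L v x := by
          rw [hL, hx, map_smul, smul_smul, boolSign_xor]
        rw [LinearMap.comp_apply, LinearMap.comp_apply, LinearMap.rTensor_tmul,
          koszulFlip_pure hx', koszulFlip_pure hx, TensorProduct.map_tmul]
        congr 1
        cases b <;> cases e <;> simp [X.ε_ε]
      have h2 : koszulFlip X.ε ∘ₗ TensorProduct.map (twist X.ε b) (X.L v) =
          (X.L v).rTensor C ∘ₗ koszulFlip X.ε := by
        refine tensor_square_ext X.ε_comp_ε fun e e' x y hx hy => ?_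
        rw [LinearMap.comp_apply, LinearMap.comp_apply, TensorProduct.map_tmul, twist_pure hx,
          ← TensorProduct.smul_tmul', map_smul, koszulFlip_pure hx, koszulFlip_pure hx,
          LinearMap.rTensor_tmul, TensorProduct.smul_tmul']
        congr 1
        cases b <;> cases e <;> simp [hL]
      have h3 : ∀ c, koszulFlip X.ε (twist X.ε b c ⊗ₜ X.incl v) = X.incl v ⊗ₜ c := fun c => by
        have := ext_homogeneous X.ε_comp_ε (f := koszulFlip X.ε ∘ₗ
          (TensorProduct.mk k C C).flip (X.incl v) ∘ₗ twist X.ε b)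
          (g := TensorProduct.mk k C C (X.incl v)) fun e c hc => by
          simp only [LinearMap.comp_apply, LinearMap.flip_apply, TensorProduct.mk_apply]
          rw [twist_pure hc, ← TensorProduct.smul_tmul', map_smul, koszulFlip_pure hc,
            twist_pure hv', ← TensorProduct.smul_tmul', smul_smul, Bool.and_comm,
            boolSign_mul_self, one_smul]
        exact LinearMap.congr_fun this c
      rw [X.Δ_L hv, map_add, map_add, map_add, koszulFlip_pure hv', h3]
      rw [← LinearMap.comp_apply (koszulFlip X.ε), ← LinearMap.comp_apply (koszulFlip X.ε), h1, h2,
        LinearMap.comp_apply, LinearMap.comp_apply, hc]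
      abel)
  exact LinearMap.congr_fun h x

/-- The operator `x ↦ π(x') x'' + π(x)`, which multiplies elements by their weight. -/
def num : C →ₗ[k] C :=
  TensorProduct.lift X.L ∘ₗ X.π.rTensor C ∘ₗ X.Δ + X.incl ∘ₗ X.π

lemma num_incl (v : M) : X.num (X.incl v) = X.incl v := by
  simp [num, X.Δ_incl, X.π_incl]

/-- In `Δ_L` the projection `π` kills every left factor of the form `L v x`. The term `v ⊗ c`
contributes the new copy of `L v c`, the term `c ⊗ v` restores the summand `incl (π c)` of `num c`,
and the last term gives the rest by commutativity of shuffles. -/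
lemma num_L {b : Bool} {v : M} (hv : X.σ v = boolSign k b • v) (c : C) :
    X.num (X.L v c) = X.L v c + X.L v (X.num c) := by
  have h1 : ∀ y, X.π.rTensor C ((X.L v).rTensor C y) = 0 := fun y => by
    rw [← LinearMap.rTensor_comp_apply, show X.π ∘ₗ X.L v = 0 from LinearMap.ext (X.π_L v),
      LinearMap.rTensor_zero, LinearMap.zero_apply]
  have h2 : ∀ y, TensorProduct.lift X.L (X.π.rTensor C (TensorProduct.map (twist X.ε b) (X.L v) y)) =
      X.L v (TensorProduct.lift X.L (X.π.rTensor C y)) := fun y => by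
    induction y using TensorProduct.induction_on with
    | zero => simp
    | add y z hy hz => simp only [map_add, hy, hz]
    | tmul x y =>
      simp only [TensorProduct.map_tmul, LinearMap.rTensor_tmul, TensorProduct.lift.tmul]
      rw [X.L_comm hv, twist_map X.π_ε]
  simp only [num, LinearMap.add_apply, LinearMap.comp_apply, X.Δ_L hv, map_add, h1, h2,
    LinearMap.rTensor_tmul, TensorProduct.lift.tmul, X.π_incl, X.π_L, map_zero]
  rw [X.L_incl_comm hv, twist_map X.π_ε]
  abel

variable {X} in
lemma IsShuffle.num_eq {b : Bool} {n : ℕ} {x : C} (h : X.IsShuffle b n x) :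
    X.num x = (n : k) • x := by
  induction h with
  | incl hv => rw [num_incl, Nat.cast_one, one_smul]
  | L hv _ ih => rw [X.num_L hv, ih, map_smul]; push_cast; module

end InsertionCoalgebra

end SymCobar
end

noncomputable section

namespace SymCobar

open TensorAlgebra (ι)

/-! ### The cobar construction and the derivations extending shuffle products -/

namespace InsertionCoalgebra

variable {k : Type u} [Field k] [CharZero k] {M : Type v} [AddCommGroup M] [Module k M]
  {C : Type w} [AddCommGroup C] [Module k C] (X : InsertionCoalgebra k M C)
  {B : Type*} [AddCommGroup B] [Module k B]

/-- The differential of the cobar construction. -/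
def D : TensorAlgebra k C →ₗ[k] TensorAlgebra k C := cobarD X.ε X.d X.Δ

/-- The `b`-th power of the parity involution of the cobar construction. -/
def par (b : Bool) : TensorAlgebra k C →ₐ[k] TensorAlgebra k C := tensorTwist (-X.ε) b

/-- The parity involution of the desuspension of `M`. -/
def ρ : M →ₗ[k] M := -X.σ

/-- The quadratic part of the cobar differential. -/
def quad : C ⊗[k] C →ₗ[k] TensorAlgebra k C :=
  LinearMap.mul' k (TensorAlgebra k C) ∘ₗ TensorProduct.map (ι k ∘ₗ X.ε) (ι k)

@[simp] lemma quad_tmul (x y : C) : X.quad (x ⊗ₜ y) = ι k (X.ε x) * ι k y := rfl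

lemma cobarGen_eq (x : C) : cobarGen X.ε X.d X.Δ x = -ι k (X.d x) + X.quad (X.Δ x) := rfl

@[simp] lemma D_one : X.D 1 = 0 := cobarD_one _ _ _

@[simp] lemma D_ι (x : C) : X.D (ι k x) = cobarGen X.ε X.d X.Δ x := cobarD_ι _ _ _ x

@[simp] lemma par_ι (b : Bool) (x : C) : X.par b (ι k x) = ι k (twist (-X.ε) b x) := by
  simp [par]

lemma par_false : X.par false = AlgHom.id k _ := by simp [par]

lemma D_mul (a b : TensorAlgebra k C) : X.D (a * b) = X.D a * b + X.par true a * X.D b :=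
  cobarD_mul _ _ _ a b

lemma D_ι_mul (x : C) (a : TensorAlgebra k C) :
    X.D (ι k x * a) = cobarGen X.ε X.d X.Δ x * a - ι k (X.ε x) * X.D a := by
  rw [D_mul, D_ι, par_ι]
  simp [sub_eq_add_neg]

lemma neg_ε_comp : (-X.ε) ∘ₗ (-X.ε) = LinearMap.id := by
  rw [LinearMap.neg_comp, LinearMap.comp_neg, neg_neg, X.ε_comp_ε]

lemma ρ_comp_ρ : X.ρ ∘ₗ X.ρ = LinearMap.id := by
  rw [ρ, LinearMap.neg_comp, LinearMap.comp_neg, neg_neg, X.σ_comp_σ]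

lemma par_par (b c : Bool) (a : TensorAlgebra k C) : X.par b (X.par c a) = X.par (b ^^ c) a :=
  tensorTwist_tensorTwist X.neg_ε_comp b c a

lemma twist_neg_ε (b : Bool) (x : C) : twist (-X.ε) b x = boolSign k b • twist X.ε b x := by
  cases b <;> simp

lemma ρ_pure {v : M} {b : Bool} (hv : X.σ v = boolSign k b • v) :
    X.ρ v = boolSign k (!b) • v := by
  rw [ρ, LinearMap.neg_apply, hv, boolSign_not, neg_smul]

/-- The derivation of the cobar construction, depending linearly on `v`, that extends the shuffle
product with `v`. -/
def Lhat : TensorAlgebra k C →ₗ[k] M →ₗ[k] TensorAlgebra k C :=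
  tensorRec 0
    (LinearMap.mk₂ k (fun x a => LinearMap.mulRight k a ∘ₗ ι k ∘ₗ X.L.flip x)
      (fun x y a => by ext v; simp [add_mul])
      (fun c x a => by ext v; simp)
      (fun x a b => by ext v; simp [mul_add])
      (fun c x a => by ext v; simp))
    (twistedMul (-X.ε) X.σ)

@[simp] lemma Lhat_one : X.Lhat 1 = 0 := by simp [Lhat]

variable {X} in
lemma Lhat_ι_mul {v : M} {b : Bool} (hv : X.σ v = boolSign k b • v) (x : C)
    (a : TensorAlgebra k C) : X.Lhat (ι k x * a) v =
      ι k (X.L v x) * a + ι k (twist (-X.ε) b x) * X.Lhat a v := by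
  rw [Lhat, tensorRec_ι_mul, LinearMap.add_apply, twistedMul_pure _ hv]
  rfl

lemma Lhat_ι (v : M) (x : C) : X.Lhat (ι k x) v = ι k (X.L v x) := by
  have h := ext_homogeneous X.σ_comp_σ (f := X.Lhat (ι k x)) (g := ι k ∘ₗ X.L.flip x)
    fun b v hv => by
      have := Lhat_ι_mul hv x 1
      rw [mul_one, mul_one] at this
      simp [this]
  exact LinearMap.congr_fun h v

variable {X} in
lemma Lhat_mul {v : M} {b : Bool} (hv : X.σ v = boolSign k b • v) (a a' : TensorAlgebra k C) :
    X.Lhat (a * a') v = X.Lhat a v * a' + X.par b a * X.Lhat a' v := by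
  have h := tensor_ext' (f := X.Lhat.flip v ∘ₗ LinearMap.mulRight k a')
    (g := LinearMap.mulRight k a' ∘ₗ X.Lhat.flip v +
      LinearMap.mulRight k (X.Lhat a' v) ∘ₗ (X.par b).toLinearMap) (by simp) (fun x a ha => by
    simp only [LinearMap.comp_apply, LinearMap.flip_apply, LinearMap.mulRight_apply,
      LinearMap.add_apply, AlgHom.toLinearMap_apply] at ha ⊢
    rw [mul_assoc, Lhat_ι_mul hv, ha, Lhat_ι_mul hv, map_mul, par_ι]
    noncomm_ring)
  exact LinearMap.congr_fun h a

variable {X} in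
lemma par_Lhat {v : M} {b : Bool} (hv : X.σ v = boolSign k b • v) (c : Bool)
    (a : TensorAlgebra k C) :
    X.par c (X.Lhat a v) = boolSign k (b && c) • X.Lhat (X.par c a) v := by
  have h := tensor_ext' (f := (X.par c).toLinearMap ∘ₗ X.Lhat.flip v)
    (g := boolSign k (b && c) • X.Lhat.flip v ∘ₗ (X.par c).toLinearMap) (by simp)
    (fun x a ha => by
      simp only [LinearMap.comp_apply, LinearMap.flip_apply,
        LinearMap.smul_apply, AlgHom.toLinearMap_apply] at ha ⊢
      rw [Lhat_ι_mul hv, map_mul, par_ι, Lhat_ι_mul hv, map_add, map_mul, map_mul, ha, par_ι,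
        par_ι]
      cases b <;> cases c <;> simp [X.ε_L, hv])
  exact LinearMap.congr_fun h a

lemma par_cobarGen (x : C) :
    X.par true (cobarGen X.ε X.d X.Δ x) = cobarGen X.ε X.d X.Δ (X.ε x) := by
  have h : ∀ y, X.par true (X.quad y) = X.quad (TensorProduct.map X.ε X.ε y) := fun y => by
    induction y using TensorProduct.induction_on with
    | zero => simp
    | add y z hy hz => simp only [map_add, hy, hz]
    | tmul x y => simp
  rw [cobarGen_eq, cobarGen_eq, map_add, h, X.Δ_ε, X.d_ε]
  simp

lemma par_D (b : Bool) (a : TensorAlgebra k C) :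
    X.par b (X.D a) = boolSign k b • X.D (X.par b a) := by
  cases b
  · simp [par_false]
  have h := tensor_ext' (f := (X.par true).toLinearMap ∘ₗ X.D)
    (g := -(X.D ∘ₗ (X.par true).toLinearMap)) (by simp)
    (fun x a ha => by
      simp only [LinearMap.comp_apply, LinearMap.neg_apply, AlgHom.toLinearMap_apply] at ha ⊢
      rw [D_ι_mul, map_sub, map_mul, map_mul, map_mul, ha, par_cobarGen, par_ι, par_ι, D_ι_mul]
      simp [X.ε_ε, cobarGen_eq, X.d_ε, X.Δ_ε]
      noncomm_ring)
  simpa using LinearMap.congr_fun h a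

lemma D_ι_incl (v : M) : X.D (ι k (X.incl v)) = -ι k (X.incl (X.δ v)) := by
  rw [D_ι, cobarGen_eq, X.Δ_incl, map_zero, add_zero, X.d_incl]

variable {X} in
-- This is `Δ_L` and `d_L` read in the cobar construction: the terms where `v` is shuffled into a
-- factor form the derivation `Lhat`, while `v ⊗ c` and `c ⊗ v` become a graded commutator with the
-- letter `v`.
lemma cobarGen_L {v : M} {b : Bool} (hv : X.σ v = boolSign k b • v) (x : C) :
    cobarGen X.ε X.d X.Δ (X.L v x) =
      boolSign k b • X.Lhat (cobarGen X.ε X.d X.Δ x) v - ι k (X.L (X.δ v) x) +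
        boolSign k b • (ι k (X.incl v) * ι k x - X.par (!b) (ι k x) * ι k (X.incl v)) := by
  have hL : ∀ x, X.ε (X.L v x) = boolSign k b • X.L v (X.ε x) := fun x => by
    rw [X.ε_L, hv, map_smul, LinearMap.smul_apply]
  have h : ∀ y, X.quad ((X.L v).rTensor C y + TensorProduct.map (twist X.ε b) (X.L v) y) =
      boolSign k b • X.Lhat (X.quad y) v := fun y => by
    induction y using TensorProduct.induction_on with
    | zero => simp
    | add y z hy hz =>
      simp only [map_add, smul_add, LinearMap.add_apply] at hy hz ⊢
      rw [add_add_add_comm, hy, hz]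
    | tmul x y =>
      rw [LinearMap.rTensor_tmul, TensorProduct.map_tmul, map_add, quad_tmul, quad_tmul, quad_tmul,
        Lhat_ι_mul hv, hL, Lhat_ι, twist_neg_ε]
      cases b <;> simp
  rw [cobarGen_eq, X.Δ_L hv, map_add, h, X.d_L hv, cobarGen_eq, map_add, map_add, map_add, map_neg,
    LinearMap.add_apply, LinearMap.neg_apply, Lhat_ι, quad_tmul, quad_tmul, X.ε_incl, hv, map_smul,
    map_smul, par_ι]
  cases b <;> simp [X.ε_ε] <;> abel

variable {X} in
/-- The operators `Lhat v` are homotopies for the graded commutators with `v`. -/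
lemma D_Lhat {v : M} {b : Bool} (hv : X.σ v = boolSign k b • v) (a : TensorAlgebra k C) :
    X.D (X.Lhat a v) = boolSign k b • X.Lhat (X.D a) v - X.Lhat a (X.δ v) +
      boolSign k b • (ι k (X.incl v) * a - X.par (!b) a * ι k (X.incl v)) := by
  have hδ := pure_diff X.δ_comp_σ hv
  have h := tensor_ext' (f := X.D ∘ₗ X.Lhat.flip v)
    (g := boolSign k b • X.Lhat.flip v ∘ₗ X.D - X.Lhat.flip (X.δ v) +
      boolSign k b • (LinearMap.mulLeft k (ι k (X.incl v)) -
        LinearMap.mulRight k (ι k (X.incl v)) ∘ₗ (X.par (!b)).toLinearMap)) (by simp)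
    (fun x a ha => by
      simp only [LinearMap.comp_apply, LinearMap.flip_apply, LinearMap.mulRight_apply,
        LinearMap.add_apply, AlgHom.toLinearMap_apply, LinearMap.sub_apply, LinearMap.smul_apply,
        LinearMap.mulLeft_apply] at ha ⊢
      rw [Lhat_ι_mul hv, Lhat_ι_mul hδ, map_add, D_ι_mul, D_ι_mul, ha, D_ι_mul, map_sub,
        LinearMap.sub_apply, Lhat_mul hv, Lhat_ι_mul hv, cobarGen_L hv, map_mul, par_ι,
        X.ε_L, hv]
      cases b
      · simp [par_false]
        noncomm_ring
      · simp [par_cobarGen, par_false, X.ε_ε]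
        noncomm_ring)
  exact LinearMap.congr_fun h a

end InsertionCoalgebra

end SymCobar
end

noncomputable section

namespace SymCobar

open TensorAlgebra (ι)

/-! ### The first homotopy: multiplication by the weight against moving a vector to the end -/

namespace InsertionCoalgebra

variable {k : Type u} [Field k] [CharZero k] {M : Type v} [AddCommGroup M] [Module k M]
  {C : Type w} [AddCommGroup C] [Module k C] (X : InsertionCoalgebra k M C)

/-- Instead of coassociativity, generation by shuffles is used: on `L v c` the formula `cobarGen_L`
is differentiated with `D_Lhat`, once for `v` and once for `δ v`, and all commutator terms cancel. A
derivation whose square vanishes on generators has square zero. -/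
lemma D_D (a : TensorAlgebra k C) : X.D (X.D a) = 0 := by
  have hgen : ∀ x, X.D (cobarGen X.ε X.d X.Δ x) = 0 := by
    have h := X.ext_generated (f := X.D ∘ₗ cobarGen X.ε X.d X.Δ) (g := 0)
      (fun b v _ => by
        simp [cobarGen_eq, X.Δ_incl, X.d_incl, X.δ_δ])
      (fun b v hv c hc => by
        simp only [LinearMap.comp_apply, LinearMap.zero_apply] at hc ⊢
        have hδ := pure_diff X.δ_comp_σ hv
        have h1 := D_Lhat hδ (ι k c)
        simp only [Lhat_ι] at h1
        rw [cobarGen_L hv, map_add, map_sub, map_smul, map_smul, map_sub, D_mul, D_mul, D_Lhat hv,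
          hc, h1, D_ι_incl, X.δ_δ, par_par]
        have h2 := X.par_D (!b) (ι k c)
        rw [D_ι] at h2
        cases b
        · simp [par_false] at h2 ⊢
          rw [h2, X.ε_incl, hv]
          simp
          noncomm_ring
        · simp [par_false] at h2 ⊢
          rw [X.ε_incl, hv]
          simp
          noncomm_ring)
    exact LinearMap.congr_fun h
  have h := tensor_ext' (f := X.D ∘ₗ X.D) (g := 0) (by simp)
    (fun x a ha => by
      simp only [LinearMap.comp_apply, LinearMap.zero_apply] at ha ⊢
      rw [D_ι_mul, map_sub, D_mul, D_ι_mul, hgen, ha, par_cobarGen]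
      simp)
  exact LinearMap.congr_fun h a

/-- The first approximation to the contracting homotopy: it removes a letter that is a vector `v`
and takes the shuffle product of `v` with one of the following letters. -/
def preHomotopy : TensorAlgebra k C →ₗ[k] TensorAlgebra k C :=
  tensorRec 0 (X.Lhat.flip ∘ₗ X.σ ∘ₗ X.π) (-(LinearMap.mul k (TensorAlgebra k C) ∘ₗ ι k ∘ₗ X.ε))

@[simp] lemma preHomotopy_one : X.preHomotopy 1 = 0 := by simp [preHomotopy]

lemma preHomotopy_ι_mul (x : C) (a : TensorAlgebra k C) : X.preHomotopy (ι k x * a) =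
    X.Lhat a (X.σ (X.π x)) - ι k (X.ε x) * X.preHomotopy a := by
  simp [preHomotopy, sub_eq_add_neg]

/-- The derivation that multiplies elements by their weight. -/
def weight : TensorAlgebra k C →ₗ[k] TensorAlgebra k C :=
  tensorRec 0 (LinearMap.mul k (TensorAlgebra k C) ∘ₗ ι k ∘ₗ X.num)
    (LinearMap.mul k (TensorAlgebra k C) ∘ₗ ι k)

@[simp] lemma weight_one : X.weight 1 = 0 := by simp [weight]

lemma weight_ι_mul (x : C) (a : TensorAlgebra k C) : X.weight (ι k x * a) =
    ι k (X.num x) * a + ι k x * X.weight a := by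
  simp [weight]

/-- The signed sum of the results of removing from a word a letter `v` that is a vector. -/
def extract : TensorAlgebra k C →ₗ[k] TensorAlgebra k C ⊗[k] M := extraction (-X.ε) X.ρ X.π

@[simp] lemma extract_one : X.extract 1 = 0 := extraction_one _ _ _

lemma extract_ι_mul (x : C) (a : TensorAlgebra k C) : X.extract (ι k x * a) =
    koszulSwap (-X.ε) X.ρ (X.π x) a +
      (LinearMap.mul k (TensorAlgebra k C) (ι k x)).rTensor M (X.extract a) :=
  extraction_ι_mul _ _ _ _ _

variable {X} in
lemma swap_pure {v : M} {b : Bool} (hv : X.σ v = boolSign k b • v) (a : TensorAlgebra k C) :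
    koszulSwap (-X.ε) X.ρ v a = X.par (!b) a ⊗ₜ v :=
  koszulSwap_pure _ (X.ρ_pure hv) a

/-- Absorbing the signs of `D_Lhat` into `σ` makes the identity linear in `v`, so it applies to the
vector `π x` without splitting by parity. The right side compares `v` to the left of the word with
`v` to its right. -/
lemma D_Lhat_σ (v : M) (a : TensorAlgebra k C) :
    X.D (X.Lhat a (X.σ v)) - X.Lhat a (X.σ (X.δ v)) - X.Lhat (X.D a) v =
      ι k (X.incl v) * a - mulVec X.incl (koszulSwap (-X.ε) X.ρ v a) := by
  have h := ext_homogeneous X.σ_comp_σ (f := X.D ∘ₗ X.Lhat a ∘ₗ X.σ - X.Lhat a ∘ₗ X.σ ∘ₗ X.δ -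
      X.Lhat (X.D a)) (g := LinearMap.mulRight k a ∘ₗ ι k ∘ₗ X.incl -
        mulVec X.incl ∘ₗ (koszulSwap (-X.ε) X.ρ).flip a) fun b v hv => by
    simp only [LinearMap.sub_apply, LinearMap.comp_apply, LinearMap.flip_apply,
      LinearMap.mulRight_apply]
    rw [hv, pure_diff X.δ_comp_σ hv, map_smul, map_smul, D_Lhat hv, swap_pure hv, mulVec_tmul,
      map_smul]
    cases b <;> simp <;> abel
  exact LinearMap.congr_fun h v

/-- In a quadratic term `x' x''` the vector `π x'` can be shuffled into `x''`, which produces the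
weight up to the vector part of `x`; or one of `π x'`, `π x''` is shuffled into `a` while the other
letter stays. The latter two contributions cancel by cocommutativity. -/
lemma preHomotopy_cobarGen_mul (x : C) (a : TensorAlgebra k C) :
    X.preHomotopy (cobarGen X.ε X.d X.Δ x * a) =
      cobarGen X.ε X.d X.Δ (X.ε x) * X.preHomotopy a +
        (ι k (X.num x) - ι k (X.incl (X.π x))) * a - X.Lhat a (X.σ (X.δ (X.π x))) := by
  -- In `U (x ⊗ y)` the letter `x` stays and the vector part of `y` is shuffled into `a`; the flip
  -- exchanges these roles.
  let U : C ⊗[k] C →ₗ[k] TensorAlgebra k C := LinearMap.mul' k _ ∘ₗ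
    TensorProduct.map (ι k) (X.Lhat a ∘ₗ X.σ ∘ₗ X.π)
  have h : X.preHomotopy ∘ₗ LinearMap.mulRight k a ∘ₗ X.quad =
      LinearMap.mulRight k a ∘ₗ ι k ∘ₗ TensorProduct.lift X.L ∘ₗ X.π.rTensor C +
      U ∘ₗ koszulFlip X.ε - U +
      LinearMap.mulRight k (X.preHomotopy a) ∘ₗ X.quad ∘ₗ TensorProduct.map X.ε X.ε := by
    refine tensor_square_ext X.ε_comp_ε fun b c x y hx hy => ?_
    have hπ : X.σ (X.π x) = boolSign k b • X.π x := by rw [← X.π_ε, hx, map_smul]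
    simp only [U, LinearMap.comp_apply, LinearMap.add_apply, LinearMap.sub_apply,
      koszulFlip_pure hx, LinearMap.rTensor_tmul, TensorProduct.lift.tmul, TensorProduct.map_tmul,
      quad_tmul, LinearMap.mulRight_apply, LinearMap.mul'_apply, mul_assoc, preHomotopy_ι_mul,
      X.π_ε, X.ε_ε, hπ, Lhat_ι_mul hπ, map_smul, mul_sub, mul_smul_comm, twist_neg_ε,
      smul_mul_assoc]
    cases b <;> simp <;> abel
  have h' := LinearMap.congr_fun h (X.Δ x)
  simp only [LinearMap.comp_apply, LinearMap.add_apply, LinearMap.sub_apply, koszulFlip_Δ,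
    LinearMap.mulRight_apply] at h'
  rw [cobarGen_eq, add_mul, map_add, h', neg_mul, map_neg, preHomotopy_ι_mul, X.π_d, cobarGen_eq,
    X.Δ_ε, X.d_ε, num]
  simp
  noncomm_ring

/-- For each vector letter `v`, the commutator in `D_Lhat_σ` is the difference between `v` in its
place and `v` at the right end. The terms in place supply the part `incl (π x)` of the weight that
`preHomotopy_cobarGen_mul` leaves out. -/
lemma D_preHomotopy (a : TensorAlgebra k C) :
    X.D (X.preHomotopy a) + X.preHomotopy (X.D a) =
      X.weight a - mulVec X.incl (X.extract a) := by
  have h := tensor_ext' (f := X.D ∘ₗ X.preHomotopy + X.preHomotopy ∘ₗ X.D)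
    (g := X.weight - mulVec X.incl ∘ₗ X.extract) (by simp)
    (fun x a ha => by
      simp only [LinearMap.comp_apply, LinearMap.add_apply, LinearMap.sub_apply] at ha ⊢
      have h1 := X.D_Lhat_σ (X.π x) a
      have h2 : ι k x * X.D (X.preHomotopy a) = ι k x * X.weight a -
          ι k x * mulVec X.incl (X.extract a) - ι k x * X.preHomotopy (X.D a) := by
        rw [← mul_sub, ← ha]; noncomm_ring
      rw [preHomotopy_ι_mul, map_sub, D_ι_mul, D_ι_mul, map_sub, preHomotopy_ι_mul,
        preHomotopy_cobarGen_mul, weight_ι_mul, extract_ι_mul, map_add, mulVec_rTensor_mul,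
        X.ε_ε, X.π_ε, X.σ_σ, h2]
      rw [sub_eq_iff_eq_add, sub_eq_iff_eq_add] at h1
      rw [h1]
      noncomm_ring)
  exact LinearMap.congr_fun h a

/-- The differential of `A ⊗ M`, where `M` is desuspended. -/
def DM : TensorAlgebra k C ⊗[k] M →ₗ[k] TensorAlgebra k C ⊗[k] M :=
  X.D.rTensor M - TensorProduct.map (X.par true).toLinearMap X.δ

@[simp] lemma DM_tmul (a : TensorAlgebra k C) (v : M) :
    X.DM (a ⊗ₜ v) = X.D a ⊗ₜ v - X.par true a ⊗ₜ X.δ v := rfl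

lemma D_mulVec (y : TensorAlgebra k C ⊗[k] M) :
    X.D (mulVec X.incl y) = mulVec X.incl (X.DM y) := by
  induction y using TensorProduct.induction_on with
  | zero => simp
  | add y z hy hz => simp only [map_add, hy, hz]
  | tmul a v => simp only [mulVec_tmul, DM_tmul, map_sub, D_mul, D_ι_incl]; noncomm_ring

/-- A vector can be extracted from `x'` or from `x''` of a quadratic term; by cocommutativity the
two results cancel, so that only extraction from `a` and from the linear part of the differential
remain. -/
lemma extract_cobarGen_mul (x : C) (a : TensorAlgebra k C) :
    X.extract (cobarGen X.ε X.d X.Δ x * a) =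
      (LinearMap.mul k (TensorAlgebra k C) (cobarGen X.ε X.d X.Δ x)).rTensor M (X.extract a) -
        koszulSwap (-X.ε) X.ρ (X.δ (X.π x)) a := by
  let act : TensorAlgebra k C →ₗ[k] TensorAlgebra k C ⊗[k] M →ₗ[k] TensorAlgebra k C ⊗[k] M :=
    LinearMap.rTensorHom M ∘ₗ LinearMap.mul k (TensorAlgebra k C)
  -- `U (x ⊗ y)` keeps the letter `x` and carries the vector part of `y` past `a`.
  let U : C ⊗[k] C →ₗ[k] TensorAlgebra k C ⊗[k] M := TensorProduct.lift
    (act.compl₁₂ (ι k ∘ₗ X.ε) ((koszulSwap (-X.ε) X.ρ).flip a ∘ₗ X.π))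
  have h : X.extract ∘ₗ LinearMap.mulRight k a ∘ₗ X.quad =
      U - U ∘ₗ koszulFlip X.ε + act.flip (X.extract a) ∘ₗ X.quad := by
    refine tensor_square_ext X.ε_comp_ε fun b c x y hx hy => ?_
    have hπ : X.σ (X.π x) = boolSign k b • X.π x := by rw [← X.π_ε, hx, map_smul]
    simp only [U, act, LinearMap.comp_apply, LinearMap.add_apply, LinearMap.sub_apply,
      koszulFlip_pure hx, TensorProduct.lift.tmul, LinearMap.compl₁₂_apply, LinearMap.flip_apply,
      quad_tmul, LinearMap.mulRight_apply, mul_assoc, extract_ι_mul, swap_pure hπ,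
      X.π_ε, hπ, map_smul, LinearMap.smul_apply, map_mul, par_ι, map_add, LinearMap.mul_apply',
      LinearMap.coe_rTensorHom, LinearMap.rTensor_tmul, twist_neg_ε]
    rw [← LinearMap.rTensor_comp_apply, show LinearMap.mul k (TensorAlgebra k C) (ι k (X.ε x)) ∘ₗ
      LinearMap.mul k (TensorAlgebra k C) (ι k y) = LinearMap.mul k (TensorAlgebra k C)
        (ι k (X.ε x) * ι k y) from LinearMap.ext fun t => by simp [mul_assoc]]
    cases b <;> simp [TensorProduct.neg_tmul, X.ε_ε] <;> abel
  have h' := LinearMap.congr_fun h (X.Δ x)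
  simp only [LinearMap.comp_apply, LinearMap.add_apply, LinearMap.sub_apply, koszulFlip_Δ,
    LinearMap.mulRight_apply, sub_self, zero_add, act, LinearMap.flip_apply,
    LinearMap.coe_rTensorHom] at h'
  rw [cobarGen_eq, add_mul, map_add, h', neg_mul, map_neg, extract_ι_mul, X.π_d, map_add, map_neg,
    LinearMap.rTensor_add, LinearMap.rTensor_neg]
  simp
  abel

lemma DM_rTensor_mul (x : C) (y : TensorAlgebra k C ⊗[k] M) :
    X.DM ((LinearMap.mul k (TensorAlgebra k C) (ι k x)).rTensor M y) =
      (LinearMap.mul k (TensorAlgebra k C) (cobarGen X.ε X.d X.Δ x)).rTensor M y -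
        (LinearMap.mul k (TensorAlgebra k C) (ι k (X.ε x))).rTensor M (X.DM y) := by
  induction y using TensorProduct.induction_on with
  | zero => simp
  | add y z hy hz => simp only [map_add, hy, hz]; abel
  | tmul a v =>
    simp [D_ι_mul, TensorProduct.sub_tmul, TensorProduct.neg_tmul]
    abel

lemma DM_swap (v : M) (a : TensorAlgebra k C) :
    X.DM (koszulSwap (-X.ε) X.ρ v a) =
      -koszulSwap (-X.ε) X.ρ (X.δ v) a - koszulSwap (-X.ε) X.ρ (X.σ v) (X.D a) := by
  have h := ext_homogeneous X.σ_comp_σ (f := X.DM ∘ₗ (koszulSwap (-X.ε) X.ρ).flip a)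
    (g := -(koszulSwap (-X.ε) X.ρ).flip a ∘ₗ X.δ -
      (koszulSwap (-X.ε) X.ρ).flip (X.D a) ∘ₗ X.σ) fun b v hv => by
    simp only [LinearMap.sub_apply, LinearMap.comp_apply, LinearMap.flip_apply,
      LinearMap.neg_apply]
    rw [hv, map_smul, LinearMap.smul_apply, swap_pure hv, swap_pure hv,
      swap_pure (pure_diff X.δ_comp_σ hv), DM_tmul, X.par_D, par_par]
    cases b <;> simp [TensorProduct.neg_tmul] <;> abel
  exact LinearMap.congr_fun h v

/-- Extraction is a chain map; hence a homotopy on the remaining word can be transported to the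
whole word, which is what makes the recursion for `stage` work. -/
lemma extract_D (a : TensorAlgebra k C) : X.extract (X.D a) = X.DM (X.extract a) := by
  have h := tensor_ext' (f := X.extract ∘ₗ X.D) (g := X.DM ∘ₗ X.extract) (by simp)
    (fun x a ha => by
      simp only [LinearMap.comp_apply] at ha ⊢
      rw [D_ι_mul, map_sub, extract_ι_mul, extract_cobarGen_mul, extract_ι_mul, map_add,
        DM_rTensor_mul, DM_swap, ha, X.π_ε]
      abel)
  exact LinearMap.congr_fun h a

lemma par_preHomotopy (a : TensorAlgebra k C) :
    X.par true (X.preHomotopy a) = -X.preHomotopy (X.par true a) := by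
  have h2 : ∀ a v, X.par true (X.Lhat a (X.σ v)) = X.Lhat (X.par true a) v := fun a v => by
    have h := ext_homogeneous X.σ_comp_σ (f := (X.par true).toLinearMap ∘ₗ X.Lhat a ∘ₗ X.σ)
      (g := X.Lhat (X.par true a)) fun b v hv => by
      simp only [LinearMap.comp_apply, AlgHom.toLinearMap_apply]
      rw [hv, map_smul, map_smul, par_Lhat hv, smul_smul, Bool.and_true, boolSign_mul_self,
        one_smul]
    exact LinearMap.congr_fun h v
  have h := tensor_ext' (f := (X.par true).toLinearMap ∘ₗ X.preHomotopy)
    (g := -(X.preHomotopy ∘ₗ (X.par true).toLinearMap)) (by simp)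
    (fun x a ha => by
      simp only [LinearMap.comp_apply, LinearMap.neg_apply, AlgHom.toLinearMap_apply] at ha ⊢
      rw [preHomotopy_ι_mul, map_sub, map_mul, map_mul, ha, h2, par_ι, par_ι, preHomotopy_ι_mul]
      simp [X.π_ε, X.σ_σ, X.ε_ε]
      abel)
  exact LinearMap.congr_fun h a

lemma extract_par (a : TensorAlgebra k C) :
    X.extract (X.par true a) =
      TensorProduct.map (X.par true).toLinearMap X.ρ (X.extract a) := by
  refine (extraction_map (ψ := -X.ε) (φ := X.ρ) X.ρ_comp_ρ (fun _ => rfl) (fun _ => rfl)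
    (fun x => ?_) a).symm
  simp [ρ, X.π_ε]

lemma par_mulVec (y : TensorAlgebra k C ⊗[k] M) : X.par true (mulVec X.incl y) =
    mulVec X.incl (TensorProduct.map (X.par true).toLinearMap X.ρ y) := by
  induction y using TensorProduct.induction_on with
  | zero => simp
  | add y z hy hz => simp only [map_add, hy, hz]
  | tmul a v => simp [X.ε_incl, ρ]

end InsertionCoalgebra

end SymCobar
end

noncomputable section

namespace SymCobar

open TensorAlgebra (ι)

lemma map_neg_left {R A B D E : Type*} [CommRing R] [AddCommGroup A] [AddCommGroup B]
    [AddCommGroup D] [AddCommGroup E] [Module R A] [Module R B] [Module R D] [Module R E]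
    (f : A →ₗ[R] B) (g : D →ₗ[R] E) : TensorProduct.map (-f) g = -TensorProduct.map f g :=
  TensorProduct.ext' fun x y => by simp [TensorProduct.neg_tmul]

lemma eq_zero_of_eq_neg (k : Type*) {A : Type*} [Field k] [CharZero k] [AddCommGroup A]
    [Module k A] {a : A} (h : a = -a) : a = 0 := by
  have h2 : (2 : k) • a = 0 := by rw [two_smul, ← eq_neg_iff_add_eq_zero]; exact h
  exact (smul_eq_zero.1 h2).resolve_left two_ne_zero

/-! ### Weights, and the iterated homotopy -/

namespace InsertionCoalgebra

variable {k : Type u} [Field k] [CharZero k] {M : Type v} [AddCommGroup M] [Module k M]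
  {C : Type w} [AddCommGroup C] [Module k C] (X : InsertionCoalgebra k M C)
  {B : Type*} [AddCommGroup B] [Module k B]

/-- The polynomial whose coefficients are the components of an element of the various weights. -/
def weightPoly : TensorAlgebra k C →ₐ[k] Polynomial (TensorAlgebra k C) :=
  TensorAlgebra.lift k X.wt

/-- The elements of weight `n`. -/
def weightSpace (n : ℕ) : Submodule k (TensorAlgebra k C) :=
  LinearMap.eqLocus X.weightPoly.toLinearMap ((Polynomial.monomial n).restrictScalars k)

lemma mem_weightSpace {n : ℕ} {a : TensorAlgebra k C} :
    a ∈ X.weightSpace n ↔ X.weightPoly a = Polynomial.monomial n a := Iff.rfl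

lemma one_mem_weightSpace : 1 ∈ X.weightSpace 0 := by
  rw [mem_weightSpace, map_one]; rfl

variable {X} in
lemma mul_mem_weightSpace {m n : ℕ} {a b : TensorAlgebra k C} (ha : a ∈ X.weightSpace m)
    (hb : b ∈ X.weightSpace n) : a * b ∈ X.weightSpace (m + n) := by
  rw [mem_weightSpace] at *
  rw [map_mul, ha, hb, Polynomial.monomial_mul_monomial]

lemma ι_mem_weightSpace {n : ℕ} {x : C} (hx : X.wt x = Polynomial.monomial n (ι k x)) :
    ι k x ∈ X.weightSpace n := by
  rw [mem_weightSpace, weightPoly, TensorAlgebra.lift_ι_apply, hx]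

variable {X} in
lemma IsShuffle.ι_mem {b : Bool} {n : ℕ} {x : C} (h : X.IsShuffle b n x) :
    ι k x ∈ X.weightSpace n := X.ι_mem_weightSpace h.wt

variable {X} in
lemma IsShuffle.pos {b : Bool} {n : ℕ} {x : C} (h : X.IsShuffle b n x) : 0 < n := by
  cases h <;> omega

variable {X} in
lemma weight_induction (S : ℕ → Submodule k (TensorAlgebra k C)) (h1 : 1 ∈ S 0)
    (hmul : ∀ {b m n x a}, X.IsShuffle b m x → a ∈ S n → ι k x * a ∈ S (m + n)) {n : ℕ}
    {a : TensorAlgebra k C} (ha : a ∈ X.weightSpace n) : a ∈ S n := by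
  -- To argue by induction on arbitrary words, the claim is strengthened: for every element, the
  -- component of each weight `n` lies in `S n`.
  have key := tensor_mem X.span_isShuffle (⨅ n, (S n).comap
    ((Polynomial.lcoeff (TensorAlgebra k C) n).restrictScalars k ∘ₗ X.weightPoly.toLinearMap))
    (by
      refine (Submodule.mem_iInf _).2 fun n => ?_
      rcases Nat.eq_zero_or_pos n with rfl | hn
      · simpa using h1
      · simp [Polynomial.coeff_one, hn.ne'])
    (fun x ⟨b, m, hx⟩ a ha => by
      rw [Submodule.mem_iInf] at ha
      refine (Submodule.mem_iInf _).2 fun n => ?_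
      have h := X.mem_weightSpace.1 hx.ι_mem
      simp only [Submodule.mem_comap, LinearMap.comp_apply, AlgHom.toLinearMap_apply,
        LinearMap.coe_restrictScalars, Polynomial.lcoeff_apply, map_mul, h] at ha ⊢
      rcases le_or_gt m n with hmn | hmn
      · obtain ⟨l, rfl⟩ := Nat.exists_eq_add_of_le' hmn
        rw [Polynomial.coeff_monomial_mul, add_comm]
        exact hmul hx (ha l)
      -- A word beginning with a letter of weight `m` has no component of weight below `m`.
      · rw [← Polynomial.C_mul_X_pow_eq_monomial, mul_assoc, Polynomial.coeff_C_mul,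
          Polynomial.coeff_X_pow_mul', if_neg (not_le.2 hmn), mul_zero]
        exact Submodule.zero_mem _) a
  have := (Submodule.mem_iInf _).1 key n
  rw [X.mem_weightSpace] at ha
  simpa [ha] using this

lemma iSup_weightSpace : ⨆ n, X.weightSpace n = ⊤ := by
  refine Submodule.eq_top_iff'.2 fun a => tensor_mem X.span_isShuffle _
    (Submodule.mem_iSup_of_mem 0 X.one_mem_weightSpace) (fun x ⟨b, m, hx⟩ a ha => ?_) a
  induction ha using Submodule.iSup_induction' with
  | mem n a ha => exact Submodule.mem_iSup_of_mem _ (mul_mem_weightSpace hx.ι_mem ha)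
  | zero => rw [mul_zero]; exact Submodule.zero_mem _
  | add a b _ _ ha hb => rw [mul_add]; exact Submodule.add_mem _ ha hb

lemma ext_weight {f g : TensorAlgebra k C →ₗ[k] B}
    (h : ∀ n, ∀ a ∈ X.weightSpace n, f a = g a) : f = g := by
  refine LinearMap.ext fun a => ?_
  have : (⊤ : Submodule k (TensorAlgebra k C)) ≤ LinearMap.eqLocus f g := by
    rw [← X.iSup_weightSpace]
    exact iSup_le h
  exact this Submodule.mem_top

/-- The linear map that is given by `f n` in weight `n`. -/
def byWeight (f : ℕ → TensorAlgebra k C →ₗ[k] B) : TensorAlgebra k C →ₗ[k] B :=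
  Polynomial.lsum f ∘ₗ X.weightPoly.toLinearMap

variable {X} in
lemma byWeight_apply (f : ℕ → TensorAlgebra k C →ₗ[k] B) {n : ℕ} {a : TensorAlgebra k C}
    (ha : a ∈ X.weightSpace n) : X.byWeight f a = f n a := by
  rw [mem_weightSpace] at ha
  rw [byWeight, LinearMap.comp_apply, AlgHom.toLinearMap_apply, ha]
  exact Polynomial.sum_monomial_index _ (fun n (x : TensorAlgebra k C) => f n x)
    (map_zero (f n))

variable {X} in
lemma par_mem_weightSpace (b : Bool) {n : ℕ} {a : TensorAlgebra k C} (ha : a ∈ X.weightSpace n) :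
    X.par b a ∈ X.weightSpace n := by
  refine weight_induction (fun n => (X.weightSpace n).comap (X.par b).toLinearMap)
    (by simpa using X.one_mem_weightSpace) (fun {c m n x a} hx ha => ?_) ha
  rw [Submodule.mem_comap, AlgHom.toLinearMap_apply] at ha ⊢
  rw [map_mul, par_ι]
  refine mul_mem_weightSpace ?_ ha
  have := hx.pure
  rw [twist_neg_ε, twist_pure this, map_smul, map_smul]
  exact Submodule.smul_mem _ _ (Submodule.smul_mem _ _ hx.ι_mem)

variable {X} in
lemma Lhat_mem_weightSpace {b : Bool} {v : M} (hv : X.σ v = boolSign k b • v) {n : ℕ}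
    {a : TensorAlgebra k C} (ha : a ∈ X.weightSpace n) : X.Lhat a v ∈ X.weightSpace (n + 1) := by
  -- The weight of the word itself is carried along in the induction, since the term in which `v`
  -- enters the first letter still contains the rest `a`.
  refine (weight_induction (fun n => X.weightSpace n ⊓
    (X.weightSpace (n + 1)).comap (X.Lhat.flip v)) ⟨X.one_mem_weightSpace, by simp⟩
    (fun {c m n x a} hx ha => ⟨mul_mem_weightSpace hx.ι_mem ha.1, ?_⟩) ha).2
  have h2 : X.Lhat a v ∈ X.weightSpace (n + 1) := ha.2
  rw [SetLike.mem_coe, Submodule.mem_comap, LinearMap.flip_apply, Lhat_ι_mul hv]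
  refine Submodule.add_mem _ ?_ ?_
  · rw [show m + n + 1 = m + 1 + n by omega]
    exact mul_mem_weightSpace (IsShuffle.L hv hx).ι_mem ha.1
  · rw [add_assoc]
    refine mul_mem_weightSpace ?_ h2
    rw [← par_ι]
    exact par_mem_weightSpace _ hx.ι_mem

variable {X} in
-- The differential preserves the weight by induction on the number of shuffled vectors: in
-- `cobarGen_L`, `Lhat` raises the weight by one, `δ v` has the weight of `v`, and the commutator
-- terms multiply by a letter of weight one.
lemma IsShuffle.cobarGen_mem {b : Bool} {n : ℕ} {x : C} (h : X.IsShuffle b n x) :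
    cobarGen X.ε X.d X.Δ x ∈ X.weightSpace n := by
  induction h with
  | @incl b v hv =>
    rw [cobarGen_eq, X.Δ_incl, map_zero, add_zero, X.d_incl]
    exact Submodule.neg_mem _ (X.ι_mem_weightSpace (X.wt_incl _))
  | @L b c n v x hv hx ih =>
    have h1 := (IsShuffle.incl hv).ι_mem
    rw [cobarGen_L hv]
    refine Submodule.add_mem _ (Submodule.sub_mem _ (Submodule.smul_mem _ _
      (Lhat_mem_weightSpace hv ih)) (X.ι_mem_weightSpace (X.wt_L _ _ _ hx.wt)))
      (Submodule.smul_mem _ _ (Submodule.sub_mem _ ?_ ?_))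
    · rw [add_comm n]
      exact mul_mem_weightSpace h1 hx.ι_mem
    · exact mul_mem_weightSpace (par_mem_weightSpace _ hx.ι_mem) h1

variable {X} in
lemma D_mem_weightSpace {n : ℕ} {a : TensorAlgebra k C} (ha : a ∈ X.weightSpace n) :
    X.D a ∈ X.weightSpace n := by
  refine (weight_induction (fun n => X.weightSpace n ⊓ (X.weightSpace n).comap X.D)
    ⟨X.one_mem_weightSpace, by simp⟩ (fun {c m n x a} hx ha =>
      ⟨mul_mem_weightSpace hx.ι_mem ha.1, ?_⟩) ha).2
  have h2 : X.D a ∈ X.weightSpace n := ha.2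
  rw [SetLike.mem_coe, Submodule.mem_comap, D_mul, D_ι]
  exact Submodule.add_mem _ (mul_mem_weightSpace hx.cobarGen_mem ha.1)
    (mul_mem_weightSpace (par_mem_weightSpace _ hx.ι_mem) h2)

variable {X} in
lemma weight_eq {n : ℕ} {a : TensorAlgebra k C} (ha : a ∈ X.weightSpace n) :
    X.weight a = (n : k) • a := by
  have := weight_induction (fun n => LinearMap.eqLocus X.weight ((n : k) • LinearMap.id))
    (by simp [LinearMap.mem_eqLocus]) (fun {c m n x a} hx ha => by
      rw [LinearMap.mem_eqLocus, LinearMap.smul_apply, LinearMap.id_apply] at ha ⊢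
      rw [weight_ι_mul, hx.num_eq, ha]
      simp [add_smul]) ha
  exact this

variable {X} in
/-- Extracting a vector from an element of weight `n + 1` leaves elements of weight `n`. -/
lemma rTensor_extract_eq_zero {n : ℕ} {a : TensorAlgebra k C} (ha : a ∈ X.weightSpace (n + 1))
    (e : TensorAlgebra k C →ₗ[k] TensorAlgebra k C) (he : ∀ b ∈ X.weightSpace n, e b = 0) :
    e.rTensor M (X.extract a) = 0 := by
  -- The quantifier over all `e` vanishing on the lower weight is essential: for a word `x a` the
  -- induction hypothesis is used with `e` composed with left multiplication by `x`.
  have := (weight_induction (fun n => X.weightSpace n ⊓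
    ⨅ e : TensorAlgebra k C →ₗ[k] TensorAlgebra k C,
    ⨅ _ : (∀ n', n = n' + 1 → ∀ b ∈ X.weightSpace n', e b = 0),
      LinearMap.ker (e.rTensor M ∘ₗ X.extract)) ⟨X.one_mem_weightSpace, by
        simp only [SetLike.mem_coe, Submodule.mem_iInf]
        intro e _
        simp⟩ (fun {c m n x a} hx ha => by
      obtain ⟨h1, h2⟩ := ha
      refine ⟨mul_mem_weightSpace hx.ι_mem h1, ?_⟩
      simp only [SetLike.mem_coe, Submodule.mem_iInf, LinearMap.mem_ker,
        LinearMap.comp_apply] at h2 ⊢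
      intro e he
      have h3 : e.rTensor M ((LinearMap.mul k (TensorAlgebra k C) (ι k x)).rTensor M
          (X.extract a)) = 0 := by
        rw [← LinearMap.rTensor_comp_apply]
        refine h2 _ fun n' hn' b hb => he (m + n') (by omega) _ (mul_mem_weightSpace hx.ι_mem hb)
      rw [extract_ι_mul, map_add, h3, add_zero]
      cases hx with
      | incl hv =>
        rw [X.π_incl, swap_pure hv, LinearMap.rTensor_tmul,
          he n (by omega) _ (par_mem_weightSpace _ h1), TensorProduct.zero_tmul]
      | L hv hx => rw [X.π_L, map_zero, LinearMap.zero_apply, map_zero]) ha).2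
  simp only [SetLike.mem_coe, Submodule.mem_iInf] at this
  exact this e fun n' hn' => by obtain rfl : n = n' := by omega
                                exact he

variable {X} in
lemma counit_eq_zero {n : ℕ} {a : TensorAlgebra k C} (ha : a ∈ X.weightSpace (n + 1)) :
    TensorAlgebra.algebraMapInv a = 0 := by
  have := weight_induction (fun n => ⨅ _ : n ≠ 0,
    LinearMap.ker (TensorAlgebra.algebraMapInv (R := k) (M := C)).toLinearMap)
    (by simp) (fun hx ha => by simp [Submodule.mem_iInf]) ha
  simpa [Submodule.mem_iInf] using this

variable {X} in
lemma exists_eq_algebraMap {a : TensorAlgebra k C} (ha : a ∈ X.weightSpace 0) :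
    ∃ c, a = algebraMap k _ c := by
  have := weight_induction (fun n => if n = 0 then Submodule.span k {1} else ⊤)
    (by simp) (fun {b m n x a} hx _ => by
      have := hx.pos
      rw [if_neg (by omega)]
      exact Submodule.mem_top) ha
  rw [if_pos rfl, Submodule.mem_span_singleton] at this
  obtain ⟨c, rfl⟩ := this
  exact ⟨c, (Algebra.algebraMap_eq_smul_one c).symm⟩

/-- The algebra map to the tensor algebra of `M` that extends the projection `π`. -/
def toTensors : TensorAlgebra k C →ₐ[k] TensorAlgebra k M := TensorAlgebra.lift k (ι k ∘ₗ X.π)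

/-- The embedding of the tensor algebra of `M`. -/
def ofTensors : TensorAlgebra k M →ₐ[k] TensorAlgebra k C := TensorAlgebra.lift k (ι k ∘ₗ X.incl)

@[simp] lemma toTensors_ι (x : C) : X.toTensors (ι k x) = ι k (X.π x) := by simp [toTensors]

@[simp] lemma ofTensors_ι (v : M) : X.ofTensors (ι k v) = ι k (X.incl v) := by simp [ofTensors]

/-- The sum over all permutations of the projection to the tensors of vectors. -/
def permProj : TensorAlgebra k C →ₗ[k] TensorAlgebra k C :=
  X.ofTensors.toLinearMap ∘ₗ permSum X.ρ ∘ₗ X.toTensors.toLinearMap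

/-- Choosing the last letter of each permutation gives `permProj` the recursion through `extract`
that `stage` also obeys. Extraction commutes with the projection to words of vectors, so letters
outside `M` cause no extra terms. -/
lemma permProj_eq (a : TensorAlgebra k C) : X.permProj a =
    mulVec X.incl (X.permProj.rTensor M (X.extract a)) +
      algebraMap k _ (TensorAlgebra.algebraMapInv a) := by
  have h1 : X.toTensors = TensorAlgebra.lift k (ι k ∘ₗ X.π) := rfl
  have h2 := extraction_map (ψ := X.π) (φ := LinearMap.id) (π' := LinearMap.id) X.ρ_comp_ρ
    (ρ := -X.ε) (ρ' := X.ρ) (ρM' := X.ρ) (π := X.π)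
    (fun x => by simp [ρ, X.π_ε]) (fun _ => rfl) (fun _ => rfl) a
  have h3 : ∀ y, X.ofTensors (mulVec LinearMap.id y) =
      mulVec X.incl (X.ofTensors.toLinearMap.rTensor M y) := fun y => by
    induction y using TensorProduct.induction_on with
    | zero => simp
    | add y z hy hz => simp only [map_add, hy, hz]
    | tmul t v => simp
  have h4 : (TensorAlgebra.algebraMapInv.comp X.toTensors : TensorAlgebra k C →ₐ[k] k) =
      TensorAlgebra.algebraMapInv := by
    ext x
    simp [TensorAlgebra.algebraMapInv]
  rw [permProj, LinearMap.comp_apply, LinearMap.comp_apply, AlgHom.toLinearMap_apply,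
    AlgHom.toLinearMap_apply, permSum_eq X.ρ_comp_ρ, map_add, h3, AlgHom.commutes,
    ← AlgHom.comp_apply TensorAlgebra.algebraMapInv, h4, h1, ← h2]
  congr 2
  rw [← LinearMap.rTensor_comp_apply, rTensor_map_apply]
  rfl

@[simp] lemma permProj_algebraMap (c : k) :
    X.permProj (algebraMap k _ c) = algebraMap k _ c := by
  rw [Algebra.algebraMap_eq_smul_one, map_smul]
  simp [permProj]

/-- The homotopy that contracts the part of weight `n`, up to the factor `n!`. -/
def stage : ℕ → TensorAlgebra k C →ₗ[k] TensorAlgebra k C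
  | 0 => 0
  | n + 1 => (n.factorial : k) • X.preHomotopy + mulVec X.incl ∘ₗ (stage n).rTensor M ∘ₗ X.extract

lemma stage_succ (n : ℕ) (a : TensorAlgebra k C) : X.stage (n + 1) a =
    (n.factorial : k) • X.preHomotopy a + mulVec X.incl ((X.stage n).rTensor M (X.extract a)) :=
  rfl

/-- `stage n` is odd; this supplies the sign when it passes the summand of `DM` that differentiates
the extracted vector. -/
lemma par_stage (n : ℕ) (a : TensorAlgebra k C) :
    X.par true (X.stage n a) = -X.stage n (X.par true a) := by
  induction n generalizing a with
  | zero => simp [stage]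
  | succ n ih =>
    have h : (X.par true).toLinearMap ∘ₗ X.stage n = -(X.stage n ∘ₗ (X.par true).toLinearMap) :=
      LinearMap.ext ih
    rw [stage_succ, stage_succ, map_add, map_smul, par_preHomotopy, par_mulVec, extract_par,
      map_rTensor_apply, rTensor_map_apply, h, map_neg_left, LinearMap.neg_apply,
      map_neg, smul_neg, neg_add]

/-- The first summand of `stage (n + 1)` contributes `D_preHomotopy`. Extraction and right
multiplication by the vector are chain maps, so the second contributes the anticommutator of `D` and
`stage n` on the remaining word. -/
lemma D_stage_succ (n : ℕ) (a : TensorAlgebra k C) :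
    X.D (X.stage (n + 1) a) + X.stage (n + 1) (X.D a) =
      (n.factorial : k) • (X.weight a - mulVec X.incl (X.extract a)) +
        mulVec X.incl ((X.D ∘ₗ X.stage n + X.stage n ∘ₗ X.D).rTensor M (X.extract a)) := by
  have h : ∀ y, X.DM ((X.stage n).rTensor M y) + (X.stage n).rTensor M (X.DM y) =
      (X.D ∘ₗ X.stage n + X.stage n ∘ₗ X.D).rTensor M y := fun y => by
    induction y using TensorProduct.induction_on with
    | zero => simp
    | add y z hy hz => simp only [map_add, ← hy, ← hz]; abel
    | tmul t v =>
      simp [par_stage, TensorProduct.neg_tmul]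
  rw [← D_preHomotopy, ← h, stage_succ, stage_succ, map_add, map_smul, D_mulVec, extract_D,
    smul_add, map_add]
  abel

variable {X} in
-- In weight `n + 1` the sum telescopes: `n!` times the weight is `(n + 1)!`, the term `n! • mulVec
-- (extract a)` cancels against the induction hypothesis on the remaining word of weight `n`, and
-- what is left is the recursion for `permProj`.
lemma D_stage {n : ℕ} {a : TensorAlgebra k C} (ha : a ∈ X.weightSpace n) :
    X.D (X.stage n a) + X.stage n (X.D a) = (n.factorial : k) • a - X.permProj a := by
  induction n generalizing a with
  | zero =>
    obtain ⟨c, rfl⟩ := exists_eq_algebraMap ha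
    simp [stage]
  | succ n ih =>
    have h := rTensor_extract_eq_zero ha
      (X.D ∘ₗ X.stage n + X.stage n ∘ₗ X.D - ((n.factorial : k) • LinearMap.id - X.permProj))
      fun b hb => by
        simp only [LinearMap.sub_apply, LinearMap.add_apply, LinearMap.comp_apply, ih hb]
        simp
    rw [LinearMap.rTensor_sub, LinearMap.sub_apply, sub_eq_zero] at h
    rw [D_stage_succ, h, weight_eq ha, X.permProj_eq a, counit_eq_zero ha, LinearMap.rTensor_sub,
      LinearMap.rTensor_smul, LinearMap.rTensor_id, LinearMap.sub_apply, LinearMap.smul_apply,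
      LinearMap.id_apply, map_sub, map_smul, map_zero, add_zero, smul_sub, smul_smul,
      Nat.factorial_succ]
    push_cast
    rw [mul_comm]
    abel

/-- A homotopy from the identity to the projection to symmetrized tensors of vectors. -/
def homotopy : TensorAlgebra k C →ₗ[k] TensorAlgebra k C :=
  X.byWeight fun n => (n.factorial : k)⁻¹ • X.stage n

/-- The projection to symmetrized tensors of vectors. -/
def avgProj : TensorAlgebra k C →ₗ[k] TensorAlgebra k C :=
  X.byWeight fun n => (n.factorial : k)⁻¹ • X.permProj

lemma D_homotopy (a : TensorAlgebra k C) :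
    X.D (X.homotopy a) + X.homotopy (X.D a) = a - X.avgProj a := by
  have h := X.ext_weight (f := X.D ∘ₗ X.homotopy + X.homotopy ∘ₗ X.D)
    (g := LinearMap.id - X.avgProj) fun n a ha => by
    have hn : (n.factorial : k) ≠ 0 := by exact_mod_cast n.factorial_ne_zero
    simp only [LinearMap.add_apply, LinearMap.comp_apply, LinearMap.sub_apply, LinearMap.id_apply,
      homotopy, avgProj, byWeight_apply _ ha, byWeight_apply _ (D_mem_weightSpace ha),
      LinearMap.smul_apply, map_smul]
    rw [← smul_add, D_stage ha, smul_sub, inv_smul_smul₀ hn]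
  exact LinearMap.congr_fun h a

variable {X} in
-- A letter is either a vector, of weight one, or killed by `π`; so a surviving word of weight `n`
-- has exactly `n` letters.
lemma toTensors_mem_range {n : ℕ} {a : TensorAlgebra k C} (ha : a ∈ X.weightSpace n) :
    ∃ t : ⨂[k]^n M, TensorPower.toTensorAlgebra t = X.toTensors a := by
  refine weight_induction (fun n => (LinearMap.range (TensorPower.toTensorAlgebra (R := k) (M := M)
    (n := n))).comap X.toTensors.toLinearMap) ⟨PiTensorProduct.tprod k Fin.elim0, ?_⟩
    (fun {b m n x a} hx ha => ?_) ha
  · rw [TensorPower.toTensorAlgebra_tprod, tprod_zero, AlgHom.toLinearMap_apply, map_one]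
  · obtain ⟨t, ht⟩ := ha
    rw [AlgHom.toLinearMap_apply] at ht
    rw [Submodule.mem_comap, AlgHom.toLinearMap_apply, map_mul, toTensors_ι]
    cases hx with
    | @incl _ v _ =>
      rw [add_comm, X.π_incl]
      exact ⟨tensorCons n v t, by rw [toTensorAlgebra_tensorCons, ht]⟩
    | L => rw [X.π_L, map_zero, zero_mul]; exact Submodule.zero_mem _

/-- The projection to the tensor algebra is compatible with the differentials up to
symmetrization. -/
lemma permSum_toTensors_D (a : TensorAlgebra k C) :
    permSum X.ρ (X.toTensors (X.D a)) =
      permSum X.ρ (tensorDiff X.ρ (-X.δ) (X.toTensors a)) := by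
  -- Quadratic terms vanish after symmetrization: `Δ x` is invariant under the flip, but
  -- desuspension reverses the sign of the exchange of two letters, so the expression equals its own
  -- negative.
  have hq : ∀ x t, permSum X.ρ (X.toTensors (X.quad (X.Δ x)) * t) = 0 := fun x t => by
    have h : (permSum X.ρ ∘ₗ LinearMap.mulRight k t ∘ₗ X.toTensors.toLinearMap ∘ₗ X.quad) ∘ₗ
        koszulFlip X.ε = -(permSum X.ρ ∘ₗ LinearMap.mulRight k t ∘ₗ X.toTensors.toLinearMap ∘ₗ
          X.quad) := by
      refine tensor_square_ext X.ε_comp_ε fun b c x y hx hy => ?_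
      have hx' : X.ρ (X.π x) = boolSign k (!b) • X.π x := X.ρ_pure (by rw [← X.π_ε, hx, map_smul])
      have hy' : X.ρ (X.π y) = boolSign k (!c) • X.π y := X.ρ_pure (by rw [← X.π_ε, hy, map_smul])
      simp only [LinearMap.comp_apply, LinearMap.neg_apply, LinearMap.mulRight_apply,
        AlgHom.toLinearMap_apply, koszulFlip_pure hx, quad_tmul, map_mul, toTensors_ι, mul_assoc,
        permSum_ι_mul, twist_pure hy, hx, hy, map_smul, smul_mul_assoc]
      rw [insertion_comm X.ρ_comp_ρ hx', twist_pure hy', map_smul]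
      cases b <;> cases c <;> simp
    have h' := LinearMap.congr_fun h (X.Δ x)
    rw [LinearMap.comp_apply, koszulFlip_Δ, LinearMap.neg_apply] at h'
    exact eq_zero_of_eq_neg k h'
  have h := tensor_ext' (f := permSum X.ρ ∘ₗ X.toTensors.toLinearMap ∘ₗ X.D)
    (g := permSum X.ρ ∘ₗ tensorDiff X.ρ (-X.δ) ∘ₗ X.toTensors.toLinearMap) (by simp)
    (fun x a ha => by
      simp only [LinearMap.comp_apply, AlgHom.toLinearMap_apply] at ha ⊢
      rw [D_ι_mul, map_sub, map_mul, map_mul, map_mul, toTensors_ι, toTensors_ι, tensorDiff_ι_mul,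
        map_sub, map_add, permSum_ι_mul, permSum_ι_mul, permSum_ι_mul, ha, cobarGen_eq, map_add,
        add_mul, map_add, hq, map_neg, toTensors_ι, neg_mul, map_neg, permSum_ι_mul, X.π_d, X.π_ε]
      simp [ρ, sub_eq_add_neg])
  exact LinearMap.congr_fun h a

end InsertionCoalgebra

end SymCobar
end

noncomputable section

namespace SymCobar

open TensorAlgebra (ι)

/-! ### Naturality of all operators -/

namespace InsertionCoalgebra

variable {k : Type u} [Field k] [CharZero k] {M : Type v} [AddCommGroup M] [Module k M]
  {C : Type w} [AddCommGroup C] [Module k C] {X : InsertionCoalgebra k M C}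
  {M' : Type*} [AddCommGroup M'] [Module k M'] {C' : Type*} [AddCommGroup C'] [Module k C']
  {Y : InsertionCoalgebra k M' C'}

/-- Compatibility of linear maps with the structures that determine all the others. -/
structure IsMorphism (X : InsertionCoalgebra k M C) (Y : InsertionCoalgebra k M' C')
    (φ : M →ₗ[k] M') (ψ : C →ₗ[k] C') : Prop where
  σ : ∀ v, φ (X.σ v) = Y.σ (φ v)
  δ : ∀ v, φ (X.δ v) = Y.δ (φ v)
  incl : ∀ v, ψ (X.incl v) = Y.incl (φ v)
  L : ∀ v c, ψ (X.L v c) = Y.L (φ v) (ψ c)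

namespace IsMorphism

variable {φ : M →ₗ[k] M'} {ψ : C →ₗ[k] C'} (H : IsMorphism X Y φ ψ)

include H

lemma pure {v : M} {b : Bool} (hv : X.σ v = boolSign k b • v) :
    Y.σ (φ v) = boolSign k b • φ v := by
  rw [← H.σ, hv, map_smul]

lemma isShuffle {b : Bool} {n : ℕ} {x : C} (h : X.IsShuffle b n x) : Y.IsShuffle b n (ψ x) := by
  induction h with
  | incl hv => rw [H.incl]; exact .incl (H.pure hv)
  | L hv _ ih => rw [H.L]; exact .L (H.pure hv) ih

lemma ε (x : C) : ψ (X.ε x) = Y.ε (ψ x) := by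
  have h := X.ext_generated (f := ψ ∘ₗ X.ε) (g := Y.ε ∘ₗ ψ)
    (fun b v _ => by simp [X.ε_incl, Y.ε_incl, H.incl, H.σ])
    (fun b v _ c hc => by
      rw [LinearMap.comp_apply, LinearMap.comp_apply] at hc ⊢
      rw [X.ε_L, H.L, H.L, Y.ε_L, hc, H.σ])
  exact LinearMap.congr_fun h x

lemma π (x : C) : φ (X.π x) = Y.π (ψ x) := by
  have h := X.ext_generated (f := φ ∘ₗ X.π) (g := Y.π ∘ₗ ψ)
    (fun b v _ => by simp [X.π_incl, Y.π_incl, H.incl])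
    (fun b v _ c _ => by simp [X.π_L, H.L, Y.π_L])
  exact LinearMap.congr_fun h x

lemma d (x : C) : ψ (X.d x) = Y.d (ψ x) := by
  have h := X.ext_generated (f := ψ ∘ₗ X.d) (g := Y.d ∘ₗ ψ)
    (fun b v _ => by simp [X.d_incl, Y.d_incl, H.incl, H.δ])
    (fun b v hv c hc => by
      rw [LinearMap.comp_apply, LinearMap.comp_apply] at hc ⊢
      rw [X.d_L hv, map_add, map_smul, H.L, H.L, H.L, Y.d_L (H.pure hv), hc, H.δ])
  exact LinearMap.congr_fun h x

/-- The coproduct is determined by `Δ_incl` and the recursion `Δ_L`, and a morphism respects every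
ingredient of these formulas. -/
lemma Δ (x : C) : TensorProduct.map ψ ψ (X.Δ x) = Y.Δ (ψ x) := by
  have h := X.ext_generated (f := TensorProduct.map ψ ψ ∘ₗ X.Δ) (g := Y.Δ ∘ₗ ψ)
    (fun b v _ => by simp [X.Δ_incl, Y.Δ_incl, H.incl])
    (fun b v hv c hc => by
      rw [LinearMap.comp_apply, LinearMap.comp_apply] at hc ⊢
      have h1 : ψ ∘ₗ X.L v = Y.L (φ v) ∘ₗ ψ := LinearMap.ext (H.L v)
      have h2 : ψ ∘ₗ twist X.ε b = twist Y.ε b ∘ₗ ψ := LinearMap.ext (twist_map H.ε b)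
      rw [X.Δ_L hv, map_add, map_add, map_add, H.L, Y.Δ_L (H.pure hv), map_rTensor_apply,
        ← hc, rTensor_map_apply, h1, TensorProduct.map_tmul, TensorProduct.map_tmul, H.incl,
        twist_map H.ε, ← LinearMap.comp_apply (TensorProduct.map ψ ψ),
        ← LinearMap.comp_apply (TensorProduct.map _ _) (TensorProduct.map ψ ψ),
        ← TensorProduct.map_comp, ← TensorProduct.map_comp, h1, h2])
  exact LinearMap.congr_fun h x

/-- The induced map of cobar constructions. -/
local notation "Ω" => TensorAlgebra.lift k (ι k ∘ₗ ψ)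

lemma mem_weightSpace {n : ℕ} {a : TensorAlgebra k C} (ha : a ∈ X.weightSpace n) :
    Ω a ∈ Y.weightSpace n := by
  refine weight_induction (fun n => (Y.weightSpace n).comap (Ω).toLinearMap)
    (by simpa using Y.one_mem_weightSpace) (fun {b m n x a} hx ha => ?_) ha
  rw [Submodule.mem_comap, AlgHom.toLinearMap_apply] at ha ⊢
  rw [map_mul, TensorAlgebra.lift_ι_apply]
  exact mul_mem_weightSpace (H.isShuffle hx).ι_mem ha

lemma D (a : TensorAlgebra k C) : Ω (X.D a) = Y.D (Ω a) := by
  have hq : ∀ y, Ω (X.quad y) = Y.quad (TensorProduct.map ψ ψ y) := fun y => by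
    induction y using TensorProduct.induction_on with
    | zero => simp
    | add y z hy hz => simp only [map_add, hy, hz]
    | tmul x y => simp [H.ε]
  have h := tensor_ext' (f := (Ω).toLinearMap ∘ₗ X.D) (g := Y.D ∘ₗ (Ω).toLinearMap) (by simp)
    (fun x a ha => by
      simp only [LinearMap.comp_apply, AlgHom.toLinearMap_apply] at ha ⊢
      rw [D_ι_mul, map_sub, map_mul, map_mul, map_mul, ha, TensorAlgebra.lift_ι_apply,
        TensorAlgebra.lift_ι_apply, LinearMap.comp_apply, LinearMap.comp_apply, D_ι_mul,
        cobarGen_eq, cobarGen_eq, map_add, hq, H.Δ, H.ε, map_neg, TensorAlgebra.lift_ι_apply,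
        LinearMap.comp_apply, H.d])
  exact LinearMap.congr_fun h a

lemma Lhat (v : M) (a : TensorAlgebra k C) : Ω (X.Lhat a v) = Y.Lhat (Ω a) (φ v) := by
  have h := ext_homogeneous X.σ_comp_σ (f := X.Lhat.flip.compr₂ (Ω).toLinearMap)
    (g := Y.Lhat.flip.compl₁₂ φ (Ω).toLinearMap) fun b v hv => by
    refine tensor_ext' (by simp) fun x a ha => ?_
    simp only [LinearMap.compr₂_apply, LinearMap.compl₁₂_apply, AlgHom.toLinearMap_apply,
      LinearMap.flip_apply] at ha ⊢
    rw [Lhat_ι_mul hv, map_add, map_mul, map_mul, map_mul, ha, TensorAlgebra.lift_ι_apply,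
      TensorAlgebra.lift_ι_apply, TensorAlgebra.lift_ι_apply, LinearMap.comp_apply,
      LinearMap.comp_apply, LinearMap.comp_apply, Lhat_ι_mul (H.pure hv), H.L,
      twist_map (τ := -X.ε) (τ' := -Y.ε) fun x => by simp [H.ε]]
  exact LinearMap.congr_fun₂ h v a

lemma preHomotopy (a : TensorAlgebra k C) : Ω (X.preHomotopy a) = Y.preHomotopy (Ω a) := by
  have h := tensor_ext' (f := (Ω).toLinearMap ∘ₗ X.preHomotopy)
    (g := Y.preHomotopy ∘ₗ (Ω).toLinearMap) (by simp)
    (fun x a ha => by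
      simp only [LinearMap.comp_apply, AlgHom.toLinearMap_apply] at ha ⊢
      rw [preHomotopy_ι_mul, map_sub, map_mul, map_mul, ha, TensorAlgebra.lift_ι_apply,
        TensorAlgebra.lift_ι_apply, LinearMap.comp_apply, LinearMap.comp_apply,
        preHomotopy_ι_mul, H.Lhat, H.σ, H.π, H.ε])
  exact LinearMap.congr_fun h a

lemma extract (a : TensorAlgebra k C) :
    TensorProduct.map (Ω).toLinearMap φ (X.extract a) = Y.extract (Ω a) :=
  extraction_map X.ρ_comp_ρ (fun x => by simp [H.ε]) (fun v => by simp [ρ, H.σ]) H.π a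

lemma mulVec (y : TensorAlgebra k C ⊗[k] M) : Ω (mulVec X.incl y) =
    SymCobar.mulVec Y.incl (TensorProduct.map (Ω).toLinearMap φ y) := by
  induction y using TensorProduct.induction_on with
  | zero => simp
  | add y z hy hz => simp only [map_add, hy, hz]
  | tmul a v => simp [H.incl]

lemma stage (n : ℕ) (a : TensorAlgebra k C) : Ω (X.stage n a) = Y.stage n (Ω a) := by
  induction n generalizing a with
  | zero => simp [InsertionCoalgebra.stage]
  | succ n ih =>
    have h : (Ω).toLinearMap ∘ₗ X.stage n = Y.stage n ∘ₗ (Ω).toLinearMap := LinearMap.ext ih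
    rw [stage_succ, stage_succ, map_add, map_smul, H.preHomotopy, H.mulVec, map_rTensor_apply,
      ← H.extract, rTensor_map_apply, h]

lemma homotopy (a : TensorAlgebra k C) : Ω (X.homotopy a) = Y.homotopy (Ω a) := by
  have h := X.ext_weight (f := (Ω).toLinearMap ∘ₗ X.homotopy)
    (g := Y.homotopy ∘ₗ (Ω).toLinearMap) fun n a ha => by
    simp only [LinearMap.comp_apply, AlgHom.toLinearMap_apply, InsertionCoalgebra.homotopy,
      byWeight_apply _ ha, byWeight_apply _ (H.mem_weightSpace ha), LinearMap.smul_apply, map_smul,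
      H.stage]
  exact LinearMap.congr_fun h a

end IsMorphism

end InsertionCoalgebra

end SymCobar
end

noncomputable section

namespace SymCobar

open TensorAlgebra (ι)

/-! ### Degrees of all operators -/

namespace InsertionCoalgebra

variable {k : Type u} [Field k] [CharZero k] {M : Type v} [AddCommGroup M] [Module k M]
  {C : Type w} [AddCommGroup C] [Module k C] {X : InsertionCoalgebra k M C}

/-- A family of subspaces of `M` that consist of homogeneous vectors and are compatible with the
differential. -/
structure IsGrading (X : InsertionCoalgebra k M C) (G : ℤ → Submodule k M) : Prop where
  pure : ∀ p, ∃ b, ∀ v ∈ G p, X.σ v = boolSign k b • v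
  δ_mem : ∀ {p v}, v ∈ G p → X.δ v ∈ G (p + 1)

/-- The elements of degree `q` that are obtained by shuffling vectors, where `v` in `G p` has
degree `p` as an element of `C`, and `L v` has degree `p - 1`. -/
inductive IsDegShuffle (X : InsertionCoalgebra k M C) (G : ℤ → Submodule k M) : ℤ → C → Prop
  | incl {p : ℤ} {v : M} (hv : v ∈ G p) : IsDegShuffle X G p (X.incl v)
  | L {p q : ℤ} {v : M} {x : C} (hv : v ∈ G p) (hx : IsDegShuffle X G q x) :
      IsDegShuffle X G (q + p - 1) (X.L v x)

/-- The products of degree `q` of homogeneous elements of `C`. -/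
inductive IsDegWord (X : InsertionCoalgebra k M C) (G : ℤ → Submodule k M) :
    ℤ → TensorAlgebra k C → Prop
  | one : IsDegWord X G 0 1
  | mul {p q : ℤ} {x : C} {a : TensorAlgebra k C} (hx : IsDegShuffle X G p x)
      (ha : IsDegWord X G q a) : IsDegWord X G (p + q) (ι k x * a)

/-- The part of degree `q` of the cobar construction. -/
def degSpace (X : InsertionCoalgebra k M C) (G : ℤ → Submodule k M) (q : ℤ) :
    Submodule k (TensorAlgebra k C) :=
  Submodule.span k {a | IsDegWord X G q a}

variable {G : ℤ → Submodule k M}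

lemma map_degSpace {f : TensorAlgebra k C →ₗ[k] TensorAlgebra k C} {p q : ℤ}
    (h : ∀ a, IsDegWord X G p a → f a ∈ degSpace X G q) {a : TensorAlgebra k C}
    (ha : a ∈ degSpace X G p) : f a ∈ degSpace X G q :=
  (Submodule.span_le (p := (degSpace X G q).comap f)).2 h ha

lemma one_mem_degSpace : 1 ∈ degSpace X G 0 := Submodule.subset_span .one

lemma IsDegShuffle.ι_mul_mem {p q : ℤ} {x : C} (hx : X.IsDegShuffle G p x) {a : TensorAlgebra k C}
    (ha : a ∈ degSpace X G q) : ι k x * a ∈ degSpace X G (p + q) :=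
  map_degSpace (f := LinearMap.mulLeft k (ι k x)) (fun _ ha => Submodule.subset_span (.mul hx ha)) ha

lemma IsDegShuffle.ι_mem {q : ℤ} {x : C} (hx : X.IsDegShuffle G q x) :
    ι k x ∈ degSpace X G q := by
  simpa using hx.ι_mul_mem one_mem_degSpace

lemma mul_mem_degSpace {p q : ℤ} {a b : TensorAlgebra k C} (ha : a ∈ degSpace X G p)
    (hb : b ∈ degSpace X G q) : a * b ∈ degSpace X G (p + q) := by
  refine map_degSpace (f := LinearMap.mulRight k b) (fun w hw => ?_) ha
  rw [LinearMap.mulRight_apply]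
  clear ha
  induction hw with
  | one => rwa [one_mul, zero_add]
  | mul hx _ ih => rw [mul_assoc, add_assoc]; exact hx.ι_mul_mem ih

variable (hG : IsGrading X G)

include hG

lemma IsDegShuffle.isShuffle {q : ℤ} {x : C} (hx : X.IsDegShuffle G q x) :
    ∃ b n, X.IsShuffle b n x := by
  induction hx with
  | @incl p v hv => exact ⟨_, _, .incl ((hG.pure p).choose_spec v hv)⟩
  | @L p q v x hv _ ih =>
    obtain ⟨b, n, h⟩ := ih
    exact ⟨_, _, .L ((hG.pure p).choose_spec v hv) h⟩

lemma IsDegShuffle.par_ι_mem {q : ℤ} {x : C} (hx : X.IsDegShuffle G q x) (b : Bool) :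
    X.par b (ι k x) ∈ degSpace X G q := by
  obtain ⟨c, n, h⟩ := hx.isShuffle hG
  rw [par_ι, twist_neg_ε, twist_pure h.pure, map_smul, map_smul]
  exact Submodule.smul_mem _ _ (Submodule.smul_mem _ _ hx.ι_mem)

lemma IsDegWord.mem_weightSpace {q : ℤ} {a : TensorAlgebra k C} (ha : X.IsDegWord G q a) :
    ∃ n, a ∈ X.weightSpace n := by
  induction ha with
  | one => exact ⟨0, X.one_mem_weightSpace⟩
  | mul hx _ ih =>
    obtain ⟨n, h⟩ := ih
    obtain ⟨b, m, hm⟩ := hx.isShuffle hG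
    exact ⟨_, mul_mem_weightSpace hm.ι_mem h⟩

lemma par_mem_degSpace (b : Bool) {q : ℤ} {a : TensorAlgebra k C} (ha : a ∈ degSpace X G q) :
    X.par b a ∈ degSpace X G q := by
  refine map_degSpace (f := (X.par b).toLinearMap) (fun w hw => ?_) ha
  rw [AlgHom.toLinearMap_apply]
  clear ha
  induction hw with
  | one => rw [map_one]; exact one_mem_degSpace
  | mul hx _ ih =>
    rw [map_mul]
    exact mul_mem_degSpace (hx.par_ι_mem hG b) ih

lemma Lhat_mem_degSpace {p q : ℤ} {v : M} (hv : v ∈ G p) {a : TensorAlgebra k C}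
    (ha : a ∈ degSpace X G q) : X.Lhat a v ∈ degSpace X G (q + p - 1) := by
  obtain ⟨b, hb⟩ := hG.pure p
  refine map_degSpace (f := X.Lhat.flip v) (fun w hw => ?_) ha
  rw [LinearMap.flip_apply]
  clear ha
  induction hw with
  | one => simp
  | @mul m q x a hx hw ih =>
    rw [Lhat_ι_mul (hb v hv)]
    refine Submodule.add_mem _ ?_ ?_
    · rw [show m + q + p - 1 = (m + p - 1) + q by ring]
      exact (IsDegShuffle.L hv hx).ι_mul_mem (Submodule.subset_span hw)
    · rw [show m + q + p - 1 = m + (q + p - 1) by ring, ← par_ι]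
      exact mul_mem_degSpace (hx.par_ι_mem hG b) ih

lemma IsDegShuffle.cobarGen_mem {q : ℤ} {x : C} (hx : X.IsDegShuffle G q x) :
    cobarGen X.ε X.d X.Δ x ∈ degSpace X G (q + 1) := by
  induction hx with
  | @incl p v hv =>
    rw [cobarGen_eq, X.Δ_incl, map_zero, add_zero, X.d_incl]
    exact Submodule.neg_mem _ (IsDegShuffle.incl (hG.δ_mem hv)).ι_mem
  | @L p q v x hv hx ih =>
    obtain ⟨b, hb⟩ := hG.pure p
    rw [cobarGen_L (hb v hv)]
    have h1 := Lhat_mem_degSpace hG hv ih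
    have h2 := (IsDegShuffle.L (hG.δ_mem hv) hx).ι_mem
    have h3 := (IsDegShuffle.incl (X := X) hv).ι_mul_mem hx.ι_mem
    have h4 := mul_mem_degSpace (hx.par_ι_mem hG (!b)) (IsDegShuffle.incl (X := X) hv).ι_mem
    rw [show q + 1 + p - 1 = q + p - 1 + 1 by ring] at h1
    rw [show q + (p + 1) - 1 = q + p - 1 + 1 by ring] at h2
    rw [show p + q = q + p - 1 + 1 by ring] at h3
    rw [show q + p = q + p - 1 + 1 by ring] at h4
    exact Submodule.add_mem _ (Submodule.sub_mem _ (Submodule.smul_mem _ _ h1) h2)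
      (Submodule.smul_mem _ _ (Submodule.sub_mem _ h3 h4))

lemma D_mem_degSpace {q : ℤ} {a : TensorAlgebra k C} (ha : a ∈ degSpace X G q) :
    X.D a ∈ degSpace X G (q + 1) := by
  refine map_degSpace (fun w hw => ?_) ha
  clear ha
  induction hw with
  | one => simp
  | @mul p q x a hx hw ih =>
    rw [D_mul, D_ι]
    refine Submodule.add_mem _ ?_ ?_
    · rw [show p + q + 1 = p + 1 + q by ring]
      exact mul_mem_degSpace (hx.cobarGen_mem hG) (Submodule.subset_span hw)
    · rw [add_assoc]
      exact mul_mem_degSpace (hx.par_ι_mem hG true) ih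

lemma preHomotopy_mem_degSpace {q : ℤ} {a : TensorAlgebra k C} (ha : a ∈ degSpace X G q) :
    X.preHomotopy a ∈ degSpace X G (q - 1) := by
  refine map_degSpace (fun w hw => ?_) ha
  clear ha
  induction hw with
  | one => simp
  | @mul p q x a hx hw ih =>
    rw [preHomotopy_ι_mul]
    refine Submodule.sub_mem _ ?_ ?_
    · cases hx with
      | @incl p v hv =>
        obtain ⟨b, hb⟩ := hG.pure p
        rw [X.π_incl, hb v hv, map_smul, add_comm p]
        exact Submodule.smul_mem _ _ (Lhat_mem_degSpace hG hv (Submodule.subset_span hw))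
      | L => rw [X.π_L, map_zero, map_zero]; exact Submodule.zero_mem _
    · have h := hx.par_ι_mem hG true
      rw [par_ι, twist_true, LinearMap.neg_apply, map_neg] at h
      rw [add_sub_assoc]
      refine mul_mem_degSpace ?_ ih
      simpa using Submodule.neg_mem _ h

/-- The operator `e` and its degree `c` are arbitrary because the induction on words replaces `e` by
its composition with left multiplication by a letter of degree `p`, whose degree is `p + c`. -/
lemma mulVec_extract_mem_degSpace {q c : ℤ} {a : TensorAlgebra k C} (ha : a ∈ degSpace X G q)
    {e : TensorAlgebra k C →ₗ[k] TensorAlgebra k C}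
    (he : ∀ p, ∀ b ∈ degSpace X G p, e b ∈ degSpace X G (p + c)) :
    mulVec X.incl (e.rTensor M (X.extract a)) ∈ degSpace X G (q + c) := by
  refine map_degSpace (f := mulVec X.incl ∘ₗ e.rTensor M ∘ₗ X.extract) (fun w hw => ?_) ha
  rw [LinearMap.comp_apply, LinearMap.comp_apply]
  clear ha
  induction hw generalizing e c with
  | one => simp
  | @mul p q x a hx hw ih =>
    rw [extract_ι_mul, map_add, map_add, ← LinearMap.rTensor_comp_apply]
    refine Submodule.add_mem _ ?_ ?_
    · cases hx with
      | @incl p v hv =>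
        obtain ⟨b, hb⟩ := hG.pure p
        rw [X.π_incl, swap_pure (hb v hv), LinearMap.rTensor_tmul, mulVec_tmul,
          show p + q + c = q + c + p by ring]
        exact mul_mem_degSpace (he _ _ (par_mem_degSpace hG _ (Submodule.subset_span hw)))
          (IsDegShuffle.incl hv).ι_mem
      | L => rw [X.π_L, map_zero]; simp
    · rw [show p + q + c = q + (p + c) by ring]
      refine ih fun p' b hb => ?_
      rw [show p' + (p + c) = p + p' + c by ring]
      exact he _ _ (hx.ι_mul_mem hb)

lemma stage_mem_degSpace (n : ℕ) {q : ℤ} {a : TensorAlgebra k C} (ha : a ∈ degSpace X G q) :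
    X.stage n a ∈ degSpace X G (q - 1) := by
  induction n generalizing q a with
  | zero => exact Submodule.zero_mem _
  | succ n ih =>
    rw [stage_succ]
    exact Submodule.add_mem _ (Submodule.smul_mem _ _ (preHomotopy_mem_degSpace hG ha))
      (mulVec_extract_mem_degSpace (c := -1) hG ha fun p b hb => ih hb)

lemma homotopy_mem_degSpace {q : ℤ} {a : TensorAlgebra k C} (ha : a ∈ degSpace X G q) :
    X.homotopy a ∈ degSpace X G (q - 1) := by
  refine map_degSpace (fun a ha => ?_) ha
  obtain ⟨n, hn⟩ := ha.mem_weightSpace hG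
  rw [homotopy, byWeight_apply _ hn]
  exact Submodule.smul_mem _ _ (stage_mem_degSpace hG n (Submodule.subset_span ha))

end InsertionCoalgebra

end SymCobar
end

noncomputable section

namespace SymCobar

open TensorAlgebra (ι)
open TensorPower (toTensorAlgebra)

/-! ### The anti-involution of a tensor algebra -/

section AntiInvolution

variable {k : Type u} [Field k] {M : Type*} [AddCommGroup M] [Module k M]
  {N : Type*} [AddCommGroup N] [Module k N] {B : Type*} [AddCommGroup B] [Module k B]

lemma ext_toTensorAlgebra {f g : TensorAlgebra k M →ₗ[k] B}
    (h : ∀ n (t : ⨂[k]^n M), f (toTensorAlgebra t) = g (toTensorAlgebra t)) : f = g := by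
  refine LinearMap.ext fun a => ?_
  rw [← TensorAlgebra.ofDirectSum_toDirectSum a]
  induction TensorAlgebra.toDirectSum a using DirectSum.induction_on with
  | zero => simp
  | of n t => rw [ofDirectSum_of, h]
  | add x y hx hy => rw [map_add, map_add, map_add, hx, hy]

lemma tprod_snoc {n : ℕ} (w : Fin n → M) (v : M) :
    TensorAlgebra.tprod k M (n + 1) (Fin.snoc w v) = TensorAlgebra.tprod k M n w * ι k v := by
  rw [TensorAlgebra.tprod_apply, TensorAlgebra.tprod_apply, List.ofFn_succ']
  simp

/-- The anti-involution of the tensor algebra that acts by `-1` on generators. -/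
def antiInv (τ : M →ₗ[k] M) : TensorAlgebra k M →ₗ[k] TensorAlgebra k M :=
  tensorRec 1 0 (-∑ b : Bool, (LinearMap.mul k (TensorAlgebra k M)).flip.compl₁₂
    (ι k ∘ₗ parityProj τ b) (tensorTwist τ b).toLinearMap)

@[simp] lemma antiInv_one (τ : M →ₗ[k] M) : antiInv τ 1 = 1 := by simp [antiInv]

lemma tensorTwist_tprod_pure (τ : M →ₗ[k] M) (b : Bool) {n : ℕ} {w : Fin n → M} {e : Fin n → Bool}
    (hw : ∀ i, τ (w i) = boolSign k (e i) • w i) :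
    tensorTwist τ b (TensorAlgebra.tprod k M n w) =
      (∏ j, boolSign k (b && e j)) • TensorAlgebra.tprod k M n w := by
  rw [← MultilinearMap.map_smul_univ, TensorAlgebra.tprod_apply, TensorAlgebra.tprod_apply,
    map_list_prod, List.map_ofFn]
  congr 2
  funext i
  rw [Function.comp_apply, tensorTwist_ι, twist_pure (hw i)]

/-- Under reversal the first factor passes all others, and these are reversed among themselves. -/
lemma koszulSign_rev_cons {n : ℕ} (b : Bool) (e : Fin n → Bool) :
    ((koszulSign Fin.revPerm (Fin.cons b e : Fin (n + 1) → Bool) : ℤˣ) : ℤ) =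
      ((∏ j : Fin n, (if (b && e j) = true then (-1 : ℤ) else 1)) *
        ((koszulSign Fin.revPerm e : ℤˣ) : ℤ)) := by
  simp [koszulSign_eq', Fin.prod_univ_succ, Units.coe_prod, apply_ite]

variable [CharZero k]

lemma antiInv_ι_mul {τ : M →ₗ[k] M} {v : M} {b : Bool} (hv : τ v = boolSign k b • v)
    (t : TensorAlgebra k M) :
    antiInv τ (ι k v * t) = -(tensorTwist τ b (antiInv τ t) * ι k v) := by
  rw [antiInv, tensorRec_ι_mul]
  simp only [LinearMap.zero_apply, zero_add, LinearMap.neg_apply, LinearMap.sum_apply,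
    LinearMap.compl₁₂_apply]
  rw [neg_inj]
  exact sum_parityProj_pure hv fun c =>
    LinearMap.mulLeft k (tensorTwist τ c (antiInv τ t)) ∘ₗ ι k

lemma antiInv_tprod {τ : M →ₗ[k] M} {n : ℕ} {w : Fin n → M} {e : Fin n → Bool}
    (hw : ∀ i, τ (w i) = boolSign k (e i) • w i) :
    antiInv τ (TensorAlgebra.tprod k M n w) = ((-1) ^ n * ((koszulSign Fin.revPerm e : ℤˣ) : ℤ) : k) •
      TensorAlgebra.tprod k M n (w ∘ Fin.rev) := by
  induction n with
  | zero => simp [koszulSign]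
  | succ n ih =>
    obtain ⟨v, w, rfl⟩ : ∃ v w', w = Fin.cons v w' := ⟨_, _, (Fin.cons_self_tail w).symm⟩
    obtain ⟨b, e, rfl⟩ : ∃ b e', e = Fin.cons b e' := ⟨_, _, (Fin.cons_self_tail e).symm⟩
    have hv : τ v = boolSign k b • v := by simpa using hw 0
    have hw' : ∀ i, τ (w i) = boolSign k (e i) • w i := fun i => by simpa using hw i.succ
    rw [tprod_cons, antiInv_ι_mul hv, ih hw', map_smul,
      tensorTwist_tprod_pure (w := w ∘ Fin.rev) (e := e ∘ Fin.rev) τ b fun i => hw' _, Fin.cons_comp_rev, tprod_snoc,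
      koszulSign_rev_cons, smul_smul, smul_mul_assoc, ← neg_smul]
    congr 1
    have : ∏ j, boolSign k (b && (e ∘ Fin.rev) j) = ∏ j, boolSign k (b && e j) :=
      Equiv.prod_comp Fin.revPerm fun j => boolSign k (b && e j)
    rw [this]
    push_cast
    simp only [boolSign]
    ring

lemma antiInv_toTensorAlgebra {τ : M →ₗ[k] M} (hτ : τ ∘ₗ τ = LinearMap.id) {n : ℕ}
    (t : ⨂[k]^n M) : antiInv τ (toTensorAlgebra t) =
      (-1 : k) ^ n • toTensorAlgebra (koszulAct τ Fin.revPerm t) := by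
  have h : antiInv τ ∘ₗ toTensorAlgebra =
      (-1 : k) ^ n • toTensorAlgebra ∘ₗ koszulAct τ (Fin.revPerm (n := n)) := by
    refine ext_pure hτ fun e v hv => ?_
    rw [LinearMap.comp_apply, LinearMap.smul_apply, LinearMap.comp_apply, koszulAct_pure _ hv,
      map_smul, TensorPower.toTensorAlgebra_tprod, TensorPower.toTensorAlgebra_tprod,
      antiInv_tprod hv, smul_smul]
    rfl
  exact LinearMap.congr_fun h t

/-- This replaces the definition through reversal of tensor powers by the recursion on words, on
which the later inductions rely. -/
lemma cobarAntiInv_eq {ε : M →ₗ[k] M} (hε : ε ∘ₗ ε = LinearMap.id) :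
    cobarAntiInv ε = antiInv (-ε) := by
  refine ext_toTensorAlgebra fun n t => ?_
  rw [antiInv_toTensorAlgebra (by rw [LinearMap.neg_comp, LinearMap.comp_neg, neg_neg, hε]),
    cobarAntiInv, LinearMap.comp_apply, LinearMap.comp_apply, AlgHom.toLinearMap_apply,
    AlgHom.toLinearMap_apply, toDirectSum_toTensorAlgebra]
  have := DirectSum.lmap_lof (R := k) (fun n => ((-1 : k) ^ n) • koszulAct (-ε) (Fin.revPerm (n := n))) n t
  rw [DirectSum.lof_eq_of] at this
  rw [this, DirectSum.lof_eq_of, ofDirectSum_of, LinearMap.smul_apply,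
    map_smul]

lemma antiInv_antiInv {τ : M →ₗ[k] M} (hτ : τ ∘ₗ τ = LinearMap.id) (a : TensorAlgebra k M) :
    antiInv τ (antiInv τ a) = a := by
  have h := ext_toTensorAlgebra (f := antiInv τ ∘ₗ antiInv τ) (g := LinearMap.id) fun n t => by
    have h1 : Fin.revPerm * Fin.revPerm = (1 : Equiv.Perm (Fin n)) := by ext; simp
    have h2 := LinearMap.congr_fun (koszulAct_mul hτ (Fin.revPerm (n := n)) Fin.revPerm) t
    rw [h1, koszulAct_one hτ] at h2
    rw [LinearMap.comp_apply, antiInv_toTensorAlgebra hτ, map_smul, antiInv_toTensorAlgebra hτ,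
      ← LinearMap.comp_apply (koszulAct τ _), ← h2,
      smul_smul, ← mul_pow]
    simp
  exact LinearMap.congr_fun h a

/-- Up to sign the anti-involution is the action of one permutation, and the symmetrizer absorbs
permutations on either side. -/
lemma antiInv_permSum {τ : M →ₗ[k] M} (hτ : τ ∘ₗ τ = LinearMap.id) (a : TensorAlgebra k M) :
    antiInv τ (permSum τ a) = permSum τ (antiInv τ a) := by
  have h := ext_toTensorAlgebra (f := antiInv τ ∘ₗ permSum τ) (g := permSum τ ∘ₗ antiInv τ)
    fun n t => by
    have h1 := LinearMap.congr_fun (koszulAct_comp_symmetrizer hτ (Fin.revPerm (n := n))) t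
    have h2 := LinearMap.congr_fun (symmetrizer_comp_koszulAct hτ (Fin.revPerm (n := n))) t
    rw [LinearMap.comp_apply] at h1 h2
    rw [LinearMap.comp_apply, LinearMap.comp_apply, permSum_toTensorAlgebra hτ, map_smul,
      antiInv_toTensorAlgebra hτ, antiInv_toTensorAlgebra hτ, map_smul, permSum_toTensorAlgebra hτ,
      h1, h2, smul_comm]
  exact LinearMap.congr_fun h a

lemma antiInv_map {τ : M →ₗ[k] M} (hτ : τ ∘ₗ τ = LinearMap.id) {τ' : N →ₗ[k] N} {φ : M →ₗ[k] N}
    (h : ∀ x, φ (τ x) = τ' (φ x)) (a : TensorAlgebra k M) :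
    TensorAlgebra.lift k (ι k ∘ₗ φ) (antiInv τ a) =
      antiInv τ' (TensorAlgebra.lift k (ι k ∘ₗ φ) a) := by
  have H := tensor_ext (f := (TensorAlgebra.lift k (ι k ∘ₗ φ)).toLinearMap ∘ₗ antiInv τ)
    (g := antiInv τ' ∘ₗ (TensorAlgebra.lift k (ι k ∘ₗ φ)).toLinearMap) (span_homogeneous hτ)
    (by simp) (fun x ⟨b, hx⟩ t ht => by
      have hx' : τ' (φ x) = boolSign k b • φ x := by rw [← h, hx, map_smul]
      simp only [LinearMap.comp_apply, AlgHom.toLinearMap_apply] at ht ⊢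
      rw [antiInv_ι_mul hx, map_neg, map_mul, tensorTwist_map h, ht, map_mul,
        TensorAlgebra.lift_ι_apply, LinearMap.comp_apply, antiInv_ι_mul hx'])
  exact LinearMap.congr_fun H a

end AntiInvolution

/-! ### Side conditions: improving a homotopy algebraically -/

section Contraction

variable {k A : Type*} [Field k] [CharZero k] [Ring A] [Algebra k A] {D h p J : A}

/-- A homotopy from `1` to a projection can be made to satisfy the side conditions and to commute
with an involution. -/
def improve (k : Type*) [Field k] [Algebra k A] (D h p J : A) : A :=
  (1 - p) * ((2⁻¹ : k) • (h + J * h * J)) * (1 - p) * D *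
    ((1 - p) * ((2⁻¹ : k) • (h + J * h * J)) * (1 - p))

/-- Let `q = 1 - p`. The average `g` of `h` and `J h J` is still a homotopy and commutes with `J`;
since `q` commutes with `D`, so is `s = q g q`, which moreover is annihilated by `p` on both sides.
Finally `s D s` is a homotopy with square zero, because `s s` commutes with `D` and `D D = 0`. -/
lemma improve_spec (hD : D * D = 0) (hh : D * h + h * D = 1 - p) (hp : p * p = p) (hJ : J * J = 1)
    (hJD : J * D = D * J) (hJp : J * p = p * J) :
    D * improve k D h p J + improve k D h p J * D = 1 - p ∧ p * improve k D h p J = 0 ∧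
      improve k D h p J * p = 0 ∧ improve k D h p J * improve k D h p J = 0 ∧
      J * improve k D h p J = improve k D h p J * J := by
  set q := 1 - p with hq
  have hqq : q * q = q := by rw [hq, mul_sub, mul_one, sub_mul, hp, one_mul, sub_self, sub_zero]
  have hJq : J * q = q * J := by rw [hq, mul_sub, sub_mul, hJp, mul_one, one_mul]
  -- Both sides equal `D h D`, since `q = D h + h D`.
  have hDq : D * q = q * D := by
    rw [← hh, mul_add, add_mul, ← mul_assoc, hD, mul_assoc h, hD]
    simp [mul_assoc]
  have hpq : p * q = 0 := by rw [hq, mul_sub, hp, mul_one, sub_self]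
  have hqp : q * p = 0 := by rw [hq, sub_mul, hp, one_mul, sub_self]
  have hJJ : ∀ a, J * (J * a) = a := fun a => by rw [← mul_assoc, hJ, one_mul]
  set g := (2⁻¹ : k) • (h + J * h * J) with hg
  have hDg : D * g + g * D = q := by
    have h1 : D * (J * h * J) + J * h * J * D = q := by
      calc D * (J * h * J) + J * h * J * D = J * (D * h + h * D) * J := by
            simp only [mul_add, add_mul, mul_assoc]
            rw [← mul_assoc D J, ← hJD, mul_assoc, hJD]
        _ = q := by rw [hh, hJq, mul_assoc, hJ, mul_one]
    rw [hg, mul_smul_comm, smul_mul_assoc, ← smul_add, mul_add, add_mul, add_add_add_comm, hh, h1,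
      ← two_smul k, smul_smul, inv_mul_cancel₀ two_ne_zero, one_smul]
  have hJg : J * g = g * J := by
    rw [hg, mul_smul_comm, smul_mul_assoc, mul_add, add_mul, mul_assoc J h J, hJJ, mul_assoc J,
      mul_assoc h, hJ, mul_one, add_comm]
  have hJh : J * (q * g * q) = q * g * q * J := by
    rw [← mul_assoc, ← mul_assoc, hJq, mul_assoc q, hJg, mul_assoc q, mul_assoc g, hJq]
    simp only [mul_assoc]
  have hDh : D * (q * g * q) + q * g * q * D = q := by
    calc D * (q * g * q) + q * g * q * D = q * (D * g + g * D) * q := by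
          rw [mul_assoc (q * g), ← hDq, ← mul_assoc, ← mul_assoc, hDq]
          simp only [mul_add, add_mul, mul_assoc]
          rw [hDq]
      _ = q := by rw [hDg, hqq, hqq]
  have hqh : q * (q * g * q) = q * g * q := by rw [← mul_assoc, ← mul_assoc, hqq]
  have hhq : q * g * q * q = q * g * q := by rw [mul_assoc, hqq]
  have hph : p * (q * g * q) = 0 := by rw [← mul_assoc, ← mul_assoc, hpq, zero_mul, zero_mul]
  have hhp : q * g * q * p = 0 := by rw [mul_assoc, hqp, mul_zero]
  have him : improve k D h p J = q * g * q * D * (q * g * q) := rfl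
  rw [him]
  generalize q * g * q = s at *
  have h1 : D * s = q - s * D := by rw [← hDh, add_sub_cancel_right]
  have h2 : D * s * D = D * q := by rw [h1, sub_mul, mul_assoc, hD, mul_zero, sub_zero, hDq]
  -- Moving `D` past `s` twice produces `q s` with opposite signs.
  have h3 : s * s * D = D * (s * s) := by
    have h4 : s * D = q - D * s := by rw [← hDh, add_sub_cancel_left]
    calc s * s * D = s * (s * D) := mul_assoc _ _ _
      _ = s * (q - D * s) := by rw [h4]
      _ = (q - s * D) * s := by rw [mul_sub, hhq, sub_mul, hqh, mul_assoc]
      _ = D * (s * s) := by rw [← h1, mul_assoc]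
  refine ⟨?_, ?_, ?_, ?_, ?_⟩
  · calc D * (s * D * s) + s * D * s * D = (D * s * D) * s + s * (D * s * D) := by
          simp only [mul_assoc]
      _ = D * (q * s) + s * q * D := by rw [h2]; nth_rewrite 2 [hDq]; simp only [mul_assoc]
      _ = q := by rw [hqh, hhq, hDh]
  · rw [← mul_assoc, ← mul_assoc, hph, zero_mul, zero_mul]
  · rw [mul_assoc, hhp, mul_zero]
  · calc s * D * s * (s * D * s) = s * D * (s * s * D) * s := by simp only [mul_assoc]
      _ = s * (D * D) * (s * s) * s := by rw [h3]; simp only [mul_assoc]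
      _ = 0 := by rw [hD]; simp
  · rw [← mul_assoc, ← mul_assoc, hJh, mul_assoc s, hJD, mul_assoc, mul_assoc, mul_assoc, hJh]
    simp only [mul_assoc]

end Contraction

end SymCobar
end

noncomputable section

namespace SymCobar

open TensorAlgebra (ι)

/-! ### The anti-involution on the cobar construction, and the final contraction -/

namespace InsertionCoalgebra

variable {k : Type u} [Field k] [CharZero k] {M : Type v} [AddCommGroup M] [Module k M]
  {C : Type w} [AddCommGroup C] [Module k C] (X : InsertionCoalgebra k M C)

/-- The anti-involution of the cobar construction that acts by `-1` on generators. -/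
def J : TensorAlgebra k C →ₗ[k] TensorAlgebra k C := antiInv (-X.ε)

@[simp] lemma J_one : X.J 1 = 1 := antiInv_one _

variable {X} in
lemma J_ι_mul {x : C} {b : Bool} (hx : X.ε x = boolSign k b • x) (a : TensorAlgebra k C) :
    X.J (ι k x * a) = -(X.par (!b) (X.J a) * ι k x) :=
  antiInv_ι_mul (by rw [LinearMap.neg_apply, hx, boolSign_not, neg_smul]) a

lemma J_J (a : TensorAlgebra k C) : X.J (X.J a) = a := antiInv_antiInv X.neg_ε_comp a

variable {X} in
lemma par_ι_pure {x : C} {b : Bool} (hx : X.ε x = boolSign k b • x) (c : Bool) :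
    X.par c (ι k x) = boolSign k (c && !b) • ι k x := by
  rw [par_ι, twist_neg_ε, twist_pure hx, smul_smul, map_smul]
  cases b <;> cases c <;> simp

/-- Reversing `x' x''` amounts to flipping `x' ⊗ x''`, which leaves `Δ x` unchanged by
cocommutativity; the minus sign comes from the two desuspensions. -/
lemma J_quad_mul {x : C} {b : Bool} (hx : X.ε x = boolSign k b • x) (a : TensorAlgebra k C) :
    X.J (X.quad (X.Δ x) * a) = -(X.par b (X.J a) * X.quad (X.Δ x)) := by
  -- The sign for passing `a` depends only on the total parity of the two tensor factors. Splitting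
  -- by that parity makes the right side a linear map on all of `C ⊗ C`, to which `Δ x` can be
  -- supplied.
  let V : C ⊗[k] C →ₗ[k] TensorAlgebra k C := ∑ c : Bool,
    (LinearMap.mulLeft k (X.par c (X.J a)) ∘ₗ X.quad) ∘ₗ
      parityProj (TensorProduct.map X.ε X.ε) c
  have hV : ∀ c y, TensorProduct.map X.ε X.ε y = boolSign k c • y →
      V y = X.par c (X.J a) * X.quad y := fun c y hy => by
    simp only [V, LinearMap.sum_apply]
    exact sum_parityProj_pure hy fun c => LinearMap.mulLeft k (X.par c (X.J a)) ∘ₗ X.quad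
  have h : (X.J ∘ₗ LinearMap.mulRight k a ∘ₗ X.quad) ∘ₗ koszulFlip X.ε = -V := by
    refine tensor_square_ext X.ε_comp_ε fun b c x y hx hy => ?_
    rw [LinearMap.neg_apply, hV (b ^^ c) (x ⊗ₜ y) (by
      rw [TensorProduct.map_tmul, hx, hy, TensorProduct.smul_tmul_smul, boolSign_xor])]
    simp only [LinearMap.comp_apply, koszulFlip_pure hx, twist_pure hy, quad_tmul, hx, hy,
      map_smul, LinearMap.mulRight_apply, smul_mul_assoc, mul_assoc, J_ι_mul hy, J_ι_mul hx,
      map_neg, map_mul, par_ι_pure hx, par_par, neg_mul, neg_neg, mul_smul_comm,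
      smul_smul]
    cases b <;> cases c <;> simp
  have h' := LinearMap.congr_fun h (X.Δ x)
  rw [LinearMap.comp_apply, koszulFlip_Δ, LinearMap.neg_apply,
    hV b _ (by rw [← X.Δ_ε, hx, map_smul])] at h'
  exact h'

lemma J_D (a : TensorAlgebra k C) : X.J (X.D a) = X.D (X.J a) := by
  have h := tensor_ext (f := X.J ∘ₗ X.D) (g := X.D ∘ₗ X.J) (span_homogeneous X.ε_comp_ε) (by simp)
    (fun x ⟨b, hx⟩ a ha => by
      have hd : X.ε (X.d x) = boolSign k (!b) • X.d x := by
        rw [← neg_inj, ← X.d_ε, hx, map_smul, boolSign_not, neg_smul, neg_neg]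
      simp only [LinearMap.comp_apply] at ha ⊢
      rw [D_ι_mul, map_sub, hx, map_smul, smul_mul_assoc, map_smul, J_ι_mul hx, J_ι_mul hx, ha,
        map_neg, D_mul, par_par, D_ι, cobarGen_eq, add_mul, map_add, J_quad_mul X hx, neg_mul,
        map_neg, J_ι_mul hd, X.par_D]
      cases b <;> simp [par_false, mul_add]
      · abel
      · abel)
  exact LinearMap.congr_fun h a

lemma J_permProj (a : TensorAlgebra k C) : X.J (X.permProj a) = X.permProj (X.J a) := by
  have h1 := antiInv_map X.neg_ε_comp (τ' := X.ρ) (φ := X.π)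
    (fun x => by simp [ρ, X.π_ε]) a
  have h2 := antiInv_map X.ρ_comp_ρ (τ' := -X.ε) (φ := X.incl)
    (fun x => by simp [ρ, X.ε_incl]) (permSum X.ρ (X.toTensors a))
  rw [antiInv_permSum X.ρ_comp_ρ] at h2
  exact h2.symm.trans (congrArg (fun t => X.ofTensors (permSum X.ρ t)) h1.symm)

variable {X} in
lemma J_mem_weightSpace {n : ℕ} {a : TensorAlgebra k C} (ha : a ∈ X.weightSpace n) :
    X.J a ∈ X.weightSpace n := by
  refine weight_induction (fun n => (X.weightSpace n).comap X.J)
    (by simpa using X.one_mem_weightSpace) (fun {c m n x a} hx ha => ?_) ha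
  rw [Submodule.mem_comap] at ha ⊢
  rw [J_ι_mul hx.pure, add_comm]
  exact Submodule.neg_mem _ (mul_mem_weightSpace (par_mem_weightSpace _ ha) hx.ι_mem)

lemma J_avgProj (a : TensorAlgebra k C) : X.J (X.avgProj a) = X.avgProj (X.J a) := by
  have h := X.ext_weight (f := X.J ∘ₗ X.avgProj) (g := X.avgProj ∘ₗ X.J) fun n a ha => by
    simp only [LinearMap.comp_apply, avgProj, byWeight_apply _ ha,
      byWeight_apply _ (J_mem_weightSpace ha), LinearMap.smul_apply, map_smul, J_permProj]
  exact LinearMap.congr_fun h a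

lemma J_mem_degSpace {G : ℤ → Submodule k M} (hG : IsGrading X G) {q : ℤ} {a : TensorAlgebra k C}
    (ha : a ∈ degSpace X G q) : X.J a ∈ degSpace X G q := by
  refine map_degSpace (fun w hw => ?_) ha
  clear ha
  induction hw with
  | one => rw [J_one]; exact one_mem_degSpace
  | mul hx _ ih =>
    obtain ⟨b, n, h⟩ := hx.isShuffle hG
    rw [J_ι_mul h.pure, add_comm]
    exact Submodule.neg_mem _ (mul_mem_degSpace (par_mem_degSpace hG _ ih) hx.ι_mem)

/-- The projection is `1` minus the anticommutator of `D` with `homotopy`, both of which are known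
to be graded. -/
lemma avgProj_mem_degSpace {G : ℤ → Submodule k M} (hG : IsGrading X G) {q : ℤ}
    {a : TensorAlgebra k C} (ha : a ∈ degSpace X G q) : X.avgProj a ∈ degSpace X G q := by
  have h : X.avgProj a = a - (X.D (X.homotopy a) + X.homotopy (X.D a)) := by
    rw [D_homotopy, sub_sub_cancel]
  rw [h]
  refine Submodule.sub_mem _ ha (Submodule.add_mem _ ?_ ?_)
  · simpa using D_mem_degSpace hG (homotopy_mem_degSpace hG ha)
  · simpa using homotopy_mem_degSpace hG (D_mem_degSpace hG ha)

namespace IsMorphism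

variable {X} {M' : Type*} [AddCommGroup M'] [Module k M'] {C' : Type*} [AddCommGroup C']
  [Module k C'] {Y : InsertionCoalgebra k M' C'} {φ : M →ₗ[k] M'} {ψ : C →ₗ[k] C'}
  (H : IsMorphism X Y φ ψ)

include H

lemma J (a : TensorAlgebra k C) : TensorAlgebra.lift k (ι k ∘ₗ ψ) (X.J a) =
    Y.J (TensorAlgebra.lift k (ι k ∘ₗ ψ) a) :=
  antiInv_map X.neg_ε_comp (fun x => by simp [H.ε]) a

lemma avgProj (a : TensorAlgebra k C) : TensorAlgebra.lift k (ι k ∘ₗ ψ) (X.avgProj a) =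
    Y.avgProj (TensorAlgebra.lift k (ι k ∘ₗ ψ) a) := by
  have h : ∀ a, X.avgProj a = a - (X.D (X.homotopy a) + X.homotopy (X.D a)) := fun a => by
    rw [D_homotopy, sub_sub_cancel]
  have h' : ∀ a, Y.avgProj a = a - (Y.D (Y.homotopy a) + Y.homotopy (Y.D a)) := fun a => by
    rw [D_homotopy, sub_sub_cancel]
  rw [h, h', map_sub, map_add, H.D, H.homotopy, H.homotopy, H.D]

end IsMorphism

/-- The contracting homotopy that satisfies the side conditions. -/
def contraction : Module.End k (TensorAlgebra k C) :=
  improve k X.D X.homotopy X.avgProj X.J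

/-- Idempotence is kept as a hypothesis, as it is immediate once the projection is identified with
`g f` and `f g = 1` is known. -/
lemma contraction_spec (hp : ∀ a, X.avgProj (X.avgProj a) = X.avgProj a) :
    (∀ a, X.D (X.contraction a) + X.contraction (X.D a) = a - X.avgProj a) ∧
      (∀ a, X.avgProj (X.contraction a) = 0) ∧ (∀ a, X.contraction (X.avgProj a) = 0) ∧
      (∀ a, X.contraction (X.contraction a) = 0) ∧
      ∀ a, X.J (X.contraction a) = X.contraction (X.J a) := by
  obtain ⟨h1, h2, h3, h4, h5⟩ := improve_spec (k := k)
    (A := Module.End k (TensorAlgebra k C)) (D := X.D) (h := X.homotopy) (p := X.avgProj) (J := X.J)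
    (LinearMap.ext X.D_D) (LinearMap.ext X.D_homotopy) (LinearMap.ext hp) (LinearMap.ext X.J_J)
    (LinearMap.ext X.J_D) (LinearMap.ext X.J_avgProj)
  exact ⟨LinearMap.congr_fun h1, LinearMap.congr_fun h2, LinearMap.congr_fun h3,
    LinearMap.congr_fun h4, LinearMap.congr_fun h5⟩

/-- The homotopy whose square with the differential in the middle is `contraction`. -/
def avgHomotopy (a : TensorAlgebra k C) : TensorAlgebra k C :=
  (2⁻¹ : k) • (X.homotopy (a - X.avgProj a) + X.J (X.homotopy (X.J (a - X.avgProj a)))) -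
    X.avgProj ((2⁻¹ : k) •
      (X.homotopy (a - X.avgProj a) + X.J (X.homotopy (X.J (a - X.avgProj a)))))

lemma contraction_apply (a : TensorAlgebra k C) :
    X.contraction a = X.avgHomotopy (X.D (X.avgHomotopy a)) := rfl

lemma avgHomotopy_mem_degSpace {G : ℤ → Submodule k M} (hG : IsGrading X G) {q : ℤ}
    {a : TensorAlgebra k C} (ha : a ∈ degSpace X G q) :
    X.avgHomotopy a ∈ degSpace X G (q - 1) := by
  have h1 := Submodule.sub_mem _ ha (X.avgProj_mem_degSpace hG ha)
  have h2 := Submodule.smul_mem _ (2⁻¹ : k) (Submodule.add_mem _ (homotopy_mem_degSpace hG h1)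
    (X.J_mem_degSpace hG (homotopy_mem_degSpace hG (X.J_mem_degSpace hG h1))))
  exact Submodule.sub_mem _ h2 (X.avgProj_mem_degSpace hG h2)

lemma contraction_mem_degSpace {G : ℤ → Submodule k M} (hG : IsGrading X G) {q : ℤ}
    {a : TensorAlgebra k C} (ha : a ∈ degSpace X G q) :
    X.contraction a ∈ degSpace X G (q - 1) := by
  have h := X.avgHomotopy_mem_degSpace hG (D_mem_degSpace hG (X.avgHomotopy_mem_degSpace hG ha))
  rwa [sub_add_cancel] at h

lemma IsMorphism.contraction {X} {M' : Type*} [AddCommGroup M'] [Module k M'] {C' : Type*}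
    [AddCommGroup C'] [Module k C'] {Y : InsertionCoalgebra k M' C'} {φ : M →ₗ[k] M'}
    {ψ : C →ₗ[k] C'} (H : IsMorphism X Y φ ψ) (a : TensorAlgebra k C) :
    TensorAlgebra.lift k (ι k ∘ₗ ψ) (X.contraction a) =
      Y.contraction (TensorAlgebra.lift k (ι k ∘ₗ ψ) a) := by
  rw [contraction_apply, contraction_apply]
  simp only [avgHomotopy, map_sub, map_smul, map_add, H.avgProj, H.homotopy, H.J, H.D]

end InsertionCoalgebra

end SymCobar
end

noncomputable section

namespace SymCobar

open TensorAlgebra (ι)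
open TensorPower (toTensorAlgebra)

/-! ### The reduced symmetric coalgebra inside the tensor algebra -/

section Insertion

variable {k : Type u} [Field k] [CharZero k] {M : Type*} [AddCommGroup M] [Module k M]
  {C : Type*} [AddCommGroup C] [Module k C]

/-- The behaviour of the reduced coproduct under the shuffle product with a vector, for a space of
tensors. -/
lemma comul_insertion {τ : M →ₗ[k] M} {v : M} {b : Bool} {I : C →ₗ[k] TensorAlgebra k M}
    {l t : C →ₗ[k] C} {Δ : C →ₗ[k] C ⊗[k] C} {u : C} (hI : Function.Injective I)
    (hv : τ v = boolSign k b • v)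
    (hl : ∀ c, I (l c) = insertion τ (I c) v) (ht : ∀ c, I (t c) = tensorTwist τ b (I c))
    (hu : I u = ι k v)
    (hΔ : ∀ c, TensorProduct.map I I (Δ c) = deconcat (I c) - 1 ⊗ₜ I c - I c ⊗ₜ 1) (c : C) :
    Δ (l c) = u ⊗ₜ c + t c ⊗ₜ u + (l.rTensor C (Δ c) + TensorProduct.map t l (Δ c)) := by
  have h1 : I ∘ₗ l = (insertion τ).flip v ∘ₗ I := LinearMap.ext hl
  have h2 : I ∘ₗ t = (tensorTwist τ b).toLinearMap ∘ₗ I := LinearMap.ext ht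
  have h3 : TensorProduct.map I I (l.rTensor C (Δ c)) =
      ((insertion τ).flip v).rTensor _ (TensorProduct.map I I (Δ c)) := by
    rw [map_rTensor_apply, rTensor_map_apply, h1]
  have h4 : TensorProduct.map I I (TensorProduct.map t l (Δ c)) =
      TensorProduct.map (tensorTwist τ b).toLinearMap ((insertion τ).flip v)
        (TensorProduct.map I I (Δ c)) := by
    rw [← LinearMap.comp_apply (TensorProduct.map I I), ← TensorProduct.map_comp, h1, h2,
      TensorProduct.map_comp, LinearMap.comp_apply]
  -- Over a field `I ⊗ I` remains injective, so the identity may be compared in the tensor algebra,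
  -- where it is `deconcat_insertion` without the two outer terms.
  apply TensorProduct.map_injective_of_flat_flat _ _ hI hI
  rw [map_add, map_add, map_add, h3, h4, hΔ, hΔ, hl, deconcat_insertion hv]
  simp only [TensorProduct.map_tmul, map_sub, hu, ht, LinearMap.rTensor_tmul,
    LinearMap.flip_apply, insertion_one, AlgHom.toLinearMap_apply, map_one]
  abel

end Insertion

section SymmetricCoalgebra

variable {k : Type u} [Field k] (V : CochainComplex (ModuleCat.{v} k) ℤ)

lemma totD_totD (v : Tot V) : totD V (totD V v) = 0 := by
  have h : totD V ∘ₗ totD V = 0 := by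
    refine DirectSum.linearMap_ext k fun p => LinearMap.ext fun x => ?_
    have := congrArg (fun f => f.hom x) (V.d_comp_d p (p + 1) (p + 1 + 1))
    simp only [ModuleCat.hom_comp, LinearMap.comp_apply, ModuleCat.hom_zero,
      LinearMap.zero_apply] at this
    simp [totD, this]
  exact LinearMap.congr_fun h v

/-- The embedding of the reduced symmetric coalgebra into the tensors. -/
def symTensors : SymCoalg V →ₗ[k] TensorAlgebra k (Tot V) :=
  DirectSum.toModule k ℕ _ fun n => toTensorAlgebra ∘ₗ (SymPow (-par V) (n + 1)).subtype

/-- The inclusion of `Symⁿ⁺¹(sV)` into the reduced symmetric coalgebra. -/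
def coalgOf (n : ℕ) : SymPow (-par V) (n + 1) →ₗ[k] SymCoalg V :=
  DirectSum.lof k ℕ (fun n => SymPow (-par V) (n + 1)) n

variable {V}

@[simp] lemma symTensors_coalgOf {n : ℕ} (c : SymPow (-par V) (n + 1)) :
    symTensors V (coalgOf V n c) = toTensorAlgebra (c : ⨂[k]^(n + 1) (Tot V)) := by
  simp [symTensors, coalgOf]

lemma symCoalg_ext {B : Type*} [AddCommMonoid B] [Module k B] {f g : SymCoalg V →ₗ[k] B}
    (h : ∀ n c, f (coalgOf V n c) = g (coalgOf V n c)) : f = g :=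
  DirectSum.linearMap_ext k fun n => LinearMap.ext (h n)

lemma component_coalgOf_self {n : ℕ} (c : SymPow (-par V) (n + 1)) :
    DirectSum.component k ℕ (fun n => SymPow (-par V) (n + 1)) n (coalgOf V n c) = c :=
  DirectSum.component.lof_self _ _ _

lemma component_coalgOf_ne {m n : ℕ} (h : m ≠ n) (c : SymPow (-par V) (m + 1)) :
    DirectSum.component k ℕ (fun n => SymPow (-par V) (n + 1)) n (coalgOf V m c) = 0 :=
  (DirectSum.component.of _ _ _ _).trans (dif_neg h)

/-- The embedding is injective because its component in each tensor power is the inclusion of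
symmetric tensors. It reduces the axioms of an insertion coalgebra to identities between tensors. -/
lemma symTensors_injective : Function.Injective (symTensors V) := by
  have h : ∀ n, DirectSum.component k ℕ (fun n => ⨂[k]^n (Tot V)) (n + 1) ∘ₗ
      TensorAlgebra.toDirectSum.toLinearMap ∘ₗ symTensors V =
      (SymPow (-par V) (n + 1)).subtype ∘ₗ
        DirectSum.component k ℕ (fun n => SymPow (-par V) (n + 1)) n := fun n => by
    refine symCoalg_ext fun m c => ?_
    rw [LinearMap.comp_apply, LinearMap.comp_apply, AlgHom.toLinearMap_apply, symTensors_coalgOf,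
      toDirectSum_toTensorAlgebra, LinearMap.comp_apply]
    rcases eq_or_ne m n with rfl | hmn
    · rw [component_coalgOf_self, ← DirectSum.lof_eq_of k, DirectSum.component.lof_self]
      rfl
    · rw [component_coalgOf_ne hmn, ← DirectSum.lof_eq_of k, DirectSum.component.of,
        dif_neg (by omega), map_zero]
  refine (injective_iff_map_eq_zero _).2 fun x hx => DirectSum.ext_component k fun n => ?_
  have := LinearMap.congr_fun (h n) x
  rw [LinearMap.comp_apply, LinearMap.comp_apply, hx, map_zero, map_zero, LinearMap.comp_apply] at this
  rw [map_zero]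
  exact Subtype.ext this.symm

lemma tprod_one (v : Tot V) (w : Fin 1 → Tot V) (h : w 0 = v) :
    toTensorAlgebra (PiTensorProduct.tprod k w) = ι k v := by
  rw [TensorPower.toTensorAlgebra_tprod, TensorAlgebra.tprod_apply]
  simp [h]

variable [CharZero k]

lemma mem_symPow_one {M : Type*} [AddCommGroup M] [Module k M] {τ : M →ₗ[k] M}
    (hτ : τ ∘ₗ τ = LinearMap.id) (t : ⨂[k]^1 M) : t ∈ SymPow τ 1 := fun σ => by
  rw [Subsingleton.elim σ 1, koszulAct_one hτ, LinearMap.id_apply]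

lemma inclGen_eq (v : Tot V) :
    inclGen V v = coalgOf V 0 (symProj (spar_spar V) (0 + 1)
      (PiTensorProduct.tprod k fun _ : Fin (0 + 1) => v)) := by
  rw [inclGen, LinearMap.comp_apply, LinearMap.comp_apply, LinearEquiv.coe_coe,
    PiTensorProduct.subsingletonEquiv_symm_apply']
  rfl

@[simp] lemma symTensors_inclGen (v : Tot V) : symTensors V (inclGen V v) = ι k v := by
  rw [inclGen_eq, symTensors_coalgOf]
  change toTensorAlgebra (symmetrizer (-par V) 1 _) = _
  rw [symmetrizer_of_mem (mem_symPow_one (spar_spar V) _), tprod_one v _ rfl]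

lemma symTensors_par (x : SymCoalg V) :
    symTensors V (symCoalgPar V x) = tensorTwist (-par V) true (symTensors V x) := by
  have h : symTensors V ∘ₗ symCoalgPar V =
      (tensorTwist (-par V) true).toLinearMap ∘ₗ symTensors V := symCoalg_ext fun n c => by
    have : symCoalgPar V (coalgOf V n c) =
        coalgOf V n (symMap (spar_spar V) (-par V) rfl (n + 1) c) := DirectSum.lmap_lof _ _ _
    rw [LinearMap.comp_apply, this, symTensors_coalgOf, LinearMap.comp_apply, symTensors_coalgOf]
    exact toTensorAlgebra_map _ _
  exact LinearMap.congr_fun h x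

lemma symTensors_twist (b : Bool) (x : SymCoalg V) :
    symTensors V (twist (symCoalgPar V) b x) = tensorTwist (-par V) b (symTensors V x) := by
  cases b
  · simp
  · exact symTensors_par x

lemma symTensors_d (x : SymCoalg V) :
    symTensors V (symCoalgD V x) = tensorDiff (-par V) (-totD V) (symTensors V x) := by
  have h : symTensors V ∘ₗ symCoalgD V =
      tensorDiff (-par V) (-totD V) ∘ₗ symTensors V := symCoalg_ext fun n c => by
    have : symCoalgD V (coalgOf V n c) =
        coalgOf V n (symD (spar_spar V) (stotD_spar V) (n + 1) c) := DirectSum.lmap_lof _ _ _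
    rw [LinearMap.comp_apply, this, symTensors_coalgOf, LinearMap.comp_apply, symTensors_coalgOf]
    exact toTensorAlgebra_tensorD _ _ _
  exact LinearMap.congr_fun h x

lemma symCoalgComul_coalgOf {n : ℕ} (c : SymPow (-par V) (n + 1)) :
    symCoalgComul V (coalgOf V n c) = ∑ i : Fin n,
      TensorProduct.map (coalgOf V (i : ℕ)) (coalgOf V (n - 1 - (i : ℕ)))
        (comulComp (spar_spar V)
          (show n + 1 = ((i : ℕ) + 1) + ((n - 1 - (i : ℕ)) + 1) by have := i.isLt; omega) c) := by
  rw [symCoalgComul, coalgOf, DirectSum.toModule_lof, LinearMap.sum_apply]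
  refine Finset.sum_congr rfl fun i _ => ?_
  rw [LinearMap.comp_apply]
  rfl

lemma symTensors_comul_coalgOf {n : ℕ} (c : SymPow (-par V) (n + 1)) :
    TensorProduct.map (symTensors V) (symTensors V) (symCoalgComul V (coalgOf V n c)) +
      1 ⊗ₜ toTensorAlgebra (c : ⨂[k]^(n + 1) (Tot V)) +
      toTensorAlgebra (c : ⨂[k]^(n + 1) (Tot V)) ⊗ₜ 1 =
      deconcat (toTensorAlgebra (c : ⨂[k]^(n + 1) (Tot V))) := by
  have h : ∀ m, symTensors V ∘ₗ coalgOf V m =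
      toTensorAlgebra ∘ₗ (SymPow (-par V) (m + 1)).subtype := fun m =>
    LinearMap.ext symTensors_coalgOf
  rw [deconcat_toTensorAlgebra, symCoalgComul_coalgOf, map_sum, add_assoc, add_comm]
  congr 1
  refine Finset.sum_congr rfl fun i _ => ?_
  rw [← comulComp_spec (spar_spar V), ← LinearMap.comp_apply (TensorProduct.map (symTensors V) _),
    ← LinearMap.comp_apply (TensorProduct.map toTensorAlgebra _), ← TensorProduct.map_comp,
    ← TensorProduct.map_comp, h, h]

/-- The reduced coproduct is full deconcatenation without the two trivial cuts; the projections in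
`comulComp` do nothing by `comulComp_spec`. -/
lemma symTensors_comul (x : SymCoalg V) :
    TensorProduct.map (symTensors V) (symTensors V) (symCoalgComul V x) =
      deconcat (symTensors V x) - 1 ⊗ₜ symTensors V x - symTensors V x ⊗ₜ 1 := by
  have h : TensorProduct.map (symTensors V) (symTensors V) ∘ₗ symCoalgComul V +
      TensorProduct.mk k _ _ 1 ∘ₗ symTensors V + (TensorProduct.mk k _ _).flip 1 ∘ₗ symTensors V =
      deconcat ∘ₗ symTensors V := by
    refine symCoalg_ext fun n c => ?_
    have h1 := symTensors_comul_coalgOf c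
    rw [← symTensors_coalgOf] at h1
    exact h1
  rw [eq_sub_iff_add_eq, eq_sub_iff_add_eq, add_right_comm]
  exact LinearMap.congr_fun h x

omit [CharZero k] in
lemma symTensors_map_injective :
    Function.Injective (TensorProduct.map (symTensors V) (symTensors V)) :=
  TensorProduct.map_injective_of_flat_flat _ _ symTensors_injective symTensors_injective

variable (V) in
/-- The shuffle product of a vector and a symmetric tensor. -/
def shuffleVec : Tot V →ₗ[k] SymCoalg V →ₗ[k] SymCoalg V :=
  (DirectSum.toModule k ℕ _ fun n =>
    (((tensorCons (n + 1)).compl₂ (SymPow (-par V) (n + 1)).subtype).compr₂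
      -- The factor `n + 2` turns the average into the sum over the `n + 2` positions where a vector
      -- can be inserted into a tensor of length `n + 1`.
      (((n + 1 + 1 : ℕ) : k) • coalgOf V (n + 1) ∘ₗ symProj (spar_spar V) (n + 1 + 1))).flip).flip

lemma shuffleVec_coalgOf {n : ℕ} (v : Tot V) (c : SymPow (-par V) (n + 1)) :
    shuffleVec V v (coalgOf V n c) = ((n + 1 + 1 : ℕ) : k) •
      coalgOf V (n + 1) (symProj (spar_spar V) (n + 1 + 1)
        (tensorCons (n + 1) v (c : ⨂[k]^(n + 1) (Tot V)))) := by
  rw [shuffleVec, coalgOf, LinearMap.flip_apply, DirectSum.toModule_lof]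
  rfl

@[simp] lemma symTensors_shuffleVec (v : Tot V) (c : SymCoalg V) :
    symTensors V (shuffleVec V v c) = insertion (-par V) (symTensors V c) v := by
  have h : symTensors V ∘ₗ shuffleVec V v = (insertion (-par V)).flip v ∘ₗ symTensors V :=
    symCoalg_ext fun n c => by
    rw [LinearMap.comp_apply, shuffleVec_coalgOf, map_smul, symTensors_coalgOf,
      LinearMap.comp_apply, symTensors_coalgOf, LinearMap.flip_apply,
      ← toTensorAlgebra_symmetrizer_tensorCons (spar_spar V) v c.2]
    rfl
  exact LinearMap.congr_fun h c

omit [CharZero k] in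
lemma projGen_coalgOf_succ {n : ℕ} (c : SymPow (-par V) (n + 1 + 1)) :
    projGen V (coalgOf V (n + 1) c) = 0 := by
  rw [projGen, LinearMap.comp_apply, LinearMap.comp_apply, component_coalgOf_ne n.succ_ne_zero,
    map_zero, map_zero]

lemma projGen_shuffleVec (v : Tot V) (c : SymCoalg V) : projGen V (shuffleVec V v c) = 0 := by
  have h : projGen V ∘ₗ shuffleVec V v = 0 := symCoalg_ext fun n c => by
    rw [LinearMap.comp_apply, shuffleVec_coalgOf, map_smul, projGen_coalgOf_succ, smul_zero,
      LinearMap.zero_apply]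
  exact LinearMap.congr_fun h c

lemma projGen_inclGen (v : Tot V) : projGen V (inclGen V v) = v := by
  rw [inclGen_eq, projGen, LinearMap.comp_apply, LinearMap.comp_apply, component_coalgOf_self]
  exact (congrArg (PiTensorProduct.subsingletonEquiv (0 : Fin 1))
    (symmetrizer_of_mem (mem_symPow_one (spar_spar V) _))).trans
      (PiTensorProduct.subsingletonEquiv_apply_tprod _ _)

lemma inclGen_zero (w : Fin (0 + 1) → Tot V) : inclGen V (w 0) =
    coalgOf V 0 (symProj (spar_spar V) (0 + 1) (PiTensorProduct.tprod k w)) := by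
  rw [inclGen_eq, show (fun _ : Fin (0 + 1) => w 0) = w from
    funext fun i => congrArg w (Subsingleton.elim (α := Fin 1) 0 i)]

lemma shuffleVec_tail {n : ℕ} (w : Fin (n + 1 + 1) → Tot V) : shuffleVec V (w 0)
    (coalgOf V n (symProj (spar_spar V) (n + 1) (PiTensorProduct.tprod k (Fin.tail w)))) =
      ((n + 1 + 1 : ℕ) : k) • coalgOf V (n + 1)
        (symProj (spar_spar V) (n + 1 + 1) (PiTensorProduct.tprod k w)) := by
  rw [shuffleVec_coalgOf]
  congr 2
  refine Subtype.ext ((symmetrizer_tensorCons (spar_spar V) _ _).trans ?_)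
  rw [tensorCons_tprod, Fin.cons_self_tail]
  rfl

/-- A symmetric tensor is its own average, hence a combination of averages of pure tensors. By
`shuffleVec_tail` each of these is an iterated shuffle up to a positive integer factor, invertible
in characteristic zero. -/
lemma symCoalg_generated (S : Submodule k (SymCoalg V)) (h0 : ∀ v, inclGen V v ∈ S)
    (hL : ∀ v, ∀ c ∈ S, shuffleVec V v c ∈ S) (c : SymCoalg V) : c ∈ S := by
  have key : ∀ n (t : ⨂[k]^(n + 1) (Tot V)),
      coalgOf V n (symProj (spar_spar V) (n + 1) t) ∈ S := fun n => by
    induction n with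
    | zero =>
      intro t
      induction t using PiTensorProduct.induction_on with
      | smul_tprod r w =>
        have h1 := h0 (w 0)
        rw [inclGen_zero] at h1
        rw [map_smul, map_smul]
        exact S.smul_mem _ h1
      | add a b ha hb => rw [map_add, map_add]; exact S.add_mem ha hb
    | succ n ih =>
      intro t
      induction t using PiTensorProduct.induction_on with
      | smul_tprod r w =>
        have h1 := hL (w 0) _ (ih (PiTensorProduct.tprod k (Fin.tail w)))
        rw [shuffleVec_tail] at h1
        have h3 := S.smul_mem ((n + 1 + 1 : ℕ) : k)⁻¹ h1
        rw [inv_smul_smul₀ (by exact_mod_cast (n + 1).succ_ne_zero)] at h3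
        rw [map_smul, map_smul]
        exact S.smul_mem _ h3
      | add a b ha hb => rw [map_add, map_add]; exact S.add_mem ha hb
  induction c using DirectSum.induction_on with
  | zero => exact S.zero_mem
  | of n c =>
    have := key n c
    rwa [symProj_of_mem] at this
  | add a b ha hb => exact S.add_mem ha hb

variable (V) in
/-- The polynomial that records the components of an element of the symmetric coalgebra. -/
def symWeight : SymCoalg V →ₗ[k] Polynomial (CobarSym V) :=
  DirectSum.toModule k ℕ _ fun n =>
    (Polynomial.monomial (n + 1)).restrictScalars k ∘ₗ ι k ∘ₗ coalgOf V n

omit [CharZero k] in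
lemma symWeight_coalgOf {n : ℕ} (c : SymPow (-par V) (n + 1)) :
    symWeight V (coalgOf V n c) = Polynomial.monomial (n + 1) (ι k (coalgOf V n c)) := by
  rw [symWeight, coalgOf, DirectSum.toModule_lof]
  rfl

omit [CharZero k] in
lemma symWeight_coeff (c : SymCoalg V) (n : ℕ) : (symWeight V c).coeff (n + 1) = ι k (coalgOf V n
    (DirectSum.component k ℕ (fun n => SymPow (-par V) (n + 1)) n c)) := by
  have h : (Polynomial.lcoeff (CobarSym V) (n + 1)).restrictScalars k ∘ₗ symWeight V =
      ι k ∘ₗ coalgOf V n ∘ₗ DirectSum.component k ℕ (fun n => SymPow (-par V) (n + 1)) n :=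
    symCoalg_ext fun m c => by
    rw [LinearMap.comp_apply, symWeight_coalgOf, LinearMap.coe_restrictScalars,
      Polynomial.lcoeff_apply, Polynomial.coeff_monomial, LinearMap.comp_apply,
      LinearMap.comp_apply]
    rcases eq_or_ne m n with rfl | hmn
    · rw [if_pos rfl]
      rw [component_coalgOf_self]
    · rw [if_neg (by omega), component_coalgOf_ne hmn, map_zero, map_zero]
  exact LinearMap.congr_fun h c

lemma symWeight_shuffleVec (v : Tot V) (c : SymCoalg V) (n : ℕ)
    (hc : symWeight V c = Polynomial.monomial n (ι k c)) :
    symWeight V (shuffleVec V v c) = Polynomial.monomial (n + 1) (ι k (shuffleVec V v c)) := by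
  have h : ∀ m, m + 1 ≠ n →
      DirectSum.component k ℕ (fun n => SymPow (-par V) (n + 1)) m c = 0 := fun m hm => by
    have h1 := symWeight_coeff c m
    rw [hc, Polynomial.coeff_monomial, if_neg (Ne.symm hm)] at h1
    have h2 := congrArg (DirectSum.component k ℕ (fun n => SymPow (-par V) (n + 1)) m)
      ((TensorAlgebra.ι_eq_zero_iff k _).1 h1.symm)
    rwa [component_coalgOf_self, map_zero] at h2
  rcases n with _ | n
  -- All components have weight at least one, so weight zero forces `c = 0`.
  · rw [show c = 0 from DirectSum.ext_component k fun m => by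
      rw [h m m.succ_ne_zero, map_zero]]
    simp
  · have : c = coalgOf V n (DirectSum.component k ℕ (fun n => SymPow (-par V) (n + 1)) n c) := by
      refine DirectSum.ext_component k fun m => ?_
      rcases eq_or_ne m n with rfl | hmn
      · rw [component_coalgOf_self]
      · rw [h m (by omega), component_coalgOf_ne hmn.symm]
    rw [this, shuffleVec_coalgOf, map_smul, symWeight_coalgOf, map_smul]
    simp

lemma symCoalgComul_shuffleVec {v : Tot V} {b : Bool} (hv : (-par V) v = boolSign k b • v)
    (c : SymCoalg V) :
    symCoalgComul V (shuffleVec V v c) = inclGen V v ⊗ₜ c +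
      twist (M := SymCoalg V) (symCoalgPar V) b c ⊗ₜ inclGen V v +
      ((shuffleVec V v).rTensor (SymCoalg V) (symCoalgComul V c) +
        TensorProduct.map (twist (M := SymCoalg V) (symCoalgPar V) b) (shuffleVec V v)
          (symCoalgComul V c)) :=
  comul_insertion (C := SymCoalg V) (M := Tot V) (τ := -par V) (v := v) (b := b)
    (I := symTensors V) (l := shuffleVec V v)
    (t := twist (M := SymCoalg V) (symCoalgPar V) b) (Δ := symCoalgComul V) (u := inclGen V v)
    (symTensors_injective (V := V)) hv (symTensors_shuffleVec (V := V) v)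
    (symTensors_twist (V := V) b) (symTensors_inclGen (V := V) v) (symTensors_comul (V := V)) c

end SymmetricCoalgebra

end SymCobar
end

noncomputable section

namespace SymCobar

open TensorAlgebra (ι)
open TensorPower (toTensorAlgebra)

/-! ### The symmetric coalgebra as an insertion coalgebra -/

section SymmetricCoalgebra

variable {k : Type u} [Field k] [CharZero k] (V : CochainComplex (ModuleCat.{v} k) ℤ)

/-- The reduced symmetric coalgebra of the suspension of a complex. -/
def symInsertion : InsertionCoalgebra k (Tot V) (SymCoalg V) where
  σ := -par V
  δ := -totD V
  ε := symCoalgPar V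
  d := symCoalgD V
  Δ := symCoalgComul V
  incl := inclGen V
  π := projGen V
  L := shuffleVec V
  wt := symWeight V
  σ_comp_σ := spar_spar V
  δ_comp_σ := stotD_spar V
  δ_δ v := by simp [totD_totD]
  ε_incl v := symTensors_injective (by rw [symTensors_par]; simp)
  ε_L v c := by
    have h := ext_homogeneous (spar_spar V) (f := (shuffleVec V).compr₂ (symCoalgPar V))
      (g := (shuffleVec V).compl₁₂ (-par V) (symCoalgPar V)) fun b v hv =>
        LinearMap.ext fun c => symTensors_injective (by
          rw [LinearMap.compr₂_apply, LinearMap.compl₁₂_apply, symTensors_par,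
            symTensors_shuffleVec, tensorTwist_insertion (spar_spar V) true hv, hv,
            symTensors_shuffleVec, symTensors_par, map_smul, Bool.and_true])
    exact LinearMap.congr_fun₂ h v c
  d_incl v := symTensors_injective (by rw [symTensors_d]; simp)
  d_L hv c := symTensors_injective (by
    rw [symTensors_d, map_add, map_smul, symTensors_shuffleVec, symTensors_shuffleVec,
      symTensors_shuffleVec, symTensors_d, tensorDiff_insertion (spar_spar V) (stotD_spar V) hv])
  Δ_incl v := symTensors_map_injective (by
    rw [symTensors_comul, map_zero, symTensors_inclGen]
    have := deconcat_ι_mul v (1 : TensorAlgebra k (Tot V))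
    rw [mul_one] at this
    simp [this])
  Δ_L {b v} hv c := symCoalgComul_shuffleVec (V := V) (v := v) (b := b) hv c
  π_incl := projGen_inclGen
  π_L := projGen_shuffleVec
  L_comm hv w c := symTensors_injective (by
    simp only [symTensors_shuffleVec]
    exact insertion_comm (spar_spar V) hv w _)
  L_incl_comm hv w := symTensors_injective (by
    simp only [symTensors_shuffleVec, symTensors_inclGen]
    -- A vector is its own insertion into the empty tensor, so this is commutativity of insertions
    -- applied to `1`.
    rw [← insertion_one (-par V), ← insertion_one (-par V)]
    exact insertion_comm (spar_spar V) hv w _)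
  wt_incl v := symWeight_coalgOf _
  wt_L := symWeight_shuffleVec
  generated := symCoalg_generated

end SymmetricCoalgebra

end SymCobar
end

noncomputable section

namespace SymCobar

open TensorAlgebra (ι)
open TensorPower (toTensorAlgebra)

namespace InsertionCoalgebra

variable {k : Type u} [Field k] [CharZero k] {M : Type v} [AddCommGroup M] [Module k M]
  {C : Type w} [AddCommGroup C] [Module k C] (X : InsertionCoalgebra k M C)

lemma toTensors_ofTensors (t : TensorAlgebra k M) : X.toTensors (X.ofTensors t) = t := by
  have h : X.toTensors.comp X.ofTensors = AlgHom.id k _ := by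
    ext v
    simp [X.π_incl]
  exact DFunLike.congr_fun h t

lemma D_ofTensors (t : TensorAlgebra k M) :
    X.D (X.ofTensors t) = X.ofTensors (tensorDiff X.ρ (-X.δ) t) := by
  have h := tensor_ext' (f := X.D ∘ₗ X.ofTensors.toLinearMap)
    (g := X.ofTensors.toLinearMap ∘ₗ tensorDiff X.ρ (-X.δ)) (by simp) (fun v t ht => by
      simp only [LinearMap.comp_apply, AlgHom.toLinearMap_apply] at ht ⊢
      rw [map_mul, ofTensors_ι, D_ι_mul, ht, tensorDiff_ι_mul, cobarGen_eq, X.Δ_incl, X.d_incl,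
        X.ε_incl]
      simp [ρ, sub_eq_add_neg])
  exact LinearMap.congr_fun h t

lemma avgProj_eq {n : ℕ} {a : TensorAlgebra k C} (ha : a ∈ X.weightSpace n) {t : ⨂[k]^n M}
    (ht : toTensorAlgebra t = X.toTensors a) :
    X.avgProj a = X.ofTensors (toTensorAlgebra (symmetrizer X.ρ n t)) := by
  have hn : (n.factorial : k) ≠ 0 := by exact_mod_cast n.factorial_ne_zero
  rw [avgProj, byWeight_apply _ ha, LinearMap.smul_apply, permProj, LinearMap.comp_apply,
    LinearMap.comp_apply, AlgHom.toLinearMap_apply, AlgHom.toLinearMap_apply, ← ht,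
    permSum_toTensorAlgebra X.ρ_comp_ρ, map_smul, inv_smul_smul₀ hn]

end InsertionCoalgebra

/-! ### The maps `f` and `g`, and the identification of `g f` -/

section SymmetricAlgebra

variable {k : Type u} [Field k] [CharZero k] (V : CochainComplex (ModuleCat.{v} k) ℤ)

lemma symInsertion_ρ : (symInsertion V).ρ = par V := neg_neg _

lemma symInsertion_δ : -(symInsertion V).δ = totD V := neg_neg _

variable {V}

lemma symAlg_ext {B : Type*} [AddCommMonoid B] [Module k B] {f g : SymAlg V →ₗ[k] B}
    (h : ∀ n x, f (symOf V n x) = g (symOf V n x)) : f = g :=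
  DirectSum.linearMap_ext k fun n => LinearMap.ext (h n)

lemma symAvg_toTensorAlgebra {n : ℕ} (t : ⨂[k]^n (Tot V)) :
    symAvg V (TensorAlgebra.toDirectSum (toTensorAlgebra t)) =
      symOf V n (symProj (par_par V) n t) := by
  rw [toDirectSum_toTensorAlgebra, symAvg_of]

lemma symAvg_ι (v : Tot V) : symAvg V (TensorAlgebra.toDirectSum (ι k v)) = symι V v := by
  rw [← tprod_one v (fun _ => v) rfl, symAvg_toTensorAlgebra, symι, LinearMap.comp_apply,
    LinearMap.comp_apply, LinearEquiv.coe_coe, PiTensorProduct.subsingletonEquiv_symm_apply']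

/-- The product of `E(V)` is the symmetrized tensor product, so averaging is multiplicative
(`symAvg_mul`). Symmetrizing once at the end therefore agrees with multiplying letter by letter in
`E(V)`. -/
lemma fMap_apply (a : CobarSym V) :
    fMap V a = symAvg V (TensorAlgebra.toDirectSum ((symInsertion V).toTensors a)) := by
  have h : (fMap V).toLinearMap = symAvg V ∘ₗ TensorAlgebra.toDirectSum.toLinearMap ∘ₗ
      (symInsertion V).toTensors.toLinearMap := by
    refine tensor_ext' (C := SymCoalg V) ?_ fun x a ha => ?_
    · change fMap V 1 = symAvg V (TensorAlgebra.toDirectSum ((symInsertion V).toTensors 1))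
      rw [map_one, map_one, map_one, SymAlg.one_def]
    · simp only [LinearMap.comp_apply, AlgHom.toLinearMap_apply] at ha ⊢
      rw [map_mul, map_mul, map_mul, ← symAvg_mul, ha, InsertionCoalgebra.toTensors_ι, symAvg_ι,
        fMap, TensorAlgebra.lift_ι_apply]
      rfl
  exact LinearMap.congr_fun h a

lemma gMap_apply (x : SymAlg V) :
    gMap V x = (symInsertion V).ofTensors (TensorAlgebra.ofDirectSum (symIncl V x)) := rfl

lemma fMap_gMap (x : SymAlg V) : fMap V (gMap V x) = x := by
  rw [fMap_apply, gMap_apply, InsertionCoalgebra.toTensors_ofTensors,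
    TensorAlgebra.toDirectSum_ofDirectSum, symAvg_symIncl]

lemma gMap_symOf {n : ℕ} (x : SymPow (par V) n) :
    gMap V (symOf V n x) = (symInsertion V).ofTensors (toTensorAlgebra (x : ⨂[k]^n (Tot V))) := by
  rw [gMap_apply, symIncl_symOf, ofDirectSum_of]

/-- In weight `n` both sides keep the words of `n` vectors and average over their orders. -/
lemma gMap_fMap (a : CobarSym V) : gMap V (fMap V a) = (symInsertion V).avgProj a := by
  have h : gMap V ∘ₗ (fMap V).toLinearMap = (symInsertion V).avgProj := by
    refine (symInsertion V).ext_weight fun n a ha => ?_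
    obtain ⟨t, ht⟩ := (symInsertion V).toTensors_mem_range ha
    rw [LinearMap.comp_apply, AlgHom.toLinearMap_apply, fMap_apply, ← ht, symAvg_toTensorAlgebra,
      gMap_symOf, (symInsertion V).avgProj_eq ha ht, symInsertion_ρ]
    rfl
  exact LinearMap.congr_fun h a

variable (V) in
/-- The average of tensors divided by the order of the symmetric group. -/
def scaledAvg : (⨁ n : ℕ, ⨂[k]^n (Tot V)) →ₗ[k] SymAlg V :=
  DirectSum.lmap fun n => (n.factorial : k)⁻¹ • symProj (par_par V) n

lemma scaledAvg_of {n : ℕ} (t : ⨂[k]^n (Tot V)) :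
    scaledAvg V (DirectSum.of (fun n => ⨂[k]^n (Tot V)) n t) =
      (n.factorial : k)⁻¹ • symOf V n (symProj (par_par V) n t) := by
  rw [← map_smul]
  exact DirectSum.lmap_lof (R := k) (fun n => (n.factorial : k)⁻¹ • symProj (par_par V) n) n t

/-- The average of a tensor depends only on the sum of its permutations. This lets
`permSum_toTensors_D`, an identity that holds only after summing over permutations, be used for `f`.
-/
lemma symAvg_toDirectSum (t : TensorAlgebra k (Tot V)) :
    symAvg V (TensorAlgebra.toDirectSum t) =
      scaledAvg V (TensorAlgebra.toDirectSum (permSum (par V) t)) := by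
  have h := ext_toTensorAlgebra (f := symAvg V ∘ₗ TensorAlgebra.toDirectSum.toLinearMap)
    (g := scaledAvg V ∘ₗ TensorAlgebra.toDirectSum.toLinearMap ∘ₗ permSum (par V)) fun n t => by
    have hn : (n.factorial : k) ≠ 0 := by exact_mod_cast n.factorial_ne_zero
    have h1 : symProj (par_par V) n (symmetrizer (par V) n t) = symProj (par_par V) n t :=
      symProj_of_mem (par_par V) (symProj (par_par V) n t)
    rw [LinearMap.comp_apply, AlgHom.toLinearMap_apply, symAvg_toTensorAlgebra,
      LinearMap.comp_apply, LinearMap.comp_apply, AlgHom.toLinearMap_apply,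
      permSum_toTensorAlgebra (par_par V), map_smul, map_smul, toDirectSum_toTensorAlgebra,
      scaledAvg_of, h1, smul_inv_smul₀ hn]
  exact LinearMap.congr_fun h t

lemma symmetrizer_tensorD {M : Type*} [AddCommGroup M] [Module k M] {τ δ : M →ₗ[k] M}
    (hτ : τ ∘ₗ τ = LinearMap.id) (hδ : δ ∘ₗ τ = -(τ ∘ₗ δ)) {n : ℕ} (t : ⨂[k]^n M) :
    symmetrizer τ n (tensorD τ δ n t) = tensorD τ δ n (symmetrizer τ n t) := by
  simp only [symmetrizer, LinearMap.smul_apply, LinearMap.sum_apply, map_smul, map_sum,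
    fun σ => LinearMap.congr_fun (koszulAct_tensorD hτ hδ (n := n) σ) t, LinearMap.comp_apply,
    ← LinearMap.comp_apply (koszulAct τ _)]

lemma symAlgD_symOf {n : ℕ} (x : SymPow (par V) n) :
    symAlgD V (symOf V n x) = symOf V n (symD (par_par V) (totD_par V) n x) :=
  DirectSum.lmap_lof (R := k) (fun n => symD (par_par V) (totD_par V) n) n x

lemma symAvg_tensorDiff (t : TensorAlgebra k (Tot V)) :
    symAvg V (TensorAlgebra.toDirectSum (tensorDiff (par V) (totD V) t)) =
      symAlgD V (symAvg V (TensorAlgebra.toDirectSum t)) := by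
  have h := ext_toTensorAlgebra
    (f := symAvg V ∘ₗ TensorAlgebra.toDirectSum.toLinearMap ∘ₗ tensorDiff (par V) (totD V))
    (g := symAlgD V ∘ₗ symAvg V ∘ₗ TensorAlgebra.toDirectSum.toLinearMap) fun n t => by
    rw [LinearMap.comp_apply, LinearMap.comp_apply, LinearMap.comp_apply, LinearMap.comp_apply,
      AlgHom.toLinearMap_apply, AlgHom.toLinearMap_apply, ← toTensorAlgebra_tensorD,
      symAvg_toTensorAlgebra, symAvg_toTensorAlgebra, symAlgD_symOf]
    exact congrArg (symOf V n) (Subtype.ext (symmetrizer_tensorD (par_par V) (totD_par V) t))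
  exact LinearMap.congr_fun h t

lemma fMap_D (a : CobarSym V) : fMap V (cobarSymD V a) = symAlgD V (fMap V a) := by
  have h := (symInsertion V).permSum_toTensors_D a
  rw [symInsertion_ρ, symInsertion_δ] at h
  rw [fMap_apply, fMap_apply, ← symAvg_tensorDiff, symAvg_toDirectSum, symAvg_toDirectSum, ← h]
  rfl

lemma ofDirectSum_symIncl_symAlgD (x : SymAlg V) :
    TensorAlgebra.ofDirectSum (symIncl V (symAlgD V x)) =
      tensorDiff (par V) (totD V) (TensorAlgebra.ofDirectSum (symIncl V x)) := by
  have h := symAlg_ext (f := TensorAlgebra.ofDirectSum.toLinearMap ∘ₗ symIncl V ∘ₗ symAlgD V)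
    (g := tensorDiff (par V) (totD V) ∘ₗ TensorAlgebra.ofDirectSum.toLinearMap ∘ₗ symIncl V)
    fun n x => by
    rw [LinearMap.comp_apply, LinearMap.comp_apply, LinearMap.comp_apply, LinearMap.comp_apply,
      AlgHom.toLinearMap_apply, AlgHom.toLinearMap_apply, symAlgD_symOf, symIncl_symOf,
      symIncl_symOf, ofDirectSum_of, ofDirectSum_of, ← toTensorAlgebra_tensorD]
    rfl
  exact LinearMap.congr_fun h x

lemma gMap_symAlgD (x : SymAlg V) : gMap V (symAlgD V x) = cobarSymD V (gMap V x) := by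
  have h := (symInsertion V).D_ofTensors (TensorAlgebra.ofDirectSum (symIncl V x))
  rw [symInsertion_ρ, symInsertion_δ, ← ofDirectSum_symIncl_symAlgD] at h
  exact h.symm

lemma cobarSymD_cobarSymD (a : CobarSym V) : cobarSymD V (cobarSymD V a) = 0 :=
  (symInsertion V).D_D a

/-- Since `f g = 1` and `f` is a chain map, `E(V)` inherits square zero from `A(V)`. -/
lemma symAlgD_symAlgD (x : SymAlg V) : symAlgD V (symAlgD V x) = 0 := by
  rw [← fMap_gMap x, ← fMap_D, ← fMap_D, cobarSymD_cobarSymD, map_zero]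

end SymmetricAlgebra

end SymCobar
end

noncomputable section

namespace SymCobar

open TensorAlgebra (ι)
open TensorPower (toTensorAlgebra)

/-! ### Morphisms of complexes -/

section Naturality

lemma insertion_map {k : Type*} [Field k] [CharZero k] {M N : Type*} [AddCommGroup M] [Module k M]
    [AddCommGroup N] [Module k N] {τ : M →ₗ[k] M} (hτ : τ ∘ₗ τ = LinearMap.id) {τ' : N →ₗ[k] N}
    {φ : M →ₗ[k] N} (hφ : φ ∘ₗ τ = τ' ∘ₗ φ) (t : TensorAlgebra k M) (v : M) :
    TensorAlgebra.lift k (ι k ∘ₗ φ) (insertion τ t v) =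
      insertion τ' (TensorAlgebra.lift k (ι k ∘ₗ φ) t) (φ v) := by
  suffices h : (insertion τ).flip.compr₂ (TensorAlgebra.lift k (ι k ∘ₗ φ)).toLinearMap =
      (insertion τ').flip.compl₁₂ φ (TensorAlgebra.lift k (ι k ∘ₗ φ)).toLinearMap from
    LinearMap.congr_fun₂ h v t
  refine ext_homogeneous hτ fun b v hv => tensor_ext' (by simp) fun x t ht => ?_
  simp only [LinearMap.compr₂_apply, LinearMap.flip_apply, LinearMap.compl₁₂_apply,
    AlgHom.toLinearMap_apply] at ht ⊢
  rw [insertion_ι_mul hv, map_mul, TensorAlgebra.lift_ι_apply, LinearMap.comp_apply,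
    insertion_ι_mul (pure_map hφ hv), map_add, map_mul, map_mul, map_mul, ht]
  simp [twist_map (LinearMap.congr_fun hφ)]

variable {k : Type u} [Field k] [CharZero k] {V W : CochainComplex (ModuleCat.{v} k) ℤ} (φ : V ⟶ W)

omit [CharZero k] in
lemma totMap_totD (v : Tot V) : totMap φ (totD V v) = totD W (totMap φ v) := by
  have h : totMap φ ∘ₗ totD V = totD W ∘ₗ totMap φ := by
    refine DirectSum.linearMap_ext k fun p => LinearMap.ext fun x => ?_
    have := congrArg (fun f => f.hom x) (φ.comm p (p + 1))
    simp only [ModuleCat.hom_comp, LinearMap.comp_apply] at this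
    simp [totMap, totD, this]
  exact LinearMap.congr_fun h v

lemma symTensors_symCoalgMap (x : SymCoalg V) :
    symTensors W (symCoalgMap φ x) =
      TensorAlgebra.lift k (ι k ∘ₗ totMap φ) (symTensors V x) := by
  have h : symTensors W ∘ₗ symCoalgMap φ =
      (TensorAlgebra.lift k (ι k ∘ₗ totMap φ)).toLinearMap ∘ₗ symTensors V :=
    symCoalg_ext fun n c => by
    have : symCoalgMap φ (coalgOf V n c) =
        coalgOf W n (symMap (spar_spar V) (totMap φ) (totMap_spar φ) (n + 1) c) :=
      DirectSum.lmap_lof _ _ _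
    rw [LinearMap.comp_apply, this, symTensors_coalgOf, LinearMap.comp_apply, symTensors_coalgOf]
    exact toTensorAlgebra_map _ _
  exact LinearMap.congr_fun h x

lemma symInsertion_isMorphism :
    InsertionCoalgebra.IsMorphism (symInsertion V) (symInsertion W) (totMap φ) (symCoalgMap φ) where
  σ := LinearMap.congr_fun (totMap_spar φ)
  δ v := (map_neg (totMap φ) _).trans (congrArg Neg.neg (totMap_totD φ v))
  incl v := symTensors_injective (by
    change symTensors W (symCoalgMap φ (inclGen V v)) = symTensors W (inclGen W (totMap φ v))
    rw [symTensors_symCoalgMap, symTensors_inclGen, symTensors_inclGen,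
      TensorAlgebra.lift_ι_apply, LinearMap.comp_apply])
  L v c := symTensors_injective (by
    change symTensors W (symCoalgMap φ (shuffleVec V v c)) =
      symTensors W (shuffleVec W (totMap φ v) (symCoalgMap φ c))
    rw [symTensors_symCoalgMap, symTensors_shuffleVec, symTensors_shuffleVec,
      symTensors_symCoalgMap, insertion_map (spar_spar V) (totMap_spar φ)])

end Naturality

namespace InsertionCoalgebra

variable {k : Type u} [Field k] [CharZero k] {M : Type v} [AddCommGroup M] [Module k M]
  {C : Type w} [AddCommGroup C] [Module k C] {X : InsertionCoalgebra k M C}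
  {G : ℤ → Submodule k M}

lemma tprod_mem_degSpace {n : ℕ} {a : Fin n → ℤ} {x : Fin n → C}
    (hx : ∀ i, ι k (x i) ∈ degSpace X G (a i)) :
    TensorAlgebra.tprod k C n x ∈ degSpace X G (∑ i, a i) := by
  induction n with
  | zero => rw [tprod_zero]; exact one_mem_degSpace
  | succ n ih =>
    rw [← Fin.cons_self_tail x, tprod_cons, Fin.sum_univ_succ]
    exact mul_mem_degSpace (hx 0) (ih fun i => hx i.succ)

lemma IsDegWord.exists_tprod {q : ℤ} {t : TensorAlgebra k C} (ht : IsDegWord X G q t) :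
    ∃ (n : ℕ) (a : Fin n → ℤ) (x : Fin n → C), (∀ i, IsDegShuffle X G (a i) (x i)) ∧
      ∑ i, a i = q ∧ t = TensorAlgebra.tprod k C n x := by
  induction ht with
  | one => exact ⟨0, Fin.elim0, Fin.elim0, fun i => i.elim0, by simp, (tprod_zero _).symm⟩
  | @mul p q x t hx _ ih =>
    obtain ⟨n, a, y, hy, ha, rfl⟩ := ih
    refine ⟨n + 1, Fin.cons p a, Fin.cons x y, fun i => ?_, ?_, (tprod_cons _ _).symm⟩
    · refine Fin.cases ?_ (fun i => ?_) i
      · exact hx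
      · exact hy i
    · simp [Fin.sum_univ_succ, ha]

end InsertionCoalgebra

/-! ### The grading of the cobar construction by degrees of shuffles -/

section Degree

variable {k : Type u} [Field k] (V : CochainComplex (ModuleCat.{v} k) ℤ)

/-- The elements of degree `p` of the total space. -/
def totDeg (p : ℤ) : Submodule k (Tot V) := LinearMap.range (DirectSum.lof k ℤ (fun p => V.X p) p)

/-- The tensors of vectors of `V` that have degree `q` as tensors of the suspension. -/
def tensorDeg (n : ℕ) (q : ℤ) : Submodule k (⨂[k]^n (Tot V)) :=
  Submodule.span k {t | ∃ (a : Fin n → ℤ) (x : ∀ i, V.X (a i)), ∑ i, (a i - 1) = q ∧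
    t = PiTensorProduct.tprod k fun i => DirectSum.lof k ℤ (fun p => V.X p) (a i) (x i)}

variable {V}

lemma exists_sign (k : Type*) [Field k] (p : ℤ) :
    ∃ b, -((p.negOnePow : ℤ) : k) = boolSign k b := by
  rcases Int.units_eq_one_or p.negOnePow with h | h
  · exact ⟨true, by simp [h, boolSign]⟩
  · exact ⟨false, by simp [h, boolSign]⟩

lemma spar_lof (p : ℤ) (x : V.X p) : (-par V) (DirectSum.lof k ℤ (fun p => V.X p) p x) =
    (-((p.negOnePow : ℤ) : k)) • DirectSum.lof k ℤ (fun p => V.X p) p x := by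
  simp [par]

lemma tprod_mem_tensorDeg {n : ℕ} {a : Fin n → ℤ} {w : Fin n → Tot V}
    (hw : ∀ i, w i ∈ totDeg V (a i)) :
    PiTensorProduct.tprod k w ∈ tensorDeg V n (∑ i, (a i - 1)) := by
  choose x hx using hw
  exact Submodule.subset_span ⟨a, x, rfl, congrArg _ (funext fun i => (hx i).symm)⟩

lemma tensorDeg_induction {n : ℕ} {q : ℤ} {S : Submodule k (⨂[k]^n (Tot V))}
    (h : ∀ (a : Fin n → ℤ) (w : Fin n → Tot V), (∀ i, w i ∈ totDeg V (a i)) →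
      ∑ i, (a i - 1) = q → PiTensorProduct.tprod k w ∈ S) : tensorDeg V n q ≤ S := by
  refine Submodule.span_le.2 ?_
  rintro _ ⟨a, x, ha, rfl⟩
  exact h a _ (fun i => ⟨x i, rfl⟩) ha

lemma tensorCons_mem_tensorDeg {n : ℕ} {p q : ℤ} {v : Tot V} (hv : v ∈ totDeg V p)
    {t : ⨂[k]^n (Tot V)} (ht : t ∈ tensorDeg V n q) :
    tensorCons n v t ∈ tensorDeg V (n + 1) (p - 1 + q) := by
  refine tensorDeg_induction (S := (tensorDeg V (n + 1) (p - 1 + q)).comap (tensorCons n v))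
    (fun a w hw ha => ?_) ht
  rw [Submodule.mem_comap, tensorCons_tprod, ← ha]
  have := tprod_mem_tensorDeg (a := Fin.cons p a) (w := Fin.cons v w) fun i => by
    refine Fin.cases ?_ (fun i => ?_) i
    · exact hv
    · exact hw i
  rwa [Fin.sum_univ_succ] at this

variable [CharZero k]

lemma koszulAct_mem_tensorDeg {n : ℕ} {q : ℤ} (σ : Equiv.Perm (Fin n)) {t : ⨂[k]^n (Tot V)}
    (ht : t ∈ tensorDeg V n q) : koszulAct (-par V) σ t ∈ tensorDeg V n q := by
  refine tensorDeg_induction (S := (tensorDeg V n q).comap (koszulAct (-par V) σ))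
    (fun a w hw ha => ?_) ht
  have hb : ∀ i, ∃ b, (-par V) (w i) = boolSign k b • w i := fun i => by
    obtain ⟨x, hx⟩ := hw i
    obtain ⟨b, hb⟩ := exists_sign k (a i)
    exact ⟨b, by rw [← hx, spar_lof, hb]⟩
  choose b hb using hb
  rw [Submodule.mem_comap, koszulAct_pure σ hb, ← ha]
  have h := tprod_mem_tensorDeg fun i => hw (σ.symm i)
  rw [Equiv.sum_comp σ.symm fun i => a i - 1] at h
  exact Submodule.smul_mem _ _ h

lemma symProj_mem_tensorDeg {n : ℕ} {q : ℤ} {t : ⨂[k]^n (Tot V)} (ht : t ∈ tensorDeg V n q) :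
    (symProj (spar_spar V) n t : ⨂[k]^n (Tot V)) ∈ tensorDeg V n q := by
  change symmetrizer (-par V) n t ∈ _
  rw [symmetrizer, LinearMap.smul_apply, LinearMap.sum_apply]
  exact Submodule.smul_mem _ _ (Submodule.sum_mem _ fun σ _ => koszulAct_mem_tensorDeg σ ht)

omit [CharZero k] in
lemma coalgOf_mem_genDeg {n : ℕ} {p : ℤ} {c : SymPow (-par V) (n + 1)}
    (hc : (c : ⨂[k]^(n + 1) (Tot V)) ∈ tensorDeg V (n + 1) (p - 1)) :
    coalgOf V n c ∈ genDeg V p := by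
  refine (Submodule.mem_iInf _).2 fun m => ?_
  rw [Submodule.mem_comap]
  rcases eq_or_ne n m with rfl | h
  · rw [component_coalgOf_self]
    exact hc
  · rw [component_coalgOf_ne h]
    exact Submodule.zero_mem _

open InsertionCoalgebra

lemma symInsertion_isGrading : IsGrading (symInsertion V) (totDeg V) where
  pure p := by
    obtain ⟨b, hb⟩ := exists_sign k p
    refine ⟨b, ?_⟩
    rintro _ ⟨x, rfl⟩
    rw [← hb]
    exact spar_lof p x
  δ_mem := by
    rintro p _ ⟨x, rfl⟩
    refine ⟨-(V.d p (p + 1)).hom x, ?_⟩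
    change _ = -totD V (DirectSum.lof k ℤ (fun p => V.X p) p x)
    rw [map_neg, totD, DirectSum.toModule_lof]
    rfl

lemma mem_genDeg_of_isDegShuffle {p : ℤ} {x : SymCoalg V}
    (hx : IsDegShuffle (symInsertion V) (totDeg V) p x) : x ∈ genDeg V p := by
  suffices h : ∃ n c, x = coalgOf V n c ∧
      (c : ⨂[k]^(n + 1) (Tot V)) ∈ tensorDeg V (n + 1) (p - 1) by
    obtain ⟨n, c, rfl, hc⟩ := h
    exact coalgOf_mem_genDeg hc
  induction hx with
  | @incl p v hv =>
    refine ⟨0, _, inclGen_eq v, symProj_mem_tensorDeg ?_⟩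
    have h := tprod_mem_tensorDeg (n := 1) (a := fun _ => p) (w := fun _ => v) fun _ => hv
    rwa [Fin.sum_univ_one] at h
  | @L p q v x hv _ ih =>
    obtain ⟨n, c, rfl, hc⟩ := ih
    refine ⟨n + 1, ((n + 1 + 1 : ℕ) : k) • symProj (spar_spar V) (n + 1 + 1)
      (tensorCons (n + 1) v (c : ⨂[k]^(n + 1) (Tot V))),
      (shuffleVec_coalgOf v c).trans (map_smul _ _ _).symm,
      Submodule.smul_mem _ _ (symProj_mem_tensorDeg ?_)⟩
    have h := tensorCons_mem_tensorDeg hv hc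
    rwa [show p - 1 + (q - 1) = q + p - 1 - 1 by ring] at h

/-- Iterating `shuffleVec_tail` shows that the average of a pure tensor is a scalar multiple of a
shuffle. The first vector has degree `a 0` after desuspension, and each further vector adds its
suspended degree `a i - 1`, which explains the final `+ 1`. -/
lemma exists_isDegShuffle {n : ℕ} {a : Fin (n + 1) → ℤ} {w : Fin (n + 1) → Tot V}
    (hw : ∀ i, w i ∈ totDeg V (a i)) :
    ∃ (r : k) (x : SymCoalg V),
      IsDegShuffle (symInsertion V) (totDeg V) (∑ i, (a i - 1) + 1) x ∧
      coalgOf V n (symProj (spar_spar V) (n + 1) (PiTensorProduct.tprod k w)) = r • x := by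
  induction n with
  | zero =>
    refine ⟨1, inclGen V (w 0), ?_, ?_⟩
    · have h := IsDegShuffle.incl (X := symInsertion V) (hw 0)
      rwa [← sub_add_cancel (a 0) 1, ← Fin.sum_univ_one fun i => a i - 1] at h
    · rw [one_smul, inclGen_zero]
  | succ n ih =>
    obtain ⟨r, x, hx, h⟩ := ih (a := Fin.tail a) (w := Fin.tail w) fun i => hw i.succ
    refine ⟨((n + 1 + 1 : ℕ) : k)⁻¹ * r, shuffleVec V (w 0) x, ?_, ?_⟩
    · rw [show ∑ i, (a i - 1) + 1 = ∑ i, (Fin.tail a i - 1) + 1 + a 0 - 1 by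
        rw [Fin.sum_univ_succ]; simp only [Fin.tail]; ring]
      exact .L (hw 0) hx
    · rw [mul_smul, ← map_smul, ← h, shuffleVec_tail,
        inv_smul_smul₀ (by exact_mod_cast (n + 1).succ_ne_zero)]

lemma ι_mem_degSpace {p : ℤ} {x : SymCoalg V} (hx : x ∈ genDeg V p) :
    ι k x ∈ degSpace (symInsertion V) (totDeg V) p := by
  have key : ∀ n (c : SymPow (-par V) (n + 1)),
      (c : ⨂[k]^(n + 1) (Tot V)) ∈ tensorDeg V (n + 1) (p - 1) →
      ι k (coalgOf V n c) ∈ degSpace (symInsertion V) (totDeg V) p := fun n c hc => by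
    have h := tensorDeg_induction
      (S := (degSpace (symInsertion V) (totDeg V) p).comap
        (ι k ∘ₗ coalgOf V n ∘ₗ symProj (spar_spar V) (n + 1))) (fun a w hw ha => by
        obtain ⟨r, x, hx, h⟩ := exists_isDegShuffle hw
        rw [Submodule.mem_comap, LinearMap.comp_apply, LinearMap.comp_apply, h, map_smul]
        rw [ha, sub_add_cancel] at hx
        exact Submodule.smul_mem _ _ hx.ι_mem) hc
    rwa [Submodule.mem_comap, LinearMap.comp_apply, LinearMap.comp_apply, symProj_of_mem] at h
  classical
  rw [← DirectSum.sum_support_of x, map_sum]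
  exact Submodule.sum_mem _ fun n _ => key n _ ((Submodule.mem_iInf _).1 hx n)

/-- Shuffles of homogeneous vectors are homogeneous generators, and conversely averaging writes a
homogeneous generator as a combination of such shuffles. So the grading by words of shuffles, in
which degrees were tracked, is the intended one. -/
lemma cobarDeg_eq (q : ℤ) : cobarDeg V q = degSpace (symInsertion V) (totDeg V) q := by
  refine le_antisymm (Submodule.span_le.2 ?_) (Submodule.span_le.2 fun t ht => ?_)
  · rintro _ ⟨n, a, x, hx, rfl, rfl⟩
    exact tprod_mem_degSpace fun i => ι_mem_degSpace (hx i)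
  · obtain ⟨n, a, x, hx, ha, h⟩ := IsDegWord.exists_tprod ht
    exact Submodule.subset_span ⟨n, a, x, fun i => mem_genDeg_of_isDegShuffle (hx i), ha, h⟩

end Degree

end SymCobar
end

noncomputable section

namespace SymCobar

/-! ### Assembly of the theorem -/

variable {k : Type u} [Field k] [CharZero k] (V : CochainComplex (ModuleCat.{v} k) ℤ)

lemma iotaOmega_eq : iotaOmega V = (symInsertion V).J :=
  cobarAntiInv_eq (symInsertion V).ε_comp_ε

variable {V} in
lemma avgProj_avgProj (a : CobarSym V) :
    (symInsertion V).avgProj ((symInsertion V).avgProj a) = (symInsertion V).avgProj a := by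
  rw [← gMap_fMap, ← gMap_fMap a, fMap_gMap]

end SymCobar
end

theorem theorem1 (k : Type u) [Field k] [CharZero k] :
    -- `A(V)` and `E(V)` are complexes, and `f_V` and `g_V` are maps of complexes
    (∀ V : CochainComplex (ModuleCat.{v} k) ℤ,
      (∀ a, SymCobar.cobarSymD V (SymCobar.cobarSymD V a) = 0) ∧
      (∀ x, SymCobar.symAlgD V (SymCobar.symAlgD V x) = 0) ∧
      (∀ a, SymCobar.fMap V (SymCobar.cobarSymD V a) =
        SymCobar.symAlgD V (SymCobar.fMap V a)) ∧
      (∀ x, SymCobar.gMap V (SymCobar.symAlgD V x) =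
        SymCobar.cobarSymD V (SymCobar.gMap V x))) ∧
    -- `f_V g_V = 1`
    (∀ (V : CochainComplex (ModuleCat.{v} k) ℤ) (x : SymCobar.SymAlg V),
      SymCobar.fMap V (SymCobar.gMap V x) = x) ∧
    ∃ h : ∀ V : CochainComplex (ModuleCat.{v} k) ℤ,
        SymCobar.CobarSym V →ₗ[k] SymCobar.CobarSym V,
      -- `h_V` has degree `-1`
      (∀ (V : CochainComplex (ModuleCat.{v} k) ℤ) (p : ℤ), ∀ a ∈ SymCobar.cobarDeg V p,
        h V a ∈ SymCobar.cobarDeg V (p - 1)) ∧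
      -- `1 - g_V f_V = d h_V + h_V d`
      (∀ (V : CochainComplex (ModuleCat.{v} k) ℤ) (a : SymCobar.CobarSym V),
        a - SymCobar.gMap V (SymCobar.fMap V a) =
          SymCobar.cobarSymD V (h V a) + h V (SymCobar.cobarSymD V a)) ∧
      -- the side conditions
      (∀ (V : CochainComplex (ModuleCat.{v} k) ℤ) (a : SymCobar.CobarSym V),
        SymCobar.fMap V (h V a) = 0) ∧
      (∀ (V : CochainComplex (ModuleCat.{v} k) ℤ) (x : SymCobar.SymAlg V),
        h V (SymCobar.gMap V x) = 0) ∧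
      (∀ (V : CochainComplex (ModuleCat.{v} k) ℤ) (a : SymCobar.CobarSym V),
        h V (h V a) = 0) ∧
      -- naturality in morphisms of complexes
      (∀ (V W : CochainComplex (ModuleCat.{v} k) ℤ) (φ : V ⟶ W) (a : SymCobar.CobarSym V),
        h W (SymCobar.cobarSymMap φ a) = SymCobar.cobarSymMap φ (h V a)) ∧
      -- `h_V` commutes with the anti-involution
      (∀ (V : CochainComplex (ModuleCat.{v} k) ℤ) (a : SymCobar.CobarSym V),
        h V (SymCobar.iotaOmega V a) = SymCobar.iotaOmega V (h V a)) := by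
  have H V := (SymCobar.symInsertion (k := k) V).contraction_spec SymCobar.avgProj_avgProj
  refine ⟨fun V => ⟨SymCobar.cobarSymD_cobarSymD, SymCobar.symAlgD_symAlgD, SymCobar.fMap_D,
    SymCobar.gMap_symAlgD⟩, fun V => SymCobar.fMap_gMap,
    fun V => (SymCobar.symInsertion V).contraction, fun V p a ha => ?_, fun V a => ?_, fun V a => ?_,
    fun V x => ?_, fun V => ?_, fun V W φ a => ?_, fun V a => ?_⟩
  · rw [SymCobar.cobarDeg_eq] at ha ⊢
    exact SymCobar.InsertionCoalgebra.contraction_mem_degSpace _ SymCobar.symInsertion_isGrading ha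
  · rw [SymCobar.gMap_fMap]
    exact ((H V).1 a).symm
  -- Here `f h = f (g f) h`, and `g f h = 0` by the contraction identities.
  · rw [← SymCobar.fMap_gMap (SymCobar.fMap V _), SymCobar.gMap_fMap,
      (H V).2.1, map_zero]
  -- Here `h g = h (g f) g`, and `h g f = 0`.
  · have h := (H V).2.2.1 (SymCobar.gMap V x)
    rwa [← SymCobar.gMap_fMap, SymCobar.fMap_gMap] at h
  · exact (H V).2.2.2.1
  · exact ((SymCobar.symInsertion_isMorphism φ).contraction a).symm
  · rw [SymCobar.iotaOmega_eq]
    exact ((H V).2.2.2.2 a).symm
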